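/- Conventions. For a smooth function germ $f:(\mathbb R^2,0)\to(\mathbb R,0)$ write $j^2f(0)=c_{00}+c_{10}x+c_{11}y+c_{20}x^2+c_{21}xy+c_{22}y^2$. The germ $f$ has an $A_1^+$ singularity if $c_{00}=c_{10}=c_{11}=0$ and $c_{21}^2-4c_{20}c_{22}<0$. The origin is an umbilic point of $f$ if it is an umbilic point of the surface $z=f(x,y)$; for an $A_1^+$ singularity this means $c_{20}=c_{22}$ and $c_{21}=0$. A deformation of $f$ is a smooth germ $F(x,y,u)$ with $F(x,y,0)=f(x,y)$; write $F_u=F(\cdot,\cdot,u)$. It is $\mathcal A$-versal if every deformation $G(x,y,v)$ of $f$, with any number of parameters, has the form $G(p,v)=\Psi\big(F(\Phi(p,v),h(v)),v\big)$ with smooth germs $\Phi,\Psi,h$ such that $\Phi(p,0)=p$, $\Psi(y,0)=y$, $\Psi(0,v)=0$, $h(0)=0$ (so the changes of coordinates in the target preserve the zero level; $\mathcal R_e$-versal deformations are the case $\Psi(y,v)=y$ and are included). For a function $g$ near $0\in\mathbb R^2$ and small $\varepsilon>0$ consider the curve $g=0$ in the open disc $D_\varepsilon$ of radius $\varepsilon$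 about $0$. Its inflections are its points where $i_g=g_{xx}g_y^2-2g_{xy}g_xg_y+g_{yy}g_x^2=0$, and its vertices are its points where $v_g=0$, with $$\begin{aligned}v_g={}&(g_x^2+g_y^2)\left(-g_x^3g_{yyy}+3g_x^2g_yg_{xyy}-3g_xg_y^2g_{xxy}+g_y^3g_{xxx}\right)+3g_xg_y(g_{yy}-g_{xx})(g_x^2g_{yy}+g_{xx}g_y^2)\\&+6g_xg_yg_{xy}^2(g_y^2-g_x^2)+3g_{xy}\left(g_x^4g_{yy}+3g_x^2g_y^2(g_{xx}-g_{yy})-g_{xx}g_y^4\right)\end{aligned}$$ (the numerators of the curvature and of its derivative along the curve). Two such curves have the same geometry in $D_\varepsilon$ if (i) a diffeomorphism between open neighbourhoods of them in the plane carries one onto the other; (ii) they have the same number of inflections and the same number of vertices; (iii) some homeomorphism of $D_\varepsilon$ carries one curve onto the other and its singular points, self-intersections, inflections and vertices onto those of the other. Two deformations $F,\tilde F$ of $f$ with parameter space $\mathbb R^m$ are FRS-equivalent if there are a germ of homeomorphism $k:(\mathbb R^m,0)\to(\mathbb R^m,0)$ and germs of stratifications $S_1,S_2$ of $(\mathbb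 R^m,0)$ (finite partitions into connected smooth submanifolds with the frontier condition) such that $k$ maps the strata of $S_1$ onto strata of $S_2$ and, for every sufficiently small $\varepsilon>0$ and all parameters sufficiently close to $0$ (depending on $\varepsilon$): $F_{s}=0$ and $F_{s'}=0$ have the same geometry in $D_\varepsilon$ if $s,s'$ lie in the same stratum of $S_1$; likewise for $\tilde F$ and $S_2$; and $F_s=0$ and $\tilde F_{k(s)}=0$ have the same geometry in $D_\varepsilon$. Theorem. (a) Being non-umbilic is a generic condition on $A_1^+$ singularities: the set of umbilic $2$-jets is closed in the space of $2$-jets, and the non-umbilic $A_1^+$ jets are dense among the $A_1^+$ jets. (b) Let $f:(\mathbb R^2,0)\to(\mathbb R,0)$ be a smooth function germ with an $A_1^+$ singularity such that the origin is not an umbilic point of $f$. Then every $1$-parameter $\mathcal A$-versal deformation of $f$ is FRS-equivalent to $F(x,y,t)=f(x,y)+t$. Moreover there is a sign $\sigma\in\{1,-1\}$ such that for every sufficiently small $\varepsilon>0$ there is $\delta>0$ such that for all $0<t<\delta$: the curve $F_{\sigma t}=0$ has exactly four vertices and no inflections in $D_\varepsilon$, and the curve $F_{-\sigma t}=0$ is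 empty in $D_\varepsilon$. -/

import Mathlib

open Set Filter
open scoped Topology ContDiff

noncomputable section

namespace PlaneCurve

/-! ### Germs of smooth functions, jets, singularities -/

/-- `g` represents a germ of smooth map at `x`: it is smooth on a neighbourhood of `x`. -/
def SmoothGermAt {E F : Type*} [NormedAddCommGroup E] [NormedSpace ℝ E]
    [NormedAddCommGroup F] [NormedSpace ℝ F] (g : E → F) (x : E) : Prop :=
  ∀ᶠ y in 𝓝 x, ContDiffAt ℝ ∞ g y

/-- Partial derivative in the first variable of a function on the plane. -/
def dx (g : ℝ × ℝ → ℝ) : ℝ × ℝ → ℝ := fun p => fderiv ℝ g p (1, 0)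

/-- Partial derivative in the second variable of a function on the plane. -/
def dy (g : ℝ × ℝ → ℝ) : ℝ × ℝ → ℝ := fun p => fderiv ℝ g p (0, 1)

/-- The 2-jet space: `(c₀₀, c₁₀, c₁₁, c₂₀, c₂₁, c₂₂)` stands for the polynomial
`c₀₀ + c₁₀ x + c₁₁ y + c₂₀ x² + c₂₁ x y + c₂₂ y²`. -/
abbrev Jet2 : Type := ℝ × ℝ × ℝ × ℝ × ℝ × ℝ

/-- The 2-jet of `g` at the point `p`. -/
def jet2 (g : ℝ × ℝ → ℝ) (p : ℝ × ℝ) : Jet2 :=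
  (g p, dx g p, dy g p, dx (dx g) p / 2, dy (dx g) p, dy (dy g) p / 2)

/-- The 2-jets of functions vanishing at the base point with an `A₁⁺`-singularity there:
no constant or linear term, and a definite quadratic part. -/
def A1PlusJets : Set Jet2 :=
  {c | ∃ c20 c21 c22 : ℝ, c = (0, 0, 0, c20, c21, c22) ∧ c21 ^ 2 - 4 * c20 * c22 < 0}

/-- The 2-jets of functions `g` such that the graph `z = g(x,y)` has an umbilic point over the
base point: there, the second fundamental form is a multiple of the first fundamental form.
(The normalising factor `√(1 + gₓ² + g_y²)` is absorbed in `lam`.) -/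
def UmbilicJets : Set Jet2 :=
  {c | ∃ c00 c10 c11 c20 c21 c22 lam : ℝ, c = (c00, c10, c11, c20, c21, c22) ∧
    2 * c20 = lam * (1 + c10 ^ 2) ∧ c21 = lam * (c10 * c11) ∧ 2 * c22 = lam * (1 + c11 ^ 2)}

/-- `f : (ℝ², 0) → (ℝ, 0)` has an `A₁⁺`-singularity at the origin. -/
def HasA1Plus (f : ℝ × ℝ → ℝ) : Prop := jet2 f 0 ∈ A1PlusJets

/-- The origin is an umbilic point of `f = 0`, i.e. of the surface `z = f(x,y)`. -/
def IsUmbilicAtOrigin (f : ℝ × ℝ → ℝ) : Prop := jet2 f 0 ∈ UmbilicJets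

/-! ### Inflections and vertices of implicit curves -/

/-- Numerator of the curvature of the level curves of `g`. -/
def inflFun (g : ℝ × ℝ → ℝ) (p : ℝ × ℝ) : ℝ :=
  dx (dx g) p * dy g p ^ 2 - 2 * dy (dx g) p * dx g p * dy g p + dy (dy g) p * dx g p ^ 2

/-- Numerator of the derivative of the curvature along the level curves of `g`. -/
def vertFun (g : ℝ × ℝ → ℝ) (p : ℝ × ℝ) : ℝ :=
  let gx := dx g p
  let gy := dy g p
  let gxx := dx (dx g) p
  let gxy := dy (dx g) p
  let gyy := dy (dy g) p
  let gxxx := dx (dx (dx g)) p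
  let gxxy := dy (dx (dx g)) p
  let gxyy := dy (dy (dx g)) p
  let gyyy := dy (dy (dy g)) p
  (gx ^ 2 + gy ^ 2) *
      (-gx ^ 3 * gyyy + 3 * gx ^ 2 * gy * gxyy - 3 * gx * gy ^ 2 * gxxy + gy ^ 3 * gxxx)
    + 3 * gx * gy * (gyy - gxx) * (gx ^ 2 * gyy + gxx * gy ^ 2)
    + 6 * gx * gy * gxy ^ 2 * (gy ^ 2 - gx ^ 2)
    + 3 * gxy * (gx ^ 4 * gyy + 3 * gx ^ 2 * gy ^ 2 * (gxx - gyy) - gxx * gy ^ 4)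

/-- The open Euclidean disc of radius `ε` about the origin. -/
def disc (ε : ℝ) : Set (ℝ × ℝ) := {p | p.1 ^ 2 + p.2 ^ 2 < ε ^ 2}

/-- The curve `g = 0` in the disc of radius `ε`. -/
def curve (g : ℝ × ℝ → ℝ) (ε : ℝ) : Set (ℝ × ℝ) := {p | p ∈ disc ε ∧ g p = 0}

/-- Inflections of the curve `g = 0` (singular points count as inflections). -/
def inflections (g : ℝ × ℝ → ℝ) (ε : ℝ) : Set (ℝ × ℝ) := {p | p ∈ curve g ε ∧ inflFun g p = 0}

/-- Vertices of the curve `g = 0` (singular points count as vertices). -/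
def vertices (g : ℝ × ℝ → ℝ) (ε : ℝ) : Set (ℝ × ℝ) := {p | p ∈ curve g ε ∧ vertFun g p = 0}

/-- Singular points of the curve `g = 0`. -/
def singularPoints (g : ℝ × ℝ → ℝ) (ε : ℝ) : Set (ℝ × ℝ) :=
  {p | p ∈ curve g ε ∧ dx g p = 0 ∧ dy g p = 0}

/-- Points of self-intersection of the curve `g = 0`: points through which pass two arcs of the
curve that have no other point in common. -/
def selfIntersections (g : ℝ × ℝ → ℝ) (ε : ℝ) : Set (ℝ × ℝ) :=
  {p | ∃ γ₁ γ₂ : ℝ → ℝ × ℝ, Continuous γ₁ ∧ Continuous γ₂ ∧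
    Function.Injective γ₁ ∧ Function.Injective γ₂ ∧ γ₁ 0 = p ∧ γ₂ 0 = p ∧
    range γ₁ ⊆ curve g ε ∧ range γ₂ ⊆ curve g ε ∧ range γ₁ ∩ range γ₂ = {p}}

/-! ### Comparison of two curves -/

/-- Two plane curves are diffeomorphic: there is a smooth diffeomorphism between open
neighbourhoods of them in the plane which carries one onto the other. -/
def CurvesDiffeomorphic (X Y : Set (ℝ × ℝ)) : Prop :=
  ∃ φ : OpenPartialHomeomorph (ℝ × ℝ) (ℝ × ℝ), X ⊆ φ.source ∧ Y ⊆ φ.target ∧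
    ContDiffOn ℝ ∞ φ φ.source ∧ ContDiffOn ℝ ∞ φ.symm φ.target ∧ φ '' X = Y

/-- Two curves in the disc have their singularities, self-intersections, inflections and vertices
in the same relative position: a homeomorphism of the disc carries the one curve to the other and
each of these kinds of points of the one to the points of the same kind of the other. -/
def SameRelativePosition (g₁ g₂ : ℝ × ℝ → ℝ) (ε : ℝ) : Prop :=
  ∃ h : disc ε ≃ₜ disc ε, ∀ p : disc ε,
    ((p : ℝ × ℝ) ∈ curve g₁ ε ↔ (h p : ℝ × ℝ) ∈ curve g₂ ε) ∧
    ((p : ℝ × ℝ) ∈ singularPoints g₁ ε ↔ (h p : ℝ × ℝ) ∈ singularPoints g₂ ε) ∧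
    ((p : ℝ × ℝ) ∈ selfIntersections g₁ ε ↔ (h p : ℝ × ℝ) ∈ selfIntersections g₂ ε) ∧
    ((p : ℝ × ℝ) ∈ inflections g₁ ε ↔ (h p : ℝ × ℝ) ∈ inflections g₂ ε) ∧
    ((p : ℝ × ℝ) ∈ vertices g₁ ε ↔ (h p : ℝ × ℝ) ∈ vertices g₂ ε)

/-- The three conditions compared in FRS-equivalence, for the curves `g₁ = 0` and `g₂ = 0` in the
disc of radius `ε`: they are diffeomorphic, have the same numbers of inflections and of vertices,
and have the same relative position of the special points. -/
def SameGeometry (g₁ g₂ : ℝ × ℝ → ℝ) (ε : ℝ) : Prop :=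
  CurvesDiffeomorphic (curve g₁ ε) (curve g₂ ε) ∧
  ((inflections g₁ ε).encard = (inflections g₂ ε).encard ∧
    (vertices g₁ ε).encard = (vertices g₂ ε).encard) ∧
  SameRelativePosition g₁ g₂ ε

/-! ### Deformations and versality -/

section Deformations

variable {P : Type*} [NormedAddCommGroup P] [NormedSpace ℝ P]

/-- `F` is a deformation of the germ `f` at the origin, with parameter space `P`. -/
def IsDeformation (f : ℝ × ℝ → ℝ) (F : (ℝ × ℝ) × P → ℝ) : Prop :=
  SmoothGermAt F 0 ∧ ∀ᶠ p in 𝓝 (0 : ℝ × ℝ), F (p, 0) = f p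

/-- `F` is an `𝒜`-versal deformation of `f`: every deformation `G` of `f`, with any number `q` of
parameters, is obtained from `F` by a smooth change of parameters `h`, a smooth family `Φ` of
changes of coordinates in the source (which may move the origin) and a smooth family `Ψ` of changes
of coordinates in the target which fix `0`, so that zero sets correspond. -/
def IsAVersal (f : ℝ × ℝ → ℝ) (F : (ℝ × ℝ) × P → ℝ) : Prop :=
  IsDeformation f F ∧
  ∀ (q : ℕ) (G : (ℝ × ℝ) × EuclideanSpace ℝ (Fin q) → ℝ), IsDeformation f G →
    ∃ (Φ : (ℝ × ℝ) × EuclideanSpace ℝ (Fin q) → ℝ × ℝ)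
      (Ψ : ℝ × EuclideanSpace ℝ (Fin q) → ℝ) (h : EuclideanSpace ℝ (Fin q) → P),
      SmoothGermAt Φ 0 ∧ SmoothGermAt Ψ 0 ∧ SmoothGermAt h 0 ∧
      (∀ᶠ p in 𝓝 (0 : ℝ × ℝ), Φ (p, 0) = p) ∧
      (∀ᶠ y in 𝓝 (0 : ℝ), Ψ (y, 0) = y) ∧
      (∀ᶠ v in 𝓝 (0 : EuclideanSpace ℝ (Fin q)), Ψ (0, v) = 0) ∧
      h 0 = 0 ∧
      ∀ᶠ z in 𝓝 (0 : (ℝ × ℝ) × EuclideanSpace ℝ (Fin q)),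
        G z = Ψ (F (Φ z, h z.2), z.2)

/-- The member of a deformation at the parameter `s`. -/
def member (F : (ℝ × ℝ) × P → ℝ) (s : P) : ℝ × ℝ → ℝ := fun p => F (p, s)

/-! ### Stratifications and FRS-equivalence -/

/-- `A` is a (locally closed) smooth submanifold of `P`: near each of its points, a smooth change
of coordinates straightens it to a linear subspace. -/
def IsSmoothSubmanifold (A : Set P) : Prop :=
  ∀ x ∈ A, ∃ (φ : OpenPartialHomeomorph P P) (V : Submodule ℝ P), x ∈ φ.source ∧
    ContDiffOn ℝ ∞ φ φ.source ∧ ContDiffOn ℝ ∞ φ.symm φ.target ∧ φ.IsImage A (V : Set P)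

/-- `S` is a stratification of `W`: a finite partition of `W` into connected smooth submanifolds
with the frontier condition. -/
structure IsStratification (W : Set P) (S : Set (Set P)) : Prop where
  finite : S.Finite
  cover : ⋃₀ S = W
  disjoint : S.PairwiseDisjoint id
  connected : ∀ A ∈ S, IsConnected A
  submanifold : ∀ A ∈ S, IsSmoothSubmanifold A
  frontier : ∀ A ∈ S, ∀ B ∈ S, (closure A ∩ B).Nonempty → B ⊆ closure A

/-- The stratification germ `S` at the origin is adapted to the deformation `F` in the disc of
radius `ε`: over the parameters near the origin, curves in the same stratum have the same
geometry. -/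
def IsAdapted (S : Set (Set P)) (F : (ℝ × ℝ) × P → ℝ) (ε : ℝ) : Prop :=
  ∃ N ∈ 𝓝 (0 : P), ∀ A ∈ S, ∀ s₁ ∈ A ∩ N, ∀ s₂ ∈ A ∩ N,
    SameGeometry (member F s₁) (member F s₂) ε

/-- FRS-equivalence of two germs of deformations with the same parameter space: there is a germ of
homeomorphism `k` of the parameter space at the origin which carries the strata of a stratification
adapted to `F₁` onto those of a stratification adapted to `F₂`, such that corresponding curves have
the same geometry. The curves are germs at the origin of the plane: they are compared in all
sufficiently small discs, for parameters close to the origin (depending on the disc). -/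
def FRSEquiv (F₁ F₂ : (ℝ × ℝ) × P → ℝ) : Prop :=
  ∃ (k : OpenPartialHomeomorph P P) (S₁ S₂ : Set (Set P)),
    0 ∈ k.source ∧ k 0 = 0 ∧
    IsStratification k.source S₁ ∧ IsStratification k.target S₂ ∧
    (∀ A ∈ S₁, k '' A ∈ S₂) ∧
    ∃ ε₀ > 0, ∀ ε : ℝ, 0 < ε → ε < ε₀ →
      IsAdapted S₁ F₁ ε ∧ IsAdapted S₂ F₂ ε ∧
      ∀ᶠ s in 𝓝 (0 : P), SameGeometry (member F₁ s) (member F₂ (k s)) ε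

end Deformations

/-- The 1-parameter deformation `f(x,y) + t`. -/
def addParam (f : ℝ × ℝ → ℝ) : (ℝ × ℝ) × ℝ → ℝ := fun z => f z.1 + z.2

end PlaneCurve

end

open Set Filter Asymptotics
open scoped Topology ContDiff

namespace PlaneCurve

/-! ### Gauges and radial homeomorphisms of the plane -/

/-! After changing the sign of the values and of the parameter if necessary, `f` has a nondegenerate
minimum at the origin and `∂F/∂t < 0` there. Let `u, w` be coordinates along the principal axes of
the Hessian, and `A, B > 0` its eigenvalues. For small `t > 0` the zero curve of `F_t` resembles a
small ellipse `A u² + B w² = const · t`, and for `t < 0` it is empty.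

Points of the curve satisfy `t = O(‖p‖²)`. On such a parabolic region the gradient of `F_t` has
leading part `(A u, B w)`, the inflection function has leading form `A B (A u² + B w²)`, and the
vertex function has leading form `K u w (A u² + B w²)` with `K = 3 (A B)² (B - A)`. Third
derivatives enter the vertex function only at order five. The inflection form is definite, so there
are no inflections. Non-umbilicity says `A ≠ B`, hence `K ≠ 0`, and the vertex form vanishes only
along the two axes, which cut the ellipse in four points.

The work is to make this stable in a disc of fixed radius as `t → 0`. The function is negative for
`‖p‖ ≤ r` with `r` of order `√t`, and the estimates hold for all `‖p‖ ≥ r / 4` in the disc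
(`exists_isOval`). Zeros of the vertex function are confined to four narrow sectors
(`ModelBounds.mem_sector`). Each sector contains a vertex by the intermediate value theorem
(`ModelBounds.exists_mem_sector`), and only one, because chords of the curve are nearly tangential
while chords of the vertex locus are nearly radial (`ModelBounds.eq_of_mem_sector`).

For the comparison of curves, positivity of the radial derivative makes the zero curve star-shaped,
so that it is the unit level of a gauge that is smooth off the origin (`exists_gauge`).
Ray-preserving maps then give the diffeomorphism, and a homeomorphism from the disc to the plane
taking the curve to the unit circle and the vertices to four standard points
(`isOval_of_modelBounds`). All such ovals therefore have the same geometry.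

Versality enters only through `∂F/∂t ≠ 0` at the origin (`IsAVersal.fderiv_ne_zero`). The parameter
line is stratified by sign, and the parameter change is `s ↦ ± s`. Genericity of non-umbilic jets
follows since umbilicity amounts to two polynomial equations. -/

/-- The square of the Euclidean norm on the plane. -/
def normSq (p : ℝ × ℝ) : ℝ := p.1 ^ 2 + p.2 ^ 2

lemma normSq_nonneg (p : ℝ × ℝ) : 0 ≤ normSq p := by unfold normSq; positivity

lemma normSq_smul (s : ℝ) (p : ℝ × ℝ) : normSq (s • p) = s ^ 2 * normSq p := by
  simp only [normSq, Prod.smul_fst, Prod.smul_snd, smul_eq_mul]; ring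

lemma normSq_pos {p : ℝ × ℝ} (hp : p ≠ 0) : 0 < normSq p := by
  refine lt_of_le_of_ne (normSq_nonneg p) fun h => hp ?_
  have h' : p.1 ^ 2 + p.2 ^ 2 = 0 := h.symm
  exact Prod.ext (pow_eq_zero_iff two_ne_zero |>.1 (by nlinarith [sq_nonneg p.1, sq_nonneg p.2]))
    (pow_eq_zero_iff two_ne_zero |>.1 (by nlinarith [sq_nonneg p.1, sq_nonneg p.2]))

lemma contDiff_normSq : ContDiff ℝ ∞ normSq := by unfold normSq; fun_prop

lemma continuous_normSq : Continuous normSq := contDiff_normSq.continuous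

lemma norm_sq_le_normSq (p : ℝ × ℝ) : ‖p‖ ^ 2 ≤ normSq p := by
  rw [Prod.norm_def, normSq]
  rcases max_choice ‖p.1‖ ‖p.2‖ with h | h <;> rw [h, Real.norm_eq_abs, sq_abs] <;>
    nlinarith [sq_nonneg p.1, sq_nonneg p.2]

lemma normSq_le_norm_sq (p : ℝ × ℝ) : normSq p ≤ 2 * ‖p‖ ^ 2 := by
  have h1 : |p.1| ≤ ‖p‖ := norm_fst_le p
  have h2 : |p.2| ≤ ‖p‖ := norm_snd_le p
  have := sq_le_sq' (by linarith [abs_nonneg p.1, norm_nonneg p]) h1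
  have := sq_le_sq' (by linarith [abs_nonneg p.2, norm_nonneg p]) h2
  rw [sq_abs] at *
  unfold normSq; linarith

/-- A continuous positively homogeneous function, positive away from the origin. -/
structure IsGauge (M : ℝ × ℝ → ℝ) : Prop where
  cont : Continuous M
  pos : ∀ p, p ≠ 0 → 0 < M p
  homog : ∀ s, 0 < s → ∀ p, M (s • p) = s * M p

namespace IsGauge

variable {M M₁ M₂ : ℝ × ℝ → ℝ}

lemma zero (h : IsGauge M) : M 0 = 0 := by
  have := h.homog 2 two_pos 0
  rw [smul_zero] at this; linarith

lemma nonneg (h : IsGauge M) (p : ℝ × ℝ) : 0 ≤ M p := by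
  rcases eq_or_ne p 0 with rfl | hp
  · rw [h.zero]
  · exact (h.pos p hp).le

/-- By homogeneity it is enough to bound `M` below on the unit sphere, where compactness gives a
positive minimum. The bound controls the radial maps at the origin. -/
lemma exists_norm_le (h : IsGauge M) : ∃ C > 0, ∀ p, ‖p‖ ≤ C * M p := by
  obtain ⟨q, hq, hmin⟩ := (isCompact_sphere (0 : ℝ × ℝ) 1).exists_isMinOn
    ⟨(1, 0), by simp [Prod.norm_def]⟩ h.cont.continuousOn
  have hq0 : q ≠ 0 := by rintro rfl; simp at hq
  have hMq := h.pos q hq0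
  refine ⟨(M q)⁻¹, inv_pos.2 hMq, fun p => ?_⟩
  rcases eq_or_ne p 0 with rfl | hp
  · simp [h.zero]
  have hn : 0 < ‖p‖ := norm_pos_iff.2 hp
  have hmem : ‖p‖⁻¹ • p ∈ Metric.sphere (0 : ℝ × ℝ) 1 := by
    simp [norm_smul, hn.ne']
  have := hmin hmem
  simp only [mem_ofPred_eq] at this
  rw [h.homog _ (inv_pos.2 hn)] at this
  rw [← div_eq_inv_mul, le_div_iff₀ hMq]
  rw [← div_eq_inv_mul, le_div_iff₀ hn] at this
  linarith

lemma radial_aux (h₁ : IsGauge M₁) (h₂ : IsGauge M₂) {p : ℝ × ℝ} (hp : p ≠ 0) :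
    (M₂ ((M₁ p / M₂ p) • p) / M₁ ((M₁ p / M₂ p) • p)) • ((M₁ p / M₂ p) • p) = p := by
  have p1 := h₁.pos p hp
  have p2 := h₂.pos p hp
  rw [h₁.homog _ (div_pos p1 p2), h₂.homog _ (div_pos p1 p2), smul_smul]
  have : M₁ p / M₂ p * M₂ p / (M₁ p / M₂ p * M₁ p) * (M₁ p / M₂ p) = 1 := by field_simp
  rw [this, one_smul]

lemma continuous_radial (h₁ : IsGauge M₁) (h₂ : IsGauge M₂) :
    Continuous fun p => (M₁ p / M₂ p) • p := by
  rw [continuous_iff_continuousAt]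
  intro p
  rcases eq_or_ne p 0 with rfl | hp
  · obtain ⟨C, hC, hle⟩ := h₂.exists_norm_le
    have hlim : Tendsto (fun p => C * M₁ p) (𝓝 0) (𝓝 0) := by
      have := (h₁.cont.const_mul C).tendsto' 0 0 (by rw [h₁.zero, mul_zero])
      exact this
    show Tendsto _ _ _
    simp only [smul_zero]
    refine squeeze_zero_norm (fun p => ?_) hlim
    rcases eq_or_ne p 0 with rfl | hp
    · simp [h₁.zero]
    have p2 := h₂.pos p hp
    rw [norm_smul, Real.norm_eq_abs, abs_of_nonneg (div_nonneg (h₁.nonneg p) p2.le),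
      div_mul_eq_mul_div, div_le_iff₀ p2]
    calc M₁ p * ‖p‖ ≤ M₁ p * (C * M₂ p) := mul_le_mul_of_nonneg_left (hle p) (h₁.nonneg p)
      _ = C * M₁ p * M₂ p := by ring
  · exact (h₁.cont.continuousAt.div h₂.cont.continuousAt (h₂.pos p hp).ne').smul continuousAt_id

/-- The homeomorphism of the plane that preserves rays and carries the gauge `M₁` to `M₂`. -/
noncomputable def radialHomeo (h₁ : IsGauge M₁) (h₂ : IsGauge M₂) : ℝ × ℝ ≃ₜ ℝ × ℝ where
  toFun p := (M₁ p / M₂ p) • p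
  invFun p := (M₂ p / M₁ p) • p
  left_inv p := by
    rcases eq_or_ne p 0 with rfl | hp
    · simp
    · exact radial_aux h₁ h₂ hp
  right_inv p := by
    rcases eq_or_ne p 0 with rfl | hp
    · simp
    · exact radial_aux h₂ h₁ hp
  continuous_toFun := continuous_radial h₁ h₂
  continuous_invFun := continuous_radial h₂ h₁

lemma radialHomeo_apply (h₁ : IsGauge M₁) (h₂ : IsGauge M₂) (p : ℝ × ℝ) :
    h₁.radialHomeo h₂ p = (M₁ p / M₂ p) • p := rfl

lemma radialHomeo_symm_apply (h₁ : IsGauge M₁) (h₂ : IsGauge M₂) (p : ℝ × ℝ) :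
    (h₁.radialHomeo h₂).symm p = (M₂ p / M₁ p) • p := rfl

lemma radialHomeo_ne_zero (h₁ : IsGauge M₁) (h₂ : IsGauge M₂) {p : ℝ × ℝ} (hp : p ≠ 0) :
    h₁.radialHomeo h₂ p ≠ 0 := by
  rw [radialHomeo_apply]
  exact smul_ne_zero (div_pos (h₁.pos p hp) (h₂.pos p hp)).ne' hp

lemma apply_radialHomeo (h₁ : IsGauge M₁) (h₂ : IsGauge M₂) (p : ℝ × ℝ) :
    M₂ (h₁.radialHomeo h₂ p) = M₁ p := by
  rcases eq_or_ne p 0 with rfl | hp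
  · simp [radialHomeo_apply, h₁.zero, h₂.zero]
  · have p1 := h₁.pos p hp
    have p2 := h₂.pos p hp
    rw [radialHomeo_apply, h₂.homog _ (div_pos p1 p2), div_mul_cancel₀ _ p2.ne']

lemma ne_zero_of_eq_one (h : IsGauge M) {p : ℝ × ℝ} (hp : M p = 1) : p ≠ 0 := by
  rintro rfl; rw [h.zero] at hp; exact zero_ne_one hp

/-- The radial map is smooth with smooth inverse away from the origin, and the unit levels avoid the
origin; hence the restriction to the punctured plane. -/
lemma curvesDiffeomorphic (h₁ : IsGauge M₁) (h₂ : IsGauge M₂)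
    (s₁ : ∀ p, p ≠ 0 → ContDiffAt ℝ ∞ M₁ p) (s₂ : ∀ p, p ≠ 0 → ContDiffAt ℝ ∞ M₂ p) :
    CurvesDiffeomorphic {p | M₁ p = 1} {p | M₂ p = 1} := by
  refine ⟨(h₁.radialHomeo h₂).toOpenPartialHomeomorph.restrOpen {0}ᶜ isOpen_compl_singleton,
    ?_, ?_, ?_, ?_, ?_⟩
  · intro p hp
    simpa using h₁.ne_zero_of_eq_one hp
  · intro p hp
    have h0 : (h₁.radialHomeo h₂).symm p ≠ 0 :=
      radialHomeo_ne_zero h₂ h₁ (h₂.ne_zero_of_eq_one hp)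
    simpa [OpenPartialHomeomorph.restrOpen] using h0
  · intro p hp
    have hp0 : p ≠ 0 := by simpa using hp
    exact (((s₁ p hp0).div (s₂ p hp0) (h₂.pos p hp0).ne').smul contDiffAt_id).contDiffWithinAt
  · intro p hp
    have hp0 : p ≠ 0 := by
      rintro rfl
      simp [OpenPartialHomeomorph.restrOpen, radialHomeo_symm_apply] at hp
    exact (((s₂ p hp0).div (s₁ p hp0) (h₁.pos p hp0).ne').smul contDiffAt_id).contDiffWithinAt
  · ext q
    constructor
    · rintro ⟨p, hp, rfl⟩
      exact (apply_radialHomeo h₁ h₂ p).trans hp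
    · intro hq
      exact ⟨h₂.radialHomeo h₁ q, (apply_radialHomeo h₂ h₁ q).trans hq,
        (h₂.radialHomeo h₁).symm_apply_apply q⟩

end IsGauge

/-! ### The Euclidean gauge and the identification of the disc with the plane -/

/-- The Euclidean norm as a gauge. -/
noncomputable def euclid (p : ℝ × ℝ) : ℝ := Real.sqrt (normSq p)

lemma isGauge_euclid : IsGauge euclid where
  cont := continuous_normSq.sqrt
  pos p hp := Real.sqrt_pos.2 (normSq_pos hp)
  homog s hs p := by
    rw [euclid, normSq_smul, Real.sqrt_mul (sq_nonneg s), Real.sqrt_sq hs.le, euclid]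

lemma contDiffAt_euclid {p : ℝ × ℝ} (hp : p ≠ 0) : ContDiffAt ℝ ∞ euclid p :=
  contDiff_normSq.contDiffAt.sqrt (normSq_pos hp).ne'

lemma euclid_eq_one {p : ℝ × ℝ} : euclid p = 1 ↔ normSq p = 1 := Real.sqrt_eq_one

lemma mem_disc {ε : ℝ} {p : ℝ × ℝ} : p ∈ disc ε ↔ normSq p < ε ^ 2 := Iff.rfl

lemma isOpen_disc (ε : ℝ) : IsOpen (disc ε) :=
  isOpen_lt continuous_normSq continuous_const

/-- The open disc is homeomorphic to the plane by a ray-preserving map. -/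
noncomputable def discHomeo {ε : ℝ} (hε : 0 < ε) : disc ε ≃ₜ ℝ × ℝ where
  toFun p := (Real.sqrt (ε ^ 2 - normSq p))⁻¹ • (p : ℝ × ℝ)
  invFun q := ⟨(ε * (Real.sqrt (1 + normSq q))⁻¹) • q, by
    have h := normSq_nonneg q
    rw [mem_disc, normSq_smul, mul_pow, inv_pow, Real.sq_sqrt (by linarith)]
    have : (1 + normSq q)⁻¹ * normSq q < 1 := by
      rw [← div_eq_inv_mul, div_lt_one (by linarith)]; linarith
    nlinarith [sq_pos_of_pos hε]⟩
  left_inv p := by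
    have hp : 0 < ε ^ 2 - normSq p := sub_pos.2 (mem_disc.1 p.2)
    apply Subtype.ext
    simp only [normSq_smul, inv_pow, Real.sq_sqrt hp.le, smul_smul]
    have e1 : 1 + (ε ^ 2 - normSq p)⁻¹ * normSq p = ε ^ 2 / (ε ^ 2 - normSq p) := by
      field_simp; ring
    rw [e1, Real.sqrt_div (sq_nonneg ε), Real.sqrt_sq hε.le]
    have hs := Real.sqrt_pos.2 hp
    have : ε * (ε / √(ε ^ 2 - normSq p))⁻¹ * (√(ε ^ 2 - normSq p))⁻¹ = 1 := by field_simp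
    rw [this, one_smul]
  right_inv q := by
    have h : 0 < 1 + normSq q := by linarith [normSq_nonneg q]
    simp only [normSq_smul, mul_pow, inv_pow, Real.sq_sqrt h.le, smul_smul]
    have e1 : ε ^ 2 - ε ^ 2 * (1 + normSq q)⁻¹ * normSq q = ε ^ 2 / (1 + normSq q) := by
      field_simp; ring
    rw [e1, Real.sqrt_div (sq_nonneg ε), Real.sqrt_sq hε.le]
    have hs := Real.sqrt_pos.2 h
    have : (ε / √(1 + normSq q))⁻¹ * (ε * (√(1 + normSq q))⁻¹) = 1 := by field_simp
    rw [this, one_smul]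
  continuous_toFun := by
    have h : Continuous fun p : disc ε => Real.sqrt (ε ^ 2 - normSq p) :=
      (continuous_const.sub (continuous_normSq.comp continuous_subtype_val)).sqrt
    exact (h.inv₀ fun p => (Real.sqrt_pos.2 (sub_pos.2 (mem_disc.1 p.2))).ne').smul
      continuous_subtype_val
  continuous_invFun := by
    have h : Continuous fun q : ℝ × ℝ => Real.sqrt (1 + normSq q) :=
      (continuous_const.add continuous_normSq).sqrt
    have h' := h.inv₀ fun q => (Real.sqrt_pos.2 (by linarith [normSq_nonneg q])).ne'
    exact ((continuous_const.mul h').smul continuous_id).subtype_mk _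

lemma discHomeo_apply {ε : ℝ} (hε : 0 < ε) (p : disc ε) :
    discHomeo hε p = (Real.sqrt (ε ^ 2 - normSq p))⁻¹ • (p : ℝ × ℝ) := rfl

/-- The gauge of the image of the curve `M = 1` under `discHomeo`. -/
lemma IsGauge.expand {ε : ℝ} {M : ℝ × ℝ → ℝ} (h : IsGauge M)
    (hlt : ∀ p, p ≠ 0 → normSq p < ε ^ 2 * M p ^ 2) :
    IsGauge fun p => Real.sqrt (ε ^ 2 * M p ^ 2 - normSq p) where
  cont := ((continuous_const.mul (h.cont.pow 2)).sub continuous_normSq).sqrt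
  pos p hp := Real.sqrt_pos.2 (sub_pos.2 (hlt p hp))
  homog s hs p := by
    rw [h.homog s hs, normSq_smul]
    have : ε ^ 2 * (s * M p) ^ 2 - s ^ 2 * normSq p = s ^ 2 * (ε ^ 2 * M p ^ 2 - normSq p) := by
      ring
    rw [this, Real.sqrt_mul (sq_nonneg s), Real.sqrt_sq hs.le]

/-- With `q = p / √(ε² - |p|²)`, homogeneity gives `ε² M(q)² - |q|² = (ε² M(p)² - |p|²) / (ε² -
|p|²)`, which equals `1` exactly when `M(p)² = 1`. -/
lemma expand_discHomeo {ε : ℝ} (hε : 0 < ε) {M : ℝ × ℝ → ℝ} (h : IsGauge M)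
    (p : disc ε) : Real.sqrt (ε ^ 2 * M (discHomeo hε p) ^ 2 - normSq (discHomeo hε p)) = 1 ↔
      M p = 1 := by
  have hp : 0 < ε ^ 2 - normSq p := sub_pos.2 (mem_disc.1 p.2)
  have hs := Real.sqrt_pos.2 hp
  rw [discHomeo_apply, h.homog _ (inv_pos.2 hs), normSq_smul, mul_pow, inv_pow,
    Real.sq_sqrt hp.le, Real.sqrt_eq_one]
  have hM := h.nonneg p
  have : ε ^ 2 * ((ε ^ 2 - normSq p)⁻¹ * M p ^ 2) - (ε ^ 2 - normSq p)⁻¹ * normSq p =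
      (ε ^ 2 * M p ^ 2 - normSq p) / (ε ^ 2 - normSq p) := by field_simp
  rw [this, div_eq_one_iff_eq hp.ne']
  constructor
  · intro e
    have h2 : M p ^ 2 = 1 := by
      have : ε ^ 2 * (M p ^ 2 - 1) = 0 := by linarith
      rcases mul_eq_zero.1 this with h0 | h0
      · exact absurd h0 (pow_pos hε 2).ne'
      · linarith
    nlinarith
  · intro e; rw [e]; ring

/-- A star-shaped curve in the disc is carried to the unit circle by a homeomorphism from the disc
onto the plane, with prescribed directions of the preimages of given points. -/
theorem exists_disc_homeo {ε : ℝ} (hε : 0 < ε) {M : ℝ × ℝ → ℝ} (hM : IsGauge M)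
    (hlt : ∀ p, p ≠ 0 → normSq p < ε ^ 2 * M p ^ 2) (L : ℝ × ℝ ≃ₜ ℝ × ℝ)
    (hL : ∀ s : ℝ, 0 < s → ∀ p, L (s • p) = s • L p) :
    ∃ h : disc ε ≃ₜ ℝ × ℝ, (∀ p : disc ε, M p = 1 ↔ normSq (h p) = 1) ∧
      ∀ (p : disc ε) (e : ℝ × ℝ) (k : ℝ), 0 < k → normSq e = 1 → M p = 1 →
        (p : ℝ × ℝ) = k • L e → h p = e := by
  have hN := hM.expand hlt
  set N : ℝ × ℝ → ℝ := fun p => Real.sqrt (ε ^ 2 * M p ^ 2 - normSq p) with hNdef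
  have hL0 : L 0 = 0 := by
    have h2 := hL 2 two_pos 0
    rw [smul_zero, two_smul] at h2
    exact left_eq_add.1 h2
  have hNL : IsGauge (N ∘ L) :=
    { cont := hN.cont.comp L.continuous
      pos := fun p hp => hN.pos _ fun h => hp (L.injective (h.trans hL0.symm))
      homog := fun s hs p => by
        simp only [Function.comp_apply]; rw [hL s hs, hN.homog s hs] }
  -- Open the disc up to the plane, turn the prescribed rays to the standard ones, then rescale
  -- along rays. The last map does not move rays, so a point of the curve on the ray of `L e` must
  -- end at the point of the unit circle on the ray of `e`.
  refine ⟨((discHomeo hε).trans L.symm).trans (hNL.radialHomeo isGauge_euclid), ?_, ?_⟩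
  · intro p
    rw [← euclid_eq_one, Homeomorph.trans_apply, hNL.apply_radialHomeo isGauge_euclid, Function.comp_apply,
      Homeomorph.trans_apply, L.apply_symm_apply]
    exact (expand_discHomeo hε hM p).symm
  · intro p e k hk he hp hpe
    have hpos : 0 < (Real.sqrt (ε ^ 2 - normSq p))⁻¹ :=
      inv_pos.2 (Real.sqrt_pos.2 (sub_pos.2 (mem_disc.1 p.2)))
    have h1 : L.symm (discHomeo hε p) = ((Real.sqrt (ε ^ 2 - normSq p))⁻¹ * k) • e := by
      rw [L.symm_apply_eq, hL _ (mul_pos hpos hk), discHomeo_apply, hpe, smul_smul]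
    have h2 : (N ∘ L) (L.symm (discHomeo hε p)) = 1 := by
      rw [Function.comp_apply, L.apply_symm_apply]
      exact (expand_discHomeo hε hM p).2 hp
    rw [Homeomorph.trans_apply, Homeomorph.trans_apply, IsGauge.radialHomeo_apply, h2, h1,
      isGauge_euclid.homog _ (mul_pos hpos hk), euclid_eq_one.2 he, smul_smul, mul_one,
      one_div_mul_cancel (mul_pos hpos hk).ne', one_smul]

/-! ### A homeomorphism with prescribed values on four rays -/

/-- The rotation of the plane that carries `(1, 0)` to the unit vector `(c, s)`. -/
def rotationHomeo {c s : ℝ} (h : c ^ 2 + s ^ 2 = 1) : ℝ × ℝ ≃ₜ ℝ × ℝ where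
  toFun p := (p.1 * c - p.2 * s, p.1 * s + p.2 * c)
  invFun p := (p.1 * c + p.2 * s, p.2 * c - p.1 * s)
  left_inv p := by
    ext
    · simp only; linear_combination p.1 * h
    · simp only; linear_combination p.2 * h
  right_inv p := by
    ext
    · simp only; linear_combination p.1 * h
    · simp only; linear_combination p.2 * h
  continuous_toFun := by fun_prop
  continuous_invFun := by fun_prop

/-- A piecewise linear perturbation of the identity. -/
noncomputable def shear (α β γ δ : ℝ) (p : ℝ × ℝ) : ℝ × ℝ :=
  (p.1 + (β * max p.2 0 + δ * max (-p.2) 0), p.2 + (α * max p.1 0 + γ * max (-p.1) 0))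

lemma abs_max_sub_le {α γ : ℝ} (hα : |α| ≤ 1 / 4) (hγ : |γ| ≤ 1 / 4) (x y : ℝ) :
    |(α * max x 0 + γ * max (-x) 0) - (α * max y 0 + γ * max (-y) 0)| ≤ 1 / 2 * |x - y| := by
  have h1 : |max x 0 - max y 0| ≤ |x - y| := abs_max_sub_max_le_abs x y 0
  have h2 : |max (-x) 0 - max (-y) 0| ≤ |x - y| := by
    have := abs_max_sub_max_le_abs (-x) (-y) 0
    rwa [← abs_neg (-x - -y), show -(-x - -y) = x - y by ring] at this
  calc |(α * max x 0 + γ * max (-x) 0) - (α * max y 0 + γ * max (-y) 0)|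
      = |α * (max x 0 - max y 0) + γ * (max (-x) 0 - max (-y) 0)| := by congr 1; ring
    _ ≤ |α| * |max x 0 - max y 0| + |γ| * |max (-x) 0 - max (-y) 0| := by
        rw [← abs_mul, ← abs_mul]; exact abs_add_le _ _
    _ ≤ 1 / 4 * |x - y| + 1 / 4 * |x - y| := by gcongr
    _ = 1 / 2 * |x - y| := by ring

/-- Each coordinate of the displacement depends on one variable only, with Lipschitz constant at
most `1/4 + 1/4`. A perturbation of the identity with Lipschitz constant less than `1` is a
homeomorphism. -/
lemma approximatesLinearOn_shear {α β γ δ : ℝ} (hα : |α| ≤ 1 / 4) (hβ : |β| ≤ 1 / 4)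
    (hγ : |γ| ≤ 1 / 4) (hδ : |δ| ≤ 1 / 4) :
    ApproximatesLinearOn (shear α β γ δ)
      ((ContinuousLinearEquiv.refl ℝ (ℝ × ℝ) : (ℝ × ℝ) ≃L[ℝ] (ℝ × ℝ)) : ℝ × ℝ →L[ℝ] ℝ × ℝ)
      univ (1 / 2) := by
  intro p _ q _
  have e : shear α β γ δ p - shear α β γ δ q -
      ((ContinuousLinearEquiv.refl ℝ (ℝ × ℝ) : (ℝ × ℝ) ≃L[ℝ] (ℝ × ℝ)) : ℝ × ℝ →L[ℝ] ℝ × ℝ) (p - q) =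
      ((β * max p.2 0 + δ * max (-p.2) 0) - (β * max q.2 0 + δ * max (-q.2) 0),
       (α * max p.1 0 + γ * max (-p.1) 0) - (α * max q.1 0 + γ * max (-q.1) 0)) := by
    ext
    · simp only [shear, ContinuousLinearEquiv.coe_refl, ContinuousLinearMap.coe_id', id_eq,
        Prod.fst_sub]; ring
    · simp only [shear, ContinuousLinearEquiv.coe_refl, ContinuousLinearMap.coe_id', id_eq,
        Prod.snd_sub]; ring
  rw [e, Prod.norm_def]
  have h1 := abs_max_sub_le hα hγ p.1 q.1
  have h2 := abs_max_sub_le hβ hδ p.2 q.2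
  have n1 : |p.1 - q.1| ≤ ‖p - q‖ := norm_fst_le (p - q)
  have n2 : |p.2 - q.2| ≤ ‖p - q‖ := norm_snd_le (p - q)
  have hc : ((1 / 2 : NNReal) : ℝ) = 1 / 2 := by norm_num
  rw [hc]
  refine max_le ?_ ?_
  · exact h2.trans (by linarith)
  · exact h1.trans (by linarith)

lemma shear_smul (α β γ δ : ℝ) {s : ℝ} (hs : 0 < s) (p : ℝ × ℝ) :
    shear α β γ δ (s • p) = s • shear α β γ δ p := by
  have h (x : ℝ) : max (s * x) 0 = s * max x 0 := by
    rw [mul_max_of_nonneg _ _ hs.le, mul_zero]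
  ext <;> simp only [shear, Prod.smul_fst, Prod.smul_snd, smul_eq_mul, ← mul_neg, h] <;> ring

/-- A positively homogeneous homeomorphism of the plane with prescribed images of the four
coordinate directions, close to those of an orthonormal frame. -/
theorem exists_conic_homeo {c s : ℝ} (h : c ^ 2 + s ^ 2 = 1) {α β γ δ : ℝ} (hα : |α| ≤ 1 / 4)
    (hβ : |β| ≤ 1 / 4) (hγ : |γ| ≤ 1 / 4) (hδ : |δ| ≤ 1 / 4) :
    ∃ L : ℝ × ℝ ≃ₜ ℝ × ℝ, (∀ k : ℝ, 0 < k → ∀ p, L (k • p) = k • L p) ∧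
      L (1, 0) = (c - α * s, s + α * c) ∧ L (0, 1) = (β * c - s, β * s + c) ∧
      L (-1, 0) = (-c - γ * s, -s + γ * c) ∧ L (0, -1) = (δ * c + s, δ * s - c) := by
  have hc : Subsingleton (ℝ × ℝ) ∨ (1 / 2 : NNReal) <
      ‖((ContinuousLinearEquiv.refl ℝ (ℝ × ℝ)).symm : ℝ × ℝ →L[ℝ] ℝ × ℝ)‖₊⁻¹ := by
    right
    have : ‖((ContinuousLinearEquiv.refl ℝ (ℝ × ℝ)).symm : ℝ × ℝ →L[ℝ] ℝ × ℝ)‖₊ = 1 := by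
      rw [ContinuousLinearEquiv.refl_symm, ContinuousLinearEquiv.coe_refl]
      exact ContinuousLinearMap.nnnorm_id
    rw [this, inv_one, ← NNReal.coe_lt_coe]
    norm_num
  let S := (approximatesLinearOn_shear hα hβ hγ hδ).toHomeomorph _ hc
  have hS (p) : S p = shear α β γ δ p := rfl
  refine ⟨S.trans (rotationHomeo h), ?_, ?_, ?_, ?_, ?_⟩
  · intro k hk p
    rw [Homeomorph.trans_apply, Homeomorph.trans_apply, hS, hS, shear_smul _ _ _ _ hk]
    ext <;> simp [rotationHomeo] <;> ring
  all_goals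
    rw [Homeomorph.trans_apply, hS]
    ext <;> simp [rotationHomeo, shear] <;> ring

/-! ### The gauge of a star-shaped level curve -/

lemma smul_mem_disc {ε : ℝ} {p : ℝ × ℝ} (hp : p ∈ disc ε) {s : ℝ} (hs : 0 ≤ s) (hs1 : s ≤ 1) :
    s • p ∈ disc ε := by
  rw [mem_disc] at *
  rw [normSq_smul]
  have : s ^ 2 ≤ 1 := pow_le_one₀ hs hs1
  nlinarith [normSq_nonneg p]

/-- The norm on the product is the maximum norm, while the disc is Euclidean: the two norms differ
by a factor of at most `√2`, which the factor `1/2` absorbs. -/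
lemma mem_disc_of_norm_le {ε : ℝ} (hε : 0 < ε) {p : ℝ × ℝ} (hp : ‖p‖ ≤ ε / 2) : p ∈ disc ε := by
  rw [mem_disc]
  have := normSq_le_norm_sq p
  have : ‖p‖ ^ 2 ≤ (ε / 2) ^ 2 := pow_le_pow_left₀ (norm_nonneg p) hp 2
  nlinarith [pow_pos hε 2]

lemma hasDerivAt_comp_smul {g : ℝ × ℝ → ℝ} {p : ℝ × ℝ} {t : ℝ} (hg : DifferentiableAt ℝ g (t • p)) :
    HasDerivAt (fun s : ℝ => g (s • p)) (fderiv ℝ g (t • p) p) t := by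
  have h : HasDerivAt (fun s : ℝ => s • p) p t := by
    simpa using (hasDerivAt_id t).smul_const p
  exact hg.hasFDerivAt.comp_hasDerivAt t h

/-- Between two zeros on a ray Rolle's theorem gives a critical radius. It lies beyond the first
zero, hence outside the ball of radius `r`, where the radial derivative is positive. -/
lemma zero_unique_on_ray {g : ℝ × ℝ → ℝ} {ε r : ℝ}
    (hg : ∀ p ∈ disc ε, DifferentiableAt ℝ g p)
    (hneg : ∀ p ∈ disc ε, ‖p‖ ≤ r → g p < 0)
    (hrad : ∀ p ∈ disc ε, r ≤ ‖p‖ → 0 < fderiv ℝ g p p) {p : ℝ × ℝ} {a b : ℝ} (ha : 0 < a)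
    (hab : a < b) (had : a • p ∈ disc ε) (hbd : b • p ∈ disc ε) (hga : g (a • p) = 0)
    (hgb : g (b • p) = 0) : False := by
  have hmem : ∀ x ∈ Icc a b, x • p ∈ disc ε := by
    intro x hx
    have hb : 0 < b := ha.trans hab
    have := smul_mem_disc hbd (div_nonneg (ha.le.trans hx.1) hb.le) ((div_le_one hb).2 hx.2)
    rwa [smul_smul, div_mul_cancel₀ _ hb.ne'] at this
  have hd : ∀ x ∈ Icc a b, HasDerivAt (fun s : ℝ => g (s • p)) (fderiv ℝ g (x • p) p) x :=
    fun x hx => hasDerivAt_comp_smul (hg _ (hmem x hx))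
  obtain ⟨x, hx, hx0⟩ := exists_hasDerivAt_eq_zero hab
    (fun x hx => (hd x hx).continuousAt.continuousWithinAt) (by simp only [hga, hgb])
    (fun x hx => hd x (Ioo_subset_Icc_self hx))
  have hra : r < ‖a • p‖ := by
    by_contra h
    exact (hneg _ had (not_lt.1 h)).ne hga
  have hxp : 0 < x := ha.trans hx.1
  have hle : ‖a • p‖ ≤ ‖x • p‖ := by
    rw [norm_smul, norm_smul, Real.norm_of_nonneg ha.le, Real.norm_of_nonneg hxp.le]
    exact mul_le_mul_of_nonneg_right hx.1.le (norm_nonneg p)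
  have := hrad _ (hmem x (Ioo_subset_Icc_self hx)) (hra.le.trans hle)
  rw [map_smul, hx0, smul_zero] at this
  exact lt_irrefl _ this

/-- The implicit function theorem applied to `(q, t) ↦ g (t • q)` gives a smooth local solution, and
uniqueness of the zero on each ray identifies it with `ℓ`. -/
lemma contDiffAt_of_radial_zero {g : ℝ × ℝ → ℝ} {ℓ : ℝ × ℝ → ℝ} {U : Set (ℝ × ℝ)} (hU : IsOpen U)
    {p : ℝ × ℝ} (hp : p ≠ 0) (hg : ContDiffAt ℝ ∞ g (ℓ p • p)) (hℓ : 0 < ℓ p)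
    (hmem : ℓ p • p ∈ U) (h0 : g (ℓ p • p) = 0) (hd : fderiv ℝ g (ℓ p • p) p ≠ 0)
    (huniq : ∀ q, q ≠ 0 → ∀ t, 0 < t → t • q ∈ U → g (t • q) = 0 → t = ℓ q) :
    ContDiffAt ℝ ∞ ℓ p := by
  let f : (ℝ × ℝ) × ℝ → ℝ := fun x => g (x.2 • x.1)
  have hs : ContDiffAt ℝ ∞ (fun x : (ℝ × ℝ) × ℝ => x.2 • x.1) (p, ℓ p) := by fun_prop
  have hf : ContDiffAt ℝ ∞ f (p, ℓ p) := ContDiffAt.comp (p, ℓ p) hg hs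
  have hone : (∞ : WithTop ℕ∞) ≠ 0 := by simp
  have hinr : ∀ v : ℝ, (fderiv ℝ f (p, ℓ p) ∘L ContinuousLinearMap.inr ℝ (ℝ × ℝ) ℝ) v =
      v * fderiv ℝ g (ℓ p • p) p := by
    intro v
    have hfd := (hf.differentiableAt hone).hasFDerivAt
    have h1 : HasDerivAt (fun t : ℝ => ((p, t) : (ℝ × ℝ) × ℝ)) (0, 1) (ℓ p) :=
      (hasDerivAt_const _ _).prodMk (hasDerivAt_id _)
    have h2 := hfd.comp_hasDerivAt (ℓ p) h1
    have h3 : HasDerivAt (fun s : ℝ => g (s • p)) (fderiv ℝ g (ℓ p • p) p) (ℓ p) :=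
      hasDerivAt_comp_smul (hg.differentiableAt hone)
    have h4 := h2.unique h3
    have : (fderiv ℝ f (p, ℓ p) ∘L ContinuousLinearMap.inr ℝ (ℝ × ℝ) ℝ) v =
        fderiv ℝ f (p, ℓ p) (v • (0, 1)) := by simp
    rw [this, map_smul, h4, smul_eq_mul]
  have hinv : (fderiv ℝ f (p, ℓ p) ∘L ContinuousLinearMap.inr ℝ (ℝ × ℝ) ℝ).IsInvertible := by
    refine ⟨ContinuousLinearEquiv.unitsEquivAut ℝ (Units.mk0 _ hd), ?_⟩
    ext
    rw [hinr]
    simp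
  have φc := hf.contDiffAt_implicitFunction hone hinv
  have φ0 := hf.implicitFunction_apply_self hone hinv
  have φe := hf.eventually_apply_implicitFunction hone hinv
  set φ := hf.implicitFunction hone hinv
  simp only at φc φ0 φe
  have φcont := φc.continuousAt
  refine φc.congr_of_eventuallyEq ?_
  have e1 : ∀ᶠ q in 𝓝 p, 0 < φ q := φcont.eventually_const_lt (by rw [φ0]; exact hℓ)
  have e2 : ∀ᶠ q in 𝓝 p, φ q • q ∈ U :=
    (φcont.smul continuousAt_id).eventually_mem (hU.mem_nhds (by simpa [φ0] using hmem))
  have e3 : ∀ᶠ q in 𝓝 p, q ≠ 0 := isOpen_ne.mem_nhds hp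
  filter_upwards [e1, e2, e3, φe] with q h1 h2 h3 h4
  exact (huniq q h3 _ h1 h2 (h4.trans h0)).symm

/-- Each ray leaves a region where `g < 0` and reaches one where `g > 0`, so it crosses the curve,
and it does so once. If `ℓ p • p` is the crossing point, the gauge is `1 / ℓ`. It is continuous at
the origin because the curve stays outside the ball of radius `r`, which gives `M p ≤ ‖p‖ / r`. -/
theorem exists_gauge {g : ℝ × ℝ → ℝ} {ε r : ℝ} (hε : 0 < ε) (hr : 0 < r)
    (hg : ∀ p ∈ disc ε, ContDiffAt ℝ ∞ g p)
    (hneg : ∀ p ∈ disc ε, ‖p‖ ≤ r → g p < 0)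
    (hrad : ∀ p ∈ disc ε, r ≤ ‖p‖ → 0 < fderiv ℝ g p p)
    -- The square `‖p‖ ≤ ε / 2` lies inside the Euclidean disc, so the crossing occurs before the
    -- ray leaves the disc.
    (hpos : ∀ p, ‖p‖ = ε / 2 → 0 < g p) :
    ∃ M : ℝ × ℝ → ℝ, IsGauge M ∧ (∀ p, p ≠ 0 → ContDiffAt ℝ ∞ M p) ∧
      (∀ p, p ≠ 0 → normSq p < ε ^ 2 * M p ^ 2) ∧ ∀ p, p ∈ curve g ε ↔ M p = 1 := by
  have hone : (∞ : WithTop ℕ∞) ≠ 0 := by simp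
  have hgd : ∀ p ∈ disc ε, DifferentiableAt ℝ g p := fun p hp => (hg p hp).differentiableAt hone
  have h0d : (0 : ℝ × ℝ) ∈ disc ε := mem_disc_of_norm_le hε (by simpa using (half_pos hε).le)
  have hex : ∀ p : ℝ × ℝ, ∃ t : ℝ, p ≠ 0 → 0 < t ∧ t • p ∈ disc ε ∧ g (t • p) = 0 := by
    intro p
    by_cases hp : p = 0
    · exact ⟨0, fun h => absurd hp h⟩
    have hn : 0 < ‖p‖ := norm_pos_iff.2 hp
    have hT : 0 ≤ ε / 2 / ‖p‖ := by positivity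
    have hmem : ∀ t ∈ Icc 0 (ε / 2 / ‖p‖), t • p ∈ disc ε := by
      intro t ht
      refine mem_disc_of_norm_le hε ?_
      rw [norm_smul, Real.norm_of_nonneg ht.1]
      exact (le_div_iff₀ hn).1 ht.2
    have hc : ContinuousOn (fun t : ℝ => g (t • p)) (Icc 0 (ε / 2 / ‖p‖)) := fun t ht =>
      (hasDerivAt_comp_smul (hgd _ (hmem t ht))).continuousAt.continuousWithinAt
    have hTp : 0 < g ((ε / 2 / ‖p‖) • p) := by
      refine hpos _ ?_
      rw [norm_smul, Real.norm_of_nonneg hT, div_mul_cancel₀ _ hn.ne']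
    have h00 : g ((0 : ℝ) • p) < 0 := by
      rw [zero_smul]; exact hneg 0 h0d (by simpa using hr.le)
    obtain ⟨t, ht, ht0⟩ := intermediate_value_Icc hT hc ⟨h00.le, hTp.le⟩
    refine ⟨t, fun _ => ⟨lt_of_le_of_ne ht.1 ?_, hmem t ht, ht0⟩⟩
    rintro rfl
    exact h00.ne ht0
  choose ℓ hℓ using hex
  have huniq : ∀ q, q ≠ 0 → ∀ t, 0 < t → t • q ∈ disc ε → g (t • q) = 0 → t = ℓ q := by
    intro q hq t ht htd htg
    obtain ⟨h1, h2, h3⟩ := hℓ q hq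
    rcases lt_trichotomy t (ℓ q) with h | h | h
    · exact (zero_unique_on_ray hgd hneg hrad ht h htd h2 htg h3).elim
    · exact h
    · exact (zero_unique_on_ray hgd hneg hrad h1 h h2 htd h3 htg).elim
  have hr' : ∀ p, p ≠ 0 → r < ‖ℓ p • p‖ := by
    intro p hp
    by_contra h
    exact (hneg _ (hℓ p hp).2.1 (not_lt.1 h)).ne (hℓ p hp).2.2
  have hsmooth : ∀ p, p ≠ 0 → ContDiffAt ℝ ∞ ℓ p := by
    intro p hp
    obtain ⟨h1, h2, h3⟩ := hℓ p hp
    refine contDiffAt_of_radial_zero (isOpen_disc ε) hp (hg _ h2) h1 h2 h3 ?_ huniq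
    have := hrad _ h2 (hr' p hp).le
    rw [map_smul] at this
    exact fun h => by simp [h] at this
  let M : ℝ × ℝ → ℝ := fun p => if p = 0 then 0 else (ℓ p)⁻¹
  have hM : ∀ p, p ≠ 0 → M p = (ℓ p)⁻¹ := fun p hp => if_neg hp
  have hM0 : M 0 = 0 := if_pos rfl
  have hMs : ∀ p, p ≠ 0 → ContDiffAt ℝ ∞ M p := by
    intro p hp
    refine ((hsmooth p hp).inv (hℓ p hp).1.ne').congr_of_eventuallyEq ?_
    filter_upwards [isOpen_ne.mem_nhds hp] with q hq using hM q hq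
  have hMpos : ∀ p, p ≠ 0 → 0 < M p := fun p hp => by rw [hM p hp]; exact inv_pos.2 (hℓ p hp).1
  have hMle : ∀ p, ‖M p‖ ≤ r⁻¹ * ‖p‖ := by
    intro p
    by_cases hp : p = 0
    · rw [hp, hM0]; simp
    have h1 := (hℓ p hp).1
    have := hr' p hp
    rw [norm_smul, Real.norm_of_nonneg h1.le] at this
    rw [Real.norm_of_nonneg (hMpos p hp).le, hM p hp, inv_mul_eq_div, le_div_iff₀ hr,
      inv_mul_eq_div, div_le_iff₀ h1]
    linarith
  refine ⟨M, ⟨?_, hMpos, ?_⟩, hMs, ?_, ?_⟩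
  · rw [continuous_iff_continuousAt]
    intro p
    by_cases hp : p = 0
    · rw [hp]
      show Tendsto M (𝓝 0) (𝓝 (M 0))
      rw [hM0]
      refine squeeze_zero_norm hMle ?_
      have : Continuous fun p : ℝ × ℝ => r⁻¹ * ‖p‖ := by fun_prop
      exact this.tendsto' 0 0 (by simp)
    · exact (hMs p hp).continuousAt
  · intro s hs p
    by_cases hp : p = 0
    · rw [hp, smul_zero, hM0, mul_zero]
    have hsp : s • p ≠ 0 := smul_ne_zero hs.ne' hp
    obtain ⟨h1, h2, h3⟩ := hℓ p hp
    have e : ℓ p / s * s = ℓ p := div_mul_cancel₀ _ hs.ne'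
    have := huniq (s • p) hsp (ℓ p / s) (div_pos h1 hs) (by rwa [smul_smul, e])
      (by rwa [smul_smul, e])
    rw [hM _ hsp, hM p hp, ← this, inv_div, div_eq_mul_inv]
  · intro p hp
    obtain ⟨h1, h2, -⟩ := hℓ p hp
    rw [mem_disc, normSq_smul] at h2
    rw [hM p hp, inv_pow, ← div_eq_mul_inv, lt_div_iff₀ (pow_pos h1 2)]
    linarith
  · intro p
    constructor
    · rintro ⟨hp, hgp⟩
      have hp0 : p ≠ 0 := by
        rintro rfl
        exact (hneg 0 h0d (by simpa using hr.le)).ne hgp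
      have := huniq p hp0 1 one_pos (by rwa [one_smul]) (by rwa [one_smul])
      rw [hM p hp0, ← this, inv_one]
    · intro h
      have hp0 : p ≠ 0 := by rintro rfl; rw [hM0] at h; exact zero_ne_one h
      obtain ⟨-, h2, h3⟩ := hℓ p hp0
      rw [hM p hp0, inv_eq_one] at h
      rw [h, one_smul] at h2 h3
      exact ⟨h2, h3⟩

section

/-! ### Zeros of a perturbed quartic on a perturbed ellipse -/

/-- The first coordinate in the orthonormal frame `(c, s), (-s, c)`. -/
def frameU (c s : ℝ) (p : ℝ × ℝ) : ℝ := c * p.1 + s * p.2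

/-- The second coordinate in the orthonormal frame `(c, s), (-s, c)`. -/
def frameW (c s : ℝ) (p : ℝ × ℝ) : ℝ := -s * p.1 + c * p.2

lemma frameU_rotate (c s : ℝ) (p : ℝ × ℝ) : frameU (-s) c p = frameW c s p := rfl

lemma frameW_rotate (c s : ℝ) (p : ℝ × ℝ) : frameW (-s) c p = -frameU c s p := by
  simp only [frameU, frameW]; ring

lemma frame_sq {c s : ℝ} (h : c ^ 2 + s ^ 2 = 1) (p : ℝ × ℝ) :
    frameU c s p ^ 2 + frameW c s p ^ 2 = normSq p := by
  simp only [frameU, frameW, normSq]; linear_combination (p.1 ^ 2 + p.2 ^ 2) * h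

/-- On the part of the disc where `‖p‖ ≥ ρ`, the function `g` is `C¹`-close to the quadratic form
`(A u² + B w²) / 2` up to a constant, and `V` is `C¹`-close to the quartic `K u w (A u² + B w²)`,
where `u, w` are the coordinates in the frame given by `(c, s)`. -/
structure ModelBounds (g V : ℝ × ℝ → ℝ) (ε ρ A B K c s η : ℝ) : Prop where
  diff_g : ∀ p ∈ disc ε, DifferentiableAt ℝ g p
  diff_V : ∀ p ∈ disc ε, DifferentiableAt ℝ V p
  fderiv_g : ∀ p ∈ disc ε, ρ ≤ ‖p‖ → ∀ z, |fderiv ℝ g p z -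
    (A * frameU c s p * frameU c s z + B * frameW c s p * frameW c s z)| ≤ η * ‖p‖ * ‖z‖
  value_V : ∀ p ∈ disc ε, ρ ≤ ‖p‖ → |V p - K * frameU c s p * frameW c s p *
    (A * frameU c s p ^ 2 + B * frameW c s p ^ 2)| ≤ η * ‖p‖ ^ 4
  fderiv_V : ∀ p ∈ disc ε, ρ ≤ ‖p‖ → ∀ z, |fderiv ℝ V p z -
    K * ((frameU c s z * frameW c s p + frameU c s p * frameW c s z) *
      (A * frameU c s p ^ 2 + B * frameW c s p ^ 2) +
      frameU c s p * frameW c s p *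
        (2 * A * frameU c s p * frameU c s z + 2 * B * frameW c s p * frameW c s z))| ≤
      η * ‖p‖ ^ 3 * ‖z‖

variable {g V : ℝ × ℝ → ℝ} {ε ρ A B K c s η m C τ : ℝ}

/-- A quarter turn replaces `(u, w)` by `(w, -u)`, which exchanges `A` and `B` and changes the sign
of `K`. All four sectors are thereby reduced to the one around the positive `u`-axis. -/
lemma ModelBounds.rotate (h : ModelBounds g V ε ρ A B K c s η) :
    ModelBounds g V ε ρ B A (-K) (-s) c η where
  diff_g := h.diff_g
  diff_V := h.diff_V
  fderiv_g p hp hρ z := by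
    rw [frameU_rotate, frameU_rotate, frameW_rotate, frameW_rotate]
    convert! h.fderiv_g p hp hρ z using 3
    ring
  value_V p hp hρ := by
    rw [frameU_rotate, frameW_rotate]
    convert! h.value_V p hp hρ using 3
    ring
  fderiv_V p hp hρ z := by
    rw [frameU_rotate, frameU_rotate, frameW_rotate, frameW_rotate]
    convert! h.fderiv_V p hp hρ z using 3
    ring

lemma norm_le_two_mul_frameU (hcs : c ^ 2 + s ^ 2 = 1) {p : ℝ × ℝ} (hτ : τ ≤ 1 / 4)
    (hp : |frameW c s p| ≤ τ * frameU c s p) (hu : 0 ≤ frameU c s p) :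
    ‖p‖ ≤ 2 * frameU c s p := by
  have h1 := norm_sq_le_normSq p
  have h2 : |frameW c s p| ≤ frameU c s p := by nlinarith
  have h3 := sq_le_sq' (by linarith [abs_nonneg (frameW c s p)]) h2
  rw [sq_abs] at h3
  rw [← frame_sq hcs] at h1
  exact abs_le_of_sq_le_sq' (by nlinarith) (by linarith) |>.2

lemma frameU_le (hcs : c ^ 2 + s ^ 2 = 1) (p : ℝ × ℝ) : frameU c s p ≤ 2 * ‖p‖ := by
  have h1 := normSq_le_norm_sq p
  rw [← frame_sq hcs] at h1
  exact abs_le_of_sq_le_sq' (by nlinarith [sq_nonneg (frameW c s p)])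
    (by linarith [norm_nonneg p]) |>.2

lemma norm_le_frame (hcs : c ^ 2 + s ^ 2 = 1) (p : ℝ × ℝ) :
    ‖p‖ ≤ |frameU c s p| + |frameW c s p| := by
  have h1 := norm_sq_le_normSq p
  rw [← frame_sq hcs, ← sq_abs (frameU c s p), ← sq_abs (frameW c s p)] at h1
  have h2 := abs_nonneg (frameU c s p)
  have h3 := abs_nonneg (frameW c s p)
  exact abs_le_of_sq_le_sq' (by nlinarith) (by linarith) |>.2

/-- This is `|a p + b q|² = a |p|² + b |q|² - a b |p - q|²` for `a + b = 1`. Convexity is needed to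
apply the mean value theorem along chords. -/
lemma convex_disc (ε : ℝ) : Convex ℝ (disc ε) := by
  intro p hp q hq a b ha hb hab
  rw [mem_disc] at *
  have e : normSq (a • p + b • q) =
      a * normSq p + b * normSq q - a * b * ((p.1 - q.1) ^ 2 + (p.2 - q.2) ^ 2) := by
    obtain rfl : a = 1 - b := by linarith
    simp only [normSq, Prod.fst_add, Prod.snd_add, Prod.smul_fst, Prod.smul_snd, smul_eq_mul]
    ring
  have h1 : 0 ≤ a * b * ((p.1 - q.1) ^ 2 + (p.2 - q.2) ^ 2) := by positivity
  have h2 : a * normSq p + b * normSq q < ε ^ 2 := by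
    obtain rfl : a = 1 - b := by linarith
    rcases hb.eq_or_lt with rfl | hb
    · simpa using hp
    · nlinarith
  linarith

/-- The lower bound on `u` keeps chords away from the origin, where the model estimates are not
available. -/
lemma convex_sector (c s τ ε ρ : ℝ) :
    Convex ℝ {p : ℝ × ℝ | p ∈ disc ε ∧ |frameW c s p| ≤ τ * frameU c s p ∧
      ρ ≤ frameU c s p} := by
  intro p hp q hq a b ha hb hab
  have eU : frameU c s (a • p + b • q) = a * frameU c s p + b * frameU c s q := by
    simp only [frameU, Prod.fst_add, Prod.snd_add, Prod.smul_fst, Prod.smul_snd, smul_eq_mul]; ring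
  have eW : frameW c s (a • p + b • q) = a * frameW c s p + b * frameW c s q := by
    simp only [frameW, Prod.fst_add, Prod.snd_add, Prod.smul_fst, Prod.smul_snd, smul_eq_mul]; ring
  refine ⟨convex_disc ε hp.1 hq.1 ha hb hab, ?_, ?_⟩
  · rw [eU, eW]
    calc |a * frameW c s p + b * frameW c s q|
        ≤ |a * frameW c s p| + |b * frameW c s q| := abs_add_le _ _
      _ = a * |frameW c s p| + b * |frameW c s q| := by
        rw [abs_mul, abs_mul, abs_of_nonneg ha, abs_of_nonneg hb]
      _ ≤ a * (τ * frameU c s p) + b * (τ * frameU c s q) :=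
        add_le_add (mul_le_mul_of_nonneg_left hp.2.1 ha) (mul_le_mul_of_nonneg_left hq.2.1 hb)
      _ = τ * (a * frameU c s p + b * frameU c s q) := by ring
  · rw [eU]
    have h1 := mul_le_mul_of_nonneg_left hp.2.2 ha
    have h2 := mul_le_mul_of_nonneg_left hq.2.2 hb
    have : a * ρ + b * ρ = ρ := by rw [← add_mul, hab, one_mul]
    linarith

/-- Constants for which the perturbation arguments work. -/
structure GoodConstants (A B K m C τ η : ℝ) : Prop where
  m_pos : 0 < m
  K_ne : K ≠ 0
  mA : m ≤ A
  mB : m ≤ B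
  AC : A ≤ C
  BC : B ≤ C
  τ_pos : 0 < τ
  τ_le : 32 * C * τ ≤ m
  η_pos : 0 < η
  η_le : 64 * η ≤ m
  η_le' : 64 * η ≤ |K| * τ * m

namespace GoodConstants

lemma rotate (h : GoodConstants A B K m C τ η) : GoodConstants B A (-K) m C τ η where
  m_pos := h.m_pos
  K_ne := neg_ne_zero.2 h.K_ne
  mA := h.mB
  mB := h.mA
  AC := h.BC
  BC := h.AC
  τ_pos := h.τ_pos
  τ_le := h.τ_le
  η_pos := h.η_pos
  η_le := h.η_le
  η_le' := by rw [abs_neg]; exact h.η_le'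

lemma τ_le_quarter (h : GoodConstants A B K m C τ η) : τ ≤ 1 / 32 := by
  have := h.τ_le
  have := h.m_pos
  have : m ≤ C := h.mA.trans h.AC
  have := h.τ_pos
  nlinarith

/-- The sector width `τ` is chosen first, from the ratio of the eigenvalues; the error `η` must then
be small compared with `τ`, since the quartic has size about `|K| τ m` on the sides of the sector.
-/
lemma exists_const (hA : 0 < A) (hB : 0 < B) (hK : K ≠ 0) :
    ∃ m C τ η, GoodConstants A B K m C τ η := by
  have hm : 0 < min A B := lt_min hA hB
  have hC : 0 < max A B := lt_max_of_lt_left hA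
  have hK' := abs_pos.2 hK
  have hτ : 0 < min A B / (32 * max A B) := by positivity
  refine ⟨min A B, max A B, min A B / (32 * max A B),
    min (min A B / 64) (|K| * (min A B / (32 * max A B)) * min A B / 64),
    hm, hK, min_le_left _ _, min_le_right _ _, le_max_left _ _, le_max_right _ _, hτ,
    (mul_div_cancel₀ _ (by positivity)).le, ?_, ?_, ?_⟩
  · exact lt_min (by positivity) (by positivity)
  · have := min_le_left (min A B / 64) (|K| * (min A B / (32 * max A B)) * min A B / 64)
    linarith
  · have := min_le_right (min A B / 64) (|K| * (min A B / (32 * max A B)) * min A B / 64)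
    linarith

end GoodConstants

/-- Along a chord of the level curve of `g` in the sector, the displacement is mostly transverse. -/
lemma abs_le_of_tangent_level (h : GoodConstants A B K m C τ η) {u w α β N : ℝ} (hu : 0 < u)
    (hw : |w| ≤ τ * u) (hN : N ≤ 2 * u)
    (hb : |A * u * α + B * w * β| ≤ η * N * (|α| + |β|)) :
    |α| ≤ 1 / 4 * (|α| + |β|) := by
  have hα := abs_nonneg α
  have hβ := abs_nonneg β
  have hη := h.η_pos
  have h1 : |A * u * α| ≤ η * N * (|α| + |β|) + |B * w * β| := by
    calc |A * u * α| = |(A * u * α + B * w * β) - B * w * β| := by congr 1; ring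
      _ ≤ |A * u * α + B * w * β| + |B * w * β| := abs_sub _ _
      _ ≤ _ := by linarith
  have hA : 0 < A := h.m_pos.trans_le h.mA
  have hB : 0 < B := h.m_pos.trans_le h.mB
  rw [abs_mul, abs_mul, abs_mul, abs_mul, abs_of_pos hA, abs_of_pos hu, abs_of_pos hB] at h1
  have h2 : m * u * |α| ≤ A * u * |α| := by gcongr; exact h.mA
  have h3 : B * |w| * |β| ≤ C * (τ * u) * |β| := by
    gcongr
    · exact hB.le.trans h.BC
    · exact h.BC
  have h4 : η * N * (|α| + |β|) ≤ η * (2 * u) * (|α| + |β|) := by gcongr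
  have h5 : u * |β| * (32 * C * τ) ≤ u * |β| * m := by gcongr; exact h.τ_le
  have h6 : u * (|α| + |β|) * (64 * η) ≤ u * (|α| + |β|) * m := by gcongr; exact h.η_le
  have h7 : m * u * |α| ≤ m * u * (1 / 4 * (|α| + |β|)) := by
    have : 0 ≤ m * u * |α| := by have := h.m_pos; positivity
    have : 0 ≤ m * u * |β| := by have := h.m_pos; positivity
    linarith
  exact le_of_mul_le_mul_left h7 (mul_pos h.m_pos hu)

/-- Along a chord of the zero curve of `V` in the sector, the displacement is mostly radial. -/
lemma abs_le_of_tangent_quartic (h : GoodConstants A B K m C τ η) {u w α β N : ℝ} (hu : 0 < u)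
    (hw : |w| ≤ τ * u) (hN0 : 0 ≤ N) (hN : N ≤ 2 * u)
    (hb : |K * ((α * w + u * β) * (A * u ^ 2 + B * w ^ 2) +
      u * w * (2 * A * u * α + 2 * B * w * β))| ≤ η * N ^ 3 * (|α| + |β|)) :
    |β| ≤ 1 / 4 * (|α| + |β|) := by
  have hα := abs_nonneg α
  have hβ := abs_nonneg β
  have hη := h.η_pos
  have hm := h.m_pos
  have hA : 0 < A := h.m_pos.trans_le h.mA
  have hB : 0 < B := h.m_pos.trans_le h.mB
  have hC : 0 < C := hA.trans_le h.AC
  have hτ := h.τ_pos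
  have hK := abs_pos.2 h.K_ne
  have hw1 : |w| ≤ u := hw.trans (by nlinarith [h.τ_le_quarter])
  have hw2 : w ^ 2 ≤ u ^ 2 := sq_le_sq.2 (by rwa [abs_of_pos hu])
  set Q := A * u ^ 2 + B * w ^ 2 with hQ
  have hQ1 : m * u ^ 2 ≤ Q := by
    have : m * u ^ 2 ≤ A * u ^ 2 := by gcongr; exact h.mA
    have : 0 ≤ B * w ^ 2 := by positivity
    linarith
  have hQ0 : 0 ≤ Q := le_trans (by positivity) hQ1
  have hQ2 : Q ≤ 2 * C * u ^ 2 := by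
    have h1 : A * u ^ 2 ≤ C * u ^ 2 := by gcongr; exact h.AC
    have h2 : B * w ^ 2 ≤ C * u ^ 2 := by gcongr; exact h.BC
    linarith
  have h0 : |K| * (u * Q * |β|) ≤ η * N ^ 3 * (|α| + |β|) +
      |K| * (|α| * |w| * Q + u * |w| * (2 * A * u * |α| + 2 * B * |w| * |β|)) := by
    have e : K * (u * Q * β) = K * ((α * w + u * β) * Q + u * w * (2 * A * u * α + 2 * B * w * β))
        - K * (α * w * Q + u * w * (2 * A * u * α + 2 * B * w * β)) := by ring
    have e1 : |K| * (u * Q * |β|) = |K * (u * Q * β)| := by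
      rw [abs_mul, abs_mul, abs_mul, abs_of_pos hu, abs_of_nonneg hQ0]
    have e2 : |K * (α * w * Q + u * w * (2 * A * u * α + 2 * B * w * β))| ≤
        |K| * (|α| * |w| * Q + u * |w| * (2 * A * u * |α| + 2 * B * |w| * |β|)) := by
      rw [abs_mul]
      refine mul_le_mul_of_nonneg_left ?_ (abs_nonneg K)
      refine (abs_add_le _ _).trans (add_le_add ?_ ?_)
      · rw [abs_mul, abs_mul, abs_of_nonneg hQ0]
      · rw [abs_mul, abs_mul, abs_of_pos hu]
        refine mul_le_mul_of_nonneg_left ((abs_add_le _ _).trans ?_) (by positivity)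
        simp only [abs_mul, abs_of_pos hu, abs_of_pos hA, abs_of_pos hB, abs_two, le_refl]
    rw [e1, e]
    exact (abs_sub _ _).trans (add_le_add hb e2)
  have h1 : |K| * (u * (m * u ^ 2) * |β|) ≤ |K| * (u * Q * |β|) := by gcongr
  have h2 : η * N ^ 3 * (|α| + |β|) ≤ η * (2 * u) ^ 3 * (|α| + |β|) := by gcongr
  have h3 : |K| * (|α| * |w| * Q + u * |w| * (2 * A * u * |α| + 2 * B * |w| * |β|)) ≤
      |K| * (|α| * (τ * u) * (2 * C * u ^ 2) +
        u * (τ * u) * (2 * C * u * |α| + 2 * C * u * |β|)) := by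
    gcongr
    · exact h.AC
    · exact h.BC
  have h4 : |K| * u ^ 3 * (|α| + |β|) * (32 * C * τ) ≤ |K| * u ^ 3 * (|α| + |β|) * m := by
    gcongr; exact h.τ_le
  have h5 : u ^ 3 * (|α| + |β|) * (64 * η) ≤ u ^ 3 * (|α| + |β|) * (|K| * τ * m) :=
    mul_le_mul_of_nonneg_left h.η_le' (by positivity)
  have h6 : u ^ 3 * (|α| + |β|) * (|K| * τ * m) ≤ u ^ 3 * (|α| + |β|) * (|K| * 1 * m) := by
    gcongr; linarith [h.τ_le_quarter]
  have h7 : 0 ≤ |K| * C * τ * u ^ 3 * |β| := by positivity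
  have h9 : 0 ≤ |K| * u ^ 3 * m * |α| := by positivity
  have h10 : 0 ≤ |K| * u ^ 3 * m * |β| := by positivity
  have h8 : |K| * u ^ 3 * m * |β| ≤ |K| * u ^ 3 * m * (1 / 4 * (|α| + |β|)) := by linarith
  exact le_of_mul_le_mul_left h8 (by positivity)

/-- Two common solutions would span a chord to which the mean value theorem applies for `g` and for
`V`. The first gives a displacement that is mostly transverse to the axis, the second one that is
mostly along it, so the displacement vanishes. -/
theorem ModelBounds.eq_of_mem_sector (h : ModelBounds g V ε ρ A B K c s η)
    (hk : GoodConstants A B K m C τ η) (hcs : c ^ 2 + s ^ 2 = 1) (hρ : 0 < ρ) {p q : ℝ × ℝ}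
    (hp : p ∈ disc ε) (hq : q ∈ disc ε) (hpρ : 4 * ρ ≤ ‖p‖) (hqρ : 4 * ρ ≤ ‖q‖)
    (hps : |frameW c s p| ≤ τ * frameU c s p) (hqs : |frameW c s q| ≤ τ * frameU c s q)
    (hg : g p = g q) (hV : V p = V q) : p = q := by
  have hτ := hk.τ_le_quarter
  have hpos : ∀ x, |frameW c s x| ≤ τ * frameU c s x → 0 ≤ frameU c s x := fun x hx =>
    nonneg_of_mul_nonneg_right ((abs_nonneg _).trans hx) hk.τ_pos
  have hnorm : ∀ x, |frameW c s x| ≤ τ * frameU c s x → ‖x‖ ≤ 2 * frameU c s x := fun x hx =>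
    norm_le_two_mul_frameU hcs (by linarith) hx (hpos x hx)
  -- In the sector `‖x‖ ≤ 2 u`, and always `u ≤ 2 ‖x‖`. Hence `‖p‖ ≥ 4 ρ` gives `u ≥ 2 ρ`, a
  -- condition that persists along the chord and returns `‖x‖ ≥ ρ` there.
  let S := {x : ℝ × ℝ | x ∈ disc ε ∧ |frameW c s x| ≤ τ * frameU c s x ∧ 2 * ρ ≤ frameU c s x}
  have hS : Convex ℝ S := convex_sector c s τ ε (2 * ρ)
  have hpS : p ∈ S := ⟨hp, hps, by linarith [hnorm p hps]⟩
  have hqS : q ∈ S := ⟨hq, hqs, by linarith [hnorm q hqs]⟩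
  have hxρ : ∀ x ∈ S, ρ ≤ ‖x‖ := fun x hx => by linarith [hx.2.2, frameU_le hcs x]
  obtain ⟨x, hx, hxg⟩ := domain_mvt
    (fun x (hx : x ∈ S) => (h.diff_g x hx.1).hasFDerivAt.hasFDerivWithinAt) hS hpS hqS
  obtain ⟨y, hy, hyV⟩ := domain_mvt
    (fun x (hx : x ∈ S) => (h.diff_V x hx.1).hasFDerivAt.hasFDerivWithinAt) hS hpS hqS
  replace hx := hS.segment_subset hpS hqS hx
  replace hy := hS.segment_subset hpS hqS hy
  rw [hg, sub_self] at hxg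
  rw [hV, sub_self] at hyV
  have b1 := h.fderiv_g x hx.1 (hxρ x hx) (q - p)
  have b2 := h.fderiv_V y hy.1 (hxρ y hy) (q - p)
  rw [← hxg, zero_sub, abs_neg] at b1
  rw [← hyV, zero_sub, abs_neg] at b2
  have hΔ := norm_le_frame hcs (q - p)
  have hη := hk.η_pos
  have c1 := abs_le_of_tangent_level hk (by linarith [hx.2.2]) hx.2.1 (hnorm x hx.2.1)
    (b1.trans (mul_le_mul_of_nonneg_left hΔ (by positivity)))
  have c2 := abs_le_of_tangent_quartic hk (by linarith [hy.2.2]) hy.2.1 (norm_nonneg y)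
    (hnorm y hy.2.1) (b2.trans (mul_le_mul_of_nonneg_left hΔ (by positivity)))
  -- Adding the two estimates, `|α| + |β|` is at most half of itself.
  have : ‖q - p‖ ≤ 0 := by
    have := abs_nonneg (frameU c s (q - p))
    have := abs_nonneg (frameW c s (q - p))
    linarith
  exact (sub_eq_zero.1 (norm_le_zero_iff.1 this)).symm

/-- Outside the sectors `|u w| ≥ τ ‖p‖² / 2`, so the quartic is at least `|K| τ m ‖p‖⁴ / 2` in
absolute value and exceeds the error `η ‖p‖⁴`. -/
theorem ModelBounds.mem_sector (h : ModelBounds g V ε ρ A B K c s η)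
    (hk : GoodConstants A B K m C τ η) (hcs : c ^ 2 + s ^ 2 = 1) (hρ : 0 < ρ) {p : ℝ × ℝ}
    (hp : p ∈ disc ε) (hpρ : ρ ≤ ‖p‖) (hV : V p = 0) :
    (|frameW c s p| ≤ τ * |frameU c s p|) ∨ |frameU c s p| ≤ τ * |frameW c s p| := by
  by_contra! hcon
  obtain ⟨h1, h2⟩ := hcon
  have hb := h.value_V p hp hpρ
  have hA : 0 < A := hk.m_pos.trans_le hk.mA
  have hB : 0 < B := hk.m_pos.trans_le hk.mB
  have hn := frame_sq hcs p
  have hnn := norm_sq_le_normSq p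
  have hτ := hk.τ_pos
  have hτ' := hk.τ_le_quarter
  have hKp := abs_pos.2 hk.K_ne
  have hm := hk.m_pos
  rw [hV, zero_sub, abs_neg] at hb
  set u := frameU c s p
  set w := frameW c s p
  have hQ : m * ‖p‖ ^ 2 ≤ A * u ^ 2 + B * w ^ 2 := by
    have : m * u ^ 2 ≤ A * u ^ 2 := by gcongr; exact hk.mA
    have : m * w ^ 2 ≤ B * w ^ 2 := by gcongr; exact hk.mB
    have : m * ‖p‖ ^ 2 ≤ m * normSq p := by gcongr
    rw [← hn] at this
    linarith
  have huw : τ * ‖p‖ ^ 2 ≤ 2 * (|u| * |w|) := by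
    have : τ * ‖p‖ ^ 2 ≤ τ * normSq p := by gcongr
    rw [← hn, ← sq_abs u, ← sq_abs w] at this
    have := mul_le_mul_of_nonneg_left h1.le (abs_nonneg u)
    have := mul_le_mul_of_nonneg_left h2.le (abs_nonneg w)
    nlinarith
  have hN : 0 < ‖p‖ := hρ.trans_le hpρ
  have e : |K * u * w * (A * u ^ 2 + B * w ^ 2)| = |K| * (|u| * |w|) * (A * u ^ 2 + B * w ^ 2) := by
    rw [abs_mul, abs_mul, abs_mul, abs_of_nonneg (by positivity : 0 ≤ A * u ^ 2 + B * w ^ 2)]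
    ring
  rw [e] at hb
  have h3 : |K| * (τ * ‖p‖ ^ 2) * (m * ‖p‖ ^ 2) ≤
      |K| * (2 * (|u| * |w|)) * (A * u ^ 2 + B * w ^ 2) := by gcongr
  have h4 : 64 * η * ‖p‖ ^ 4 ≤ |K| * τ * m * ‖p‖ ^ 4 :=
    mul_le_mul_of_nonneg_right hk.η_le' (by positivity)
  have h5 : 0 < η * ‖p‖ ^ 4 := by have := hk.η_pos; positivity
  have h6 : |K| * (τ * ‖p‖ ^ 2) * (m * ‖p‖ ^ 2) = |K| * τ * m * ‖p‖ ^ 4 := by ring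
  linarith

/-- Follow the curve across the sector, parametrised by the slope `x = w / u`. The model value is `K
k⁴ x (A + B x²)` at distance `k` along the axis, and it dominates the error at `x = ± τ`; so `V`
changes sign between the two sides. -/
theorem ModelBounds.exists_mem_sector (h : ModelBounds g V ε ρ A B K c s η)
    (hk : GoodConstants A B K m C τ η) (hcs : c ^ 2 + s ^ 2 = 1)
    {M : ℝ × ℝ → ℝ} (hM : IsGauge M) (hcurve : ∀ p, p ∈ curve g ε ↔ M p = 1)
    (hfar : ∀ p ∈ curve g ε, ρ ≤ ‖p‖) :
    ∃ x k : ℝ, |x| ≤ τ ∧ 0 < k ∧ k • (c - x * s, s + x * c) ∈ curve g ε ∧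
      V (k • (c - x * s, s + x * c)) = 0 := by
  have hτ := hk.τ_pos
  have hτ' := hk.τ_le_quarter
  let y : ℝ → ℝ × ℝ := fun x => (c - x * s, s + x * c)
  have hyU : ∀ x, frameU c s (y x) = 1 := fun x => by
    simp only [frameU, y]; linear_combination hcs
  have hyW : ∀ x, frameW c s (y x) = x := fun x => by
    simp only [frameW, y]; linear_combination x * hcs
  have hy0 : ∀ x, y x ≠ 0 := fun x h0 => by
    have := hyU x
    rw [h0] at this
    simp [frameU] at this
  have hyc : Continuous y := by fun_prop
  let P : ℝ → ℝ × ℝ := fun x => (M (y x))⁻¹ • y x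
  have hMy : ∀ x, 0 < (M (y x))⁻¹ := fun x => inv_pos.2 (hM.pos _ (hy0 x))
  have hPc : Continuous P := ((hM.cont.comp hyc).inv₀ fun x => (hM.pos _ (hy0 x)).ne').smul hyc
  have hP : ∀ x, P x ∈ curve g ε := fun x => by
    rw [hcurve, hM.homog _ (hMy x), inv_mul_cancel₀ (hM.pos _ (hy0 x)).ne']
  -- Multiplying by `K` makes the sign at `x = ± τ` independent of the sign of `K`.
  have hVc : Continuous fun x => K * V (P x) := by
    refine continuous_const.mul (continuous_iff_continuousAt.2 fun x => ?_)
    exact ContinuousAt.comp (h.diff_V _ (hP x).1).continuousAt hPc.continuousAt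
  have key : ∀ x, |x| ≤ τ → |K * V (P x) -
      K ^ 2 * x * (M (y x))⁻¹ ^ 4 * (A + B * x ^ 2)| ≤ |K| * (16 * η * (M (y x))⁻¹ ^ 4) := by
    intro x hx
    set k := (M (y x))⁻¹
    have hkpos : 0 < k := hMy x
    have eU : frameU c s (P x) = k := by
      have : frameU c s (P x) = k * frameU c s (y x) := by
        simp only [frameU, P, Prod.smul_fst, Prod.smul_snd, smul_eq_mul]; ring
      rw [this, hyU, mul_one]
    have eW : frameW c s (P x) = k * x := by
      have : frameW c s (P x) = k * frameW c s (y x) := by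
        simp only [frameW, P, Prod.smul_fst, Prod.smul_snd, smul_eq_mul]; ring
      rw [this, hyW]
    have hb := h.value_V _ (hP x).1 (hfar _ (hP x))
    have hn : ‖P x‖ ≤ 2 * k := by
      have := norm_le_two_mul_frameU (p := P x) (τ := τ) hcs (by linarith)
        (by rw [eU, eW, abs_mul, abs_of_pos hkpos]; nlinarith) (by rw [eU]; exact hkpos.le)
      rwa [eU] at this
    rw [eU, eW] at hb
    have e : K * V (P x) - K ^ 2 * x * k ^ 4 * (A + B * x ^ 2) =
        K * (V (P x) - K * k * (k * x) * (A * k ^ 2 + B * (k * x) ^ 2)) := by ring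
    rw [e, abs_mul]
    refine mul_le_mul_of_nonneg_left (hb.trans ?_) (abs_nonneg K)
    have : ‖P x‖ ^ 4 ≤ (2 * k) ^ 4 := pow_le_pow_left₀ (norm_nonneg _) hn 4
    have := mul_le_mul_of_nonneg_left this hk.η_pos.le
    linarith
  have hlow : ∀ x, |x| = τ →
      |K| * (16 * η * (M (y x))⁻¹ ^ 4) ≤ K ^ 2 * τ * (M (y x))⁻¹ ^ 4 * (A + B * x ^ 2) := by
    intro x hx
    have hk4 : 0 < (M (y x))⁻¹ ^ 4 := pow_pos (hMy x) 4
    set k4 := (M (y x))⁻¹ ^ 4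
    have h1 : 64 * η * (|K| * k4) ≤ |K| * τ * m * (|K| * k4) :=
      mul_le_mul_of_nonneg_right hk.η_le' (by positivity)
    have h2 : |K| * τ * m * (|K| * k4) = K ^ 2 * τ * k4 * m := by rw [← sq_abs K]; ring
    have h3 : K ^ 2 * τ * k4 * m ≤ K ^ 2 * τ * k4 * (A + B * x ^ 2) := by
      have : 0 ≤ B * x ^ 2 := mul_nonneg (hk.m_pos.le.trans hk.mB) (sq_nonneg x)
      gcongr
      linarith [hk.mA]
    have h4 : 0 ≤ η * (|K| * k4) := by have := hk.η_pos; positivity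
    linarith
  have hneg : K * V (P (-τ)) ≤ 0 := by
    have h1 := key (-τ) (by rw [abs_neg, abs_of_pos hτ])
    have h2 := hlow (-τ) (by rw [abs_neg, abs_of_pos hτ])
    have h3 := (abs_le.1 h1).2
    linarith
  have hpos : 0 ≤ K * V (P τ) := by
    have h1 := key τ (by rw [abs_of_pos hτ])
    have h2 := hlow τ (by rw [abs_of_pos hτ])
    have h3 := (abs_le.1 h1).1
    linarith
  obtain ⟨x, hx, hx0⟩ := intermediate_value_Icc (by linarith : -τ ≤ τ) hVc.continuousOn ⟨hneg, hpos⟩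
  exact ⟨x, (M (y x))⁻¹, abs_le.2 hx, hMy x, hP x, (mul_eq_zero.1 hx0).resolve_left hk.K_ne⟩

end

/-! ### Ovals with four vertices -/

/-- The four unit coordinate vectors. -/
def fourPoints : Set (ℝ × ℝ) := {(1, 0), (0, 1), (-1, 0), (0, -1)}

lemma encard_fourPoints : fourPoints.encard = 4 := by
  unfold fourPoints
  rw [encard_insert_of_notMem, encard_insert_of_notMem, encard_insert_of_notMem, encard_singleton]
  · norm_num
  · norm_num
  · norm_num
  · norm_num

/-- The curve `g = 0` in the disc of radius `ε` is a smooth oval around the origin with four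
vertices and without inflections. -/
structure IsOval (g : ℝ × ℝ → ℝ) (ε : ℝ) : Prop where
  inflections_eq : inflections g ε = ∅
  diffeo : CurvesDiffeomorphic (curve g ε) {p | normSq p = 1}
  diffeo_symm : CurvesDiffeomorphic {p | normSq p = 1} (curve g ε)
  homeo : ∃ h : disc ε ≃ₜ ℝ × ℝ, (∀ p : disc ε, (p : ℝ × ℝ) ∈ curve g ε ↔ normSq (h p) = 1) ∧
    ∀ p : disc ε, (p : ℝ × ℝ) ∈ vertices g ε ↔ h p ∈ fourPoints

lemma IsOval.encard_vertices {g : ℝ × ℝ → ℝ} {ε : ℝ} (h : IsOval g ε) :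
    (vertices g ε).encard = 4 := by
  obtain ⟨φ, -, hφ⟩ := h.homeo
  have : vertices g ε = Subtype.val '' (φ.symm '' fourPoints) := by
    ext p
    constructor
    · intro hp
      have hpd : p ∈ disc ε := hp.1.1
      exact ⟨⟨p, hpd⟩, ⟨φ ⟨p, hpd⟩, (hφ ⟨p, hpd⟩).1 hp, φ.symm_apply_apply _⟩, rfl⟩
    · rintro ⟨_, ⟨q, hq, rfl⟩, rfl⟩
      rw [hφ, φ.apply_symm_apply]
      exact hq
  rw [this, Subtype.val_injective.encard_image, φ.symm.injective.encard_image, encard_fourPoints]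

/-- The estimates are assumed from radius `r / 4` on, whereas the curve lies beyond `r`: the factor
`4` is the margin required for chords in `ModelBounds.eq_of_mem_sector`. -/
theorem isOval_of_modelBounds {A B K c s m C τ η ε r : ℝ} {g : ℝ × ℝ → ℝ}
    (hk : GoodConstants A B K m C τ η) (hcs : c ^ 2 + s ^ 2 = 1) (hε : 0 < ε) (hr : 0 < r)
    (hg : ∀ p ∈ disc ε, ContDiffAt ℝ ∞ g p)
    (hneg : ∀ p ∈ disc ε, ‖p‖ ≤ r → g p < 0)
    (hpos : ∀ p, ‖p‖ = ε / 2 → 0 < g p)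
    (hinfl : ∀ p ∈ disc ε, r / 4 ≤ ‖p‖ → inflFun g p ≠ 0)
    (h : ModelBounds g (vertFun g) ε (r / 4) A B K c s η) : IsOval g ε := by
  have hcs2 : (-s) ^ 2 + c ^ 2 = 1 := by linarith [neg_sq s]
  have hcs3 : (-c) ^ 2 + (-s) ^ 2 = 1 := by linarith [neg_sq s, neg_sq c]
  have hcs4 : (-(-s)) ^ 2 + (-c) ^ 2 = 1 := by rw [neg_neg]; linarith [neg_sq c]
  have h2 := h.rotate
  have h3 := h2.rotate
  have h4 := h3.rotate
  have k2 := hk.rotate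
  have k3 := k2.rotate
  have k4 := k3.rotate
  have hrad : ∀ p ∈ disc ε, r ≤ ‖p‖ → 0 < fderiv ℝ g p p := by
    intro p hp hrp
    have hb := (abs_le.1 (h.fderiv_g p hp (by linarith) p)).1
    have hn : 0 < ‖p‖ := hr.trans_le hrp
    have h1 : m * (frameU c s p * frameU c s p) ≤ A * (frameU c s p * frameU c s p) :=
      mul_le_mul_of_nonneg_right hk.mA (mul_self_nonneg _)
    have h2 : m * (frameW c s p * frameW c s p) ≤ B * (frameW c s p * frameW c s p) :=
      mul_le_mul_of_nonneg_right hk.mB (mul_self_nonneg _)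
    have h3 : m * ‖p‖ ^ 2 ≤ m * normSq p :=
      mul_le_mul_of_nonneg_left (norm_sq_le_normSq p) hk.m_pos.le
    rw [← frame_sq hcs p] at h3
    have h4 : 64 * η * ‖p‖ ^ 2 ≤ m * ‖p‖ ^ 2 :=
      mul_le_mul_of_nonneg_right hk.η_le (sq_nonneg _)
    have h5 : 0 < η * ‖p‖ ^ 2 := mul_pos hk.η_pos (pow_pos hn 2)
    nlinarith
  obtain ⟨M, hM, hMs, hlt, hcurve⟩ := exists_gauge hε hr hg hneg hrad hpos
  have hfar : ∀ p ∈ curve g ε, r ≤ ‖p‖ := by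
    rintro p ⟨hp, hgp⟩
    by_contra hcon
    exact (hneg p hp (not_le.1 hcon).le).ne hgp
  have hfar' : ∀ p ∈ curve g ε, r / 4 ≤ ‖p‖ := fun p hp => by linarith [hfar p hp]
  have hset : curve g ε = {p | M p = 1} := by ext p; exact hcurve p
  have hset' : {p : ℝ × ℝ | normSq p = 1} = {p | euclid p = 1} := by
    ext p; exact euclid_eq_one.symm
  obtain ⟨x₁, t₁, hx₁, ht₁, hc₁, hv₁⟩ := h.exists_mem_sector hk hcs hM hcurve hfar'
  obtain ⟨x₂, t₂, hx₂, ht₂, hc₂, hv₂⟩ := h2.exists_mem_sector k2 hcs2 hM hcurve hfar'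
  obtain ⟨x₃, t₃, hx₃, ht₃, hc₃, hv₃⟩ := h3.exists_mem_sector k3 hcs3 hM hcurve hfar'
  obtain ⟨x₄, t₄, hx₄, ht₄, hc₄, hv₄⟩ := h4.exists_mem_sector k4 hcs4 hM hcurve hfar'
  have hτ : τ ≤ 1 / 4 := by linarith [hk.τ_le_quarter]
  -- The parameters of `L` are the slopes of the four vertices. The signs come from expressing the
  -- vectors `(c - x s, s + x c)` of the successively rotated frames in the original frame.
  obtain ⟨L, hL, hL1, hL2, hL3, hL4⟩ := exists_conic_homeo hcs (hx₁.trans hτ)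
    (β := -x₂) (γ := -x₃) (δ := x₄) (by rw [abs_neg]; exact hx₂.trans hτ)
    (by rw [abs_neg]; exact hx₃.trans hτ) (hx₄.trans hτ)
  obtain ⟨φ, hφ, hφ'⟩ := exists_disc_homeo hε hM hlt L hL
  have e₁ : φ ⟨_, hc₁.1⟩ = (1, 0) :=
    hφ' _ _ t₁ ht₁ (by simp [normSq]) ((hcurve _).1 hc₁) (by rw [hL1])
  have e₂ : φ ⟨_, hc₂.1⟩ = (0, 1) :=
    hφ' _ _ t₂ ht₂ (by simp [normSq]) ((hcurve _).1 hc₂) (by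
      rw [hL2]; ext <;> simp only [Prod.smul_fst, Prod.smul_snd, smul_eq_mul] <;> ring)
  have e₃ : φ ⟨_, hc₃.1⟩ = (-1, 0) :=
    hφ' _ _ t₃ ht₃ (by simp [normSq]) ((hcurve _).1 hc₃) (by
      rw [hL3]; ext <;> simp only [Prod.smul_fst, Prod.smul_snd, smul_eq_mul] <;> ring)
  have e₄ : φ ⟨_, hc₄.1⟩ = (0, -1) :=
    hφ' _ _ t₄ ht₄ (by simp [normSq]) ((hcurve _).1 hc₄) (by
      rw [hL4]; ext <;> simp only [Prod.smul_fst, Prod.smul_snd, smul_eq_mul] <;> ring)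
  refine ⟨?_, ?_, ?_, φ, fun p => (hcurve p).trans (hφ p), ?_⟩
  · refine eq_empty_iff_forall_notMem.2 fun p hp => ?_
    exact hinfl p hp.1.1 (hfar' p hp.1) hp.2
  · rw [hset, hset']
    exact hM.curvesDiffeomorphic isGauge_euclid hMs fun p hp => contDiffAt_euclid hp
  · rw [hset, hset']
    exact isGauge_euclid.curvesDiffeomorphic hM (fun p hp => contDiffAt_euclid hp) hMs
  · intro p
    constructor
    · rintro ⟨hpc, hpv⟩
      have hρ : 0 < r / 4 := by linarith
      have hpr : 4 * (r / 4) ≤ ‖(p : ℝ × ℝ)‖ := by linarith [hfar p hpc]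
      have hmem := h.mem_sector hk hcs hρ hpc.1 (hfar' p hpc) hpv
      have inSector : ∀ {c s x t : ℝ}, c ^ 2 + s ^ 2 = 1 → |x| ≤ τ → 0 < t →
          |frameW c s (t • (c - x * s, s + x * c))| ≤
            τ * frameU c s (t • (c - x * s, s + x * c)) := by
        intro c s x t hcs hx ht
        have e1 : frameW c s (t • (c - x * s, s + x * c)) = t * x := by
          simp only [frameW, Prod.smul_fst, Prod.smul_snd, smul_eq_mul]
          linear_combination t * x * hcs
        have e2 : frameU c s (t • (c - x * s, s + x * c)) = t := by
          simp only [frameU, Prod.smul_fst, Prod.smul_snd, smul_eq_mul]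
          linear_combination t * hcs
        rw [e1, e2, abs_mul, abs_of_pos ht, mul_comm]
        exact mul_le_mul_of_nonneg_right hx ht.le
      -- Uniqueness within one sector, stated for a variable frame so that it serves all four
      -- rotated copies.
      have finish : ∀ {A B K c s x t : ℝ} {e : ℝ × ℝ},
          ModelBounds g (vertFun g) ε (r / 4) A B K c s η → GoodConstants A B K m C τ η →
          c ^ 2 + s ^ 2 = 1 → |x| ≤ τ → 0 < t →
          ∀ hc : t • (c - x * s, s + x * c) ∈ curve g ε,
          vertFun g (t • (c - x * s, s + x * c)) = 0 → φ ⟨_, hc.1⟩ = e →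
          |frameW c s p| ≤ τ * frameU c s p → φ p = e := by
        intro A B K c s x t e h hk hcs hx ht hc hv he hp
        have := h.eq_of_mem_sector hk hcs hρ hpc.1 hc.1 hpr (by linarith [hfar _ hc]) hp
          (inSector hcs hx ht) (hpc.2.trans hc.2.symm) (hpv.trans hv.symm)
        rw [← he]
        congr 1
        exact Subtype.ext this
      unfold fourPoints
      simp only [mem_insert_iff, mem_singleton_iff]
      rcases hmem with hm | hm
      · rcases abs_cases (frameU c s p) with ⟨hu, -⟩ | ⟨hu, -⟩
        · exact Or.inl (finish h hk hcs hx₁ ht₁ hc₁ hv₁ e₁ (by rwa [hu] at hm))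
        · refine Or.inr (Or.inr (Or.inl (finish h3 k3 hcs3 hx₃ ht₃ hc₃ hv₃ e₃ ?_)))
          rw [frameW_rotate, frameU_rotate, frameU_rotate, frameW_rotate, abs_neg]
          rwa [hu] at hm
      · rcases abs_cases (frameW c s p) with ⟨hu, -⟩ | ⟨hu, -⟩
        · refine Or.inr (Or.inl (finish h2 k2 hcs2 hx₂ ht₂ hc₂ hv₂ e₂ ?_))
          rw [frameW_rotate, frameU_rotate, abs_neg]
          rwa [hu] at hm
        · refine Or.inr (Or.inr (Or.inr (finish h4 k4 hcs4 hx₄ ht₄ hc₄ hv₄ e₄ ?_)))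
          rw [frameW_rotate, frameU_rotate, frameU_rotate, frameW_rotate, frameW_rotate, abs_neg,
            abs_neg]
          rwa [hu] at hm
    · intro hp
      have back : ∀ {q : ℝ × ℝ} (hq : q ∈ curve g ε), vertFun g q = 0 → φ ⟨q, hq.1⟩ = φ p →
          (p : ℝ × ℝ) ∈ vertices g ε := by
        intro q hq hv he
        have := φ.injective he
        rw [← this]
        exact ⟨hq, hv⟩
      unfold fourPoints at hp
      simp only [mem_insert_iff, mem_singleton_iff] at hp
      rcases hp with hp | hp | hp | hp
      · exact back hc₁ hv₁ (e₁.trans hp.symm)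
      · exact back hc₂ hv₂ (e₂.trans hp.symm)
      · exact back hc₃ hv₃ (e₃.trans hp.symm)
      · exact back hc₄ hv₄ (e₄.trans hp.symm)

/-! ### Curves with the same geometry -/

lemma CurvesDiffeomorphic.trans {X Y Z : Set (ℝ × ℝ)} (h₁ : CurvesDiffeomorphic X Y)
    (h₂ : CurvesDiffeomorphic Y Z) : CurvesDiffeomorphic X Z := by
  obtain ⟨φ, hX, hY, s1, s2, hφ⟩ := h₁
  obtain ⟨ψ, hY', hZ, s3, s4, hψ⟩ := h₂
  refine ⟨φ.trans ψ, ?_, ?_, ?_, ?_, ?_⟩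
  · intro x hx
    rw [OpenPartialHomeomorph.trans_source]
    exact ⟨hX hx, hY' (hφ ▸ mem_image_of_mem φ hx)⟩
  · intro z hz
    rw [OpenPartialHomeomorph.trans_target]
    refine ⟨hZ hz, ?_⟩
    obtain ⟨y, hy, rfl⟩ := hψ ▸ hz
    rw [mem_preimage, ψ.left_inv (hY' hy)]
    exact hY hy
  · rw [OpenPartialHomeomorph.trans_source]
    exact s3.comp (s1.mono inter_subset_left) inter_subset_right
  · rw [OpenPartialHomeomorph.trans_target]
    exact s2.comp (s4.mono inter_subset_left) inter_subset_right
  · rw [OpenPartialHomeomorph.coe_trans, image_comp, hφ, hψ]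

lemma CurvesDiffeomorphic.refl (X : Set (ℝ × ℝ)) : CurvesDiffeomorphic X X :=
  ⟨OpenPartialHomeomorph.refl _, subset_univ _, subset_univ _, contDiff_id.contDiffOn,
    contDiff_id.contDiffOn, image_id X⟩

lemma singularPoints_subset_inflections (g : ℝ × ℝ → ℝ) (ε : ℝ) :
    singularPoints g ε ⊆ inflections g ε := by
  rintro p ⟨hp, hx, hy⟩
  exact ⟨hp, by simp [inflFun, hx, hy]⟩

/-- Self-intersections are defined by continuous injective arcs alone, so a homeomorphism of the
disc that respects the curves transports them. -/
lemma mem_selfIntersections_of_homeo {g₁ g₂ : ℝ × ℝ → ℝ} {ε : ℝ} (h : disc ε ≃ₜ disc ε)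
    (hc : ∀ p : disc ε, (p : ℝ × ℝ) ∈ curve g₁ ε → (h p : ℝ × ℝ) ∈ curve g₂ ε) {p : disc ε}
    (hp : (p : ℝ × ℝ) ∈ selfIntersections g₁ ε) :
    (h p : ℝ × ℝ) ∈ selfIntersections g₂ ε := by
  obtain ⟨γ₁, γ₂, c1, c2, i1, i2, z1, z2, r1, r2, r3⟩ := hp
  have d1 : ∀ t, γ₁ t ∈ disc ε := fun t => (r1 (mem_range_self t)).1
  have d2 : ∀ t, γ₂ t ∈ disc ε := fun t => (r2 (mem_range_self t)).1
  refine ⟨fun t => h ⟨γ₁ t, d1 t⟩, fun t => h ⟨γ₂ t, d2 t⟩, ?_, ?_, ?_, ?_, ?_, ?_, ?_, ?_, ?_⟩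
  · exact continuous_subtype_val.comp (h.continuous.comp (c1.subtype_mk d1))
  · exact continuous_subtype_val.comp (h.continuous.comp (c2.subtype_mk d2))
  · intro a b hab
    exact i1 (congrArg Subtype.val (h.injective (Subtype.ext hab)))
  · intro a b hab
    exact i2 (congrArg Subtype.val (h.injective (Subtype.ext hab)))
  · simp only [z1]
  · simp only [z2]
  · rintro _ ⟨t, rfl⟩
    exact hc _ (r1 (mem_range_self t))
  · rintro _ ⟨t, rfl⟩
    exact hc _ (r2 (mem_range_self t))
  · ext q
    constructor
    · rintro ⟨⟨a, rfl⟩, ⟨b, hb⟩⟩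
      have hab := congrArg Subtype.val (h.injective (Subtype.ext hb))
      have hmem : γ₁ a ∈ range γ₁ ∩ range γ₂ := ⟨mem_range_self a, ⟨b, hab⟩⟩
      rw [r3, mem_singleton_iff] at hmem
      simp only [hmem, mem_singleton_iff]
    · rintro rfl
      exact ⟨⟨0, by simp only [z1]⟩, ⟨0, by simp only [z2]⟩⟩

lemma selfIntersections_iff_of_homeo {g₁ g₂ : ℝ × ℝ → ℝ} {ε : ℝ} (h : disc ε ≃ₜ disc ε)
    (hc : ∀ p : disc ε, (p : ℝ × ℝ) ∈ curve g₁ ε ↔ (h p : ℝ × ℝ) ∈ curve g₂ ε) (p : disc ε) :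
    (p : ℝ × ℝ) ∈ selfIntersections g₁ ε ↔ (h p : ℝ × ℝ) ∈ selfIntersections g₂ ε := by
  refine ⟨mem_selfIntersections_of_homeo h fun p => (hc p).1, fun hp => ?_⟩
  have := mem_selfIntersections_of_homeo (g₂ := g₁) h.symm
    (fun p hp => (hc _).2 (by rwa [h.apply_symm_apply])) hp
  rwa [h.symm_apply_apply] at this

/-- Both curves are compared with the unit circle and its four standard points. Singular points need
no separate treatment: they are inflections, and there are none. -/
lemma IsOval.sameGeometry {g₁ g₂ : ℝ × ℝ → ℝ} {ε : ℝ} (h₁ : IsOval g₁ ε) (h₂ : IsOval g₂ ε) :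
    SameGeometry g₁ g₂ ε := by
  refine ⟨h₁.diffeo.trans h₂.diffeo_symm, ⟨?_, ?_⟩, ?_⟩
  · rw [h₁.inflections_eq, h₂.inflections_eq]
  · rw [h₁.encard_vertices, h₂.encard_vertices]
  obtain ⟨φ₁, c₁, v₁⟩ := h₁.homeo
  obtain ⟨φ₂, c₂, v₂⟩ := h₂.homeo
  have hc : ∀ p : disc ε, (p : ℝ × ℝ) ∈ curve g₁ ε ↔ ((φ₁.trans φ₂.symm) p : ℝ × ℝ) ∈ curve g₂ ε :=
    fun p => by rw [c₁, c₂, Homeomorph.trans_apply, φ₂.apply_symm_apply]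
  have s₁ := subset_eq_empty (singularPoints_subset_inflections g₁ ε) h₁.inflections_eq
  have s₂ := subset_eq_empty (singularPoints_subset_inflections g₂ ε) h₂.inflections_eq
  refine ⟨φ₁.trans φ₂.symm, fun p => ⟨hc p, ?_, selfIntersections_iff_of_homeo _ hc p, ?_, ?_⟩⟩
  · rw [s₁, s₂]; simp
  · rw [h₁.inflections_eq, h₂.inflections_eq]; simp
  · rw [v₁, v₂, Homeomorph.trans_apply, φ₂.apply_symm_apply]

lemma sameGeometry_of_eq {g₁ g₂ : ℝ × ℝ → ℝ} {ε : ℝ} (hc : curve g₁ ε = curve g₂ ε)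
    (hs : singularPoints g₁ ε = singularPoints g₂ ε) (hi : inflections g₁ ε = inflections g₂ ε)
    (hv : vertices g₁ ε = vertices g₂ ε) : SameGeometry g₁ g₂ ε := by
  refine ⟨hc ▸ CurvesDiffeomorphic.refl _, ⟨by rw [hi], by rw [hv]⟩, Homeomorph.refl _,
    fun p => ⟨by rw [hc]; rfl, by rw [hs]; rfl, ?_, by rw [hi]; rfl, by rw [hv]; rfl⟩⟩
  exact selfIntersections_iff_of_homeo (Homeomorph.refl _) (fun p => by rw [hc]; rfl) p

lemma sameGeometry_of_empty {g₁ g₂ : ℝ × ℝ → ℝ} {ε : ℝ} (h₁ : curve g₁ ε = ∅)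
    (h₂ : curve g₂ ε = ∅) : SameGeometry g₁ g₂ ε := by
  have aux : ∀ {g : ℝ × ℝ → ℝ}, curve g ε = ∅ → singularPoints g ε = ∅ ∧ inflections g ε = ∅ ∧
      vertices g ε = ∅ := fun h =>
    ⟨subset_eq_empty (fun p hp => hp.1) h, subset_eq_empty (fun p hp => hp.1) h,
      subset_eq_empty (fun p hp => hp.1) h⟩
  obtain ⟨s1, i1, v1⟩ := aux h₁
  obtain ⟨s2, i2, v2⟩ := aux h₂
  exact sameGeometry_of_eq (h₁.trans h₂.symm) (s1.trans s2.symm) (i1.trans i2.symm)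
    (v1.trans v2.symm)

/-! ### Functions that agree on the disc -/

lemma dx_congr {g₁ g₂ : ℝ × ℝ → ℝ} {U : Set (ℝ × ℝ)} (hU : IsOpen U) (h : EqOn g₁ g₂ U) :
    EqOn (dx g₁) (dx g₂) U := fun p hp => by
  have : g₁ =ᶠ[𝓝 p] g₂ := by filter_upwards [hU.mem_nhds hp] with q hq using h hq
  simp only [dx, this.fderiv_eq]

lemma dy_congr {g₁ g₂ : ℝ × ℝ → ℝ} {U : Set (ℝ × ℝ)} (hU : IsOpen U) (h : EqOn g₁ g₂ U) :
    EqOn (dy g₁) (dy g₂) U := fun p hp => by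
  have : g₁ =ᶠ[𝓝 p] g₂ := by filter_upwards [hU.mem_nhds hp] with q hq using h hq
  simp only [dy, this.fderiv_eq]

lemma sameGeometry_of_eqOn {g₁ g₂ : ℝ × ℝ → ℝ} {ε : ℝ} (h : EqOn g₁ g₂ (disc ε)) :
    SameGeometry g₁ g₂ ε := by
  have hU := isOpen_disc ε
  have hx := dx_congr hU h
  have hy := dy_congr hU h
  have hxx := dx_congr hU hx
  have hyx := dy_congr hU hx
  have hyy := dy_congr hU hy
  have hxxx := dx_congr hU hxx
  have hyxx := dy_congr hU hxx
  have hyyx := dy_congr hU hyx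
  have hyyy := dy_congr hU hyy
  have hi : ∀ p ∈ disc ε, inflFun g₁ p = inflFun g₂ p := fun p hp => by
    simp only [inflFun, hx hp, hy hp, hxx hp, hyx hp, hyy hp]
  have hv : ∀ p ∈ disc ε, vertFun g₁ p = vertFun g₂ p := fun p hp => by
    simp only [vertFun, hx hp, hy hp, hxx hp, hyx hp, hyy hp, hxxx hp, hyxx hp, hyyx hp, hyyy hp]
  have hc : curve g₁ ε = curve g₂ ε := by
    ext p; exact and_congr_right fun hp => by rw [h hp]
  refine sameGeometry_of_eq hc ?_ ?_ ?_
  · ext p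
    simp only [singularPoints, hc]
    exact and_congr_right fun hp => by rw [hx hp.1, hy hp.1]
  · ext p
    simp only [inflections, hc]
    exact and_congr_right fun hp => by rw [hi p hp.1]
  · ext p
    simp only [vertices, hc]
    exact and_congr_right fun hp => by rw [hv p hp.1]

/-! ### Partial derivatives of families of functions on the plane -/

/-- The derivative in the direction `v` of the plane of a family of functions. -/
noncomputable def partialDeriv (v : ℝ × ℝ) (G : (ℝ × ℝ) × ℝ → ℝ) : (ℝ × ℝ) × ℝ → ℝ :=
  fun z => fderiv ℝ G z (v, 0)

section Germs

variable {E F : Type*} [NormedAddCommGroup E] [NormedSpace ℝ E] [NormedAddCommGroup F]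
  [NormedSpace ℝ F]

lemma SmoothGermAt.contDiffAt {g : E → F} {x : E} (h : SmoothGermAt g x) : ContDiffAt ℝ ∞ g x :=
  h.self_of_nhds

lemma SmoothGermAt.eventually_differentiableAt {g : E → F} {x : E} (h : SmoothGermAt g x) :
    ∀ᶠ y in 𝓝 x, DifferentiableAt ℝ g y :=
  h.mono fun _ hy => hy.differentiableAt (by simp)

lemma _root_.ContDiffAt.fderiv_infty {g : E → F} {x : E} (h : ContDiffAt ℝ ∞ g x) :
    ContDiffAt ℝ ∞ (fderiv ℝ g) x :=
  h.fderiv_right (by simp)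

end Germs

lemma SmoothGermAt.partialDeriv {G : (ℝ × ℝ) × ℝ → ℝ} {z : (ℝ × ℝ) × ℝ} (h : SmoothGermAt G z)
    (v : ℝ × ℝ) : SmoothGermAt (partialDeriv v G) z :=
  h.mono fun _ hy => hy.fderiv_infty.clm_apply contDiffAt_const

lemma fderiv_slice {G : (ℝ × ℝ) × ℝ → ℝ} {z : (ℝ × ℝ) × ℝ} (hG : DifferentiableAt ℝ G z) :
    HasFDerivAt (fun p => G (p, z.2)) (fderiv ℝ G z ∘L ContinuousLinearMap.inl ℝ (ℝ × ℝ) ℝ) z.1 := by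
  have h1 : HasFDerivAt (fun p : ℝ × ℝ => (p, z.2)) (ContinuousLinearMap.inl ℝ (ℝ × ℝ) ℝ) z.1 := by
    exact (hasFDerivAt_id z.1).prodMk (hasFDerivAt_const z.2 z.1)
  exact HasFDerivAt.comp z.1 (g := G) hG.hasFDerivAt h1

/-- Passes from derivatives of the individual members to derivatives on the total space. Agreement
near the origin of the total space suffices, so the result can be iterated with `A` itself a
derivative of the members. -/
lemma eventually_hasFDerivAt_slice {A : ℝ → ℝ × ℝ → ℝ} {G : (ℝ × ℝ) × ℝ → ℝ}
    (hG : SmoothGermAt G 0) (h : ∀ᶠ z in 𝓝 (0 : (ℝ × ℝ) × ℝ), A z.2 z.1 = G z) :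
    ∀ᶠ z in 𝓝 (0 : (ℝ × ℝ) × ℝ), HasFDerivAt (A z.2)
      (fderiv ℝ G z ∘L ContinuousLinearMap.inl ℝ (ℝ × ℝ) ℝ) z.1 := by
  filter_upwards [hG.eventually_differentiableAt, h.eventually_nhds] with z hz hzA
  refine (fderiv_slice hz).congr_of_eventuallyEq ?_
  have hc : Tendsto (fun p : ℝ × ℝ => (p, z.2)) (𝓝 z.1) (𝓝 z) :=
    (continuous_id.prodMk continuous_const).tendsto' _ _ rfl
  exact hc.eventually hzA

lemma eventually_dx_slice {A : ℝ → ℝ × ℝ → ℝ} {G : (ℝ × ℝ) × ℝ → ℝ}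
    (hG : SmoothGermAt G 0) (h : ∀ᶠ z in 𝓝 (0 : (ℝ × ℝ) × ℝ), A z.2 z.1 = G z) :
    ∀ᶠ z in 𝓝 (0 : (ℝ × ℝ) × ℝ), dx (A z.2) z.1 = partialDeriv (1, 0) G z := by
  filter_upwards [eventually_hasFDerivAt_slice hG h] with z hz
  simp [dx, hz.fderiv, partialDeriv]

lemma eventually_dy_slice {A : ℝ → ℝ × ℝ → ℝ} {G : (ℝ × ℝ) × ℝ → ℝ}
    (hG : SmoothGermAt G 0) (h : ∀ᶠ z in 𝓝 (0 : (ℝ × ℝ) × ℝ), A z.2 z.1 = G z) :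
    ∀ᶠ z in 𝓝 (0 : (ℝ × ℝ) × ℝ), dy (A z.2) z.1 = partialDeriv (0, 1) G z := by
  filter_upwards [eventually_hasFDerivAt_slice hG h] with z hz
  simp [dy, hz.fderiv, partialDeriv]

/-- Only one mixed derivative is recorded in the Hessian data; the other is needed for the linear
part of `∂F/∂y`. -/
lemma partialDeriv_comm {G : (ℝ × ℝ) × ℝ → ℝ} {z : (ℝ × ℝ) × ℝ} (h : ContDiffAt ℝ ∞ G z)
    (v w : ℝ × ℝ) : partialDeriv v (partialDeriv w G) z = partialDeriv w (partialDeriv v G) z := by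
  have hd : DifferentiableAt ℝ (fderiv ℝ G) z := h.fderiv_infty.differentiableAt (by simp)
  have key : ∀ v w : ℝ × ℝ, partialDeriv v (partialDeriv w G) z =
      fderiv ℝ (fderiv ℝ G) z (v, 0) (w, 0) := by
    intro v w
    show fderiv ℝ (fun z => fderiv ℝ G z (w, 0)) z (v, 0) = _
    rw [fderiv_clm_apply hd (differentiableAt_const _)]
    simp
  have hs : IsSymmSndFDerivAt ℝ G z := h.isSymmSndFDerivAt
    (by simpa using WithTop.coe_le_coe.2 (le_top : (2 : ℕ∞) ≤ ⊤))
  rw [key, key]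
  exact hs _ _

/-! ### Orders of vanishing on a parabolic region -/

/-- The filter of neighbourhoods of the origin in the region `|t| ≤ M ‖p‖²`. -/
def parabolic (M : ℝ) : Filter ((ℝ × ℝ) × ℝ) :=
  𝓝 0 ⊓ 𝓟 {z | |z.2| ≤ M * ‖z.1‖ ^ 2}

lemma parabolic_le (M : ℝ) : parabolic M ≤ 𝓝 0 := inf_le_left

lemma eventually_parabolic {M : ℝ} :
    ∀ᶠ z : (ℝ × ℝ) × ℝ in parabolic M, |z.2| ≤ M * ‖z.1‖ ^ 2 :=
  mem_inf_of_right (mem_principal_self _)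

lemma tendsto_norm_fst_parabolic (M : ℝ) :
    Tendsto (fun z : (ℝ × ℝ) × ℝ => ‖z.1‖) (parabolic M) (𝓝 0) := by
  have : Continuous fun z : (ℝ × ℝ) × ℝ => ‖z.1‖ := by fun_prop
  exact (this.tendsto' 0 0 (by simp)).mono_left (parabolic_le M)

lemma isBigO_pow_succ (M : ℝ) (k : ℕ) : (fun z : (ℝ × ℝ) × ℝ => ‖z.1‖ ^ (k + 1)) =O[parabolic M]
    fun z => ‖z.1‖ ^ k := by
  refine IsBigO.of_bound 1 ?_
  filter_upwards [(tendsto_norm_fst_parabolic M).eventually_le_const one_pos] with z hz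
  rw [pow_succ, norm_mul, one_mul]
  exact mul_le_of_le_one_right (norm_nonneg _) (by simpa using hz)

lemma isBigO_snd (M : ℝ) : (fun z : (ℝ × ℝ) × ℝ => z.2) =O[parabolic M] fun z => ‖z.1‖ ^ 2 := by
  refine IsBigO.of_bound M ?_
  filter_upwards [eventually_parabolic] with z hz
  simpa using hz

/-- Since `t = O(‖p‖²)` on the region, the full variable `(p, t)` has size `O(‖p‖)`, and orders of
vanishing in all variables become orders in `‖p‖`. -/
lemma isBigO_id (M : ℝ) : (fun z : (ℝ × ℝ) × ℝ => z) =O[parabolic M] fun z => ‖z.1‖ := by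
  have h2 := (isBigO_snd M).trans (isBigO_pow_succ M 1)
  simp only [pow_one] at h2
  exact (isBigO_refl (fun z : (ℝ × ℝ) × ℝ => z.1) _).norm_right.prod_left h2

/-- The function `E` is `O(‖p‖^k)` on the parabolic region, and its derivatives with respect to
the variables of the plane are `O(‖p‖^(k-1))`. -/
structure HasOrder (M : ℝ) (k : ℕ) (E : (ℝ × ℝ) × ℝ → ℝ) : Prop where
  diff : ∀ᶠ z in parabolic M, DifferentiableAt ℝ E z
  value : E =O[parabolic M] fun z => ‖z.1‖ ^ k
  deriv : (fun z => ‖z.1‖ • (fderiv ℝ E z ∘L ContinuousLinearMap.inl ℝ (ℝ × ℝ) ℝ)) =O[parabolic M]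
    fun z => ‖z.1‖ ^ k

namespace HasOrder

variable {M : ℝ} {k l : ℕ} {E E' : (ℝ × ℝ) × ℝ → ℝ}

lemma add (h : HasOrder M k E) (h' : HasOrder M k E') :
    HasOrder M k fun z => E z + E' z where
  diff := by filter_upwards [h.diff, h'.diff] with z h1 h2 using h1.add h2
  value := h.value.add h'.value
  deriv := by
    refine (h.deriv.add h'.deriv).congr' ?_ EventuallyEq.rfl
    filter_upwards [h.diff, h'.diff] with z h1 h2
    rw [fderiv_fun_add h1 h2, ContinuousLinearMap.add_comp, smul_add]

lemma mul (h : HasOrder M k E) (h' : HasOrder M l E') :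
    HasOrder M (k + l) fun z => E z * E' z where
  diff := by filter_upwards [h.diff, h'.diff] with z h1 h2 using h1.mul h2
  value := by simpa only [pow_add] using h.value.mul h'.value
  deriv := by
    have h1 := h.value.smul h'.deriv
    have h2 := h'.value.smul h.deriv
    have h3 : (fun z : (ℝ × ℝ) × ℝ => ‖z.1‖ ^ l • ‖z.1‖ ^ k) = fun z => ‖z.1‖ ^ k • ‖z.1‖ ^ l := by
      funext z; simp only [smul_eq_mul, mul_comm]
    rw [h3] at h2
    have h4 : (fun z : (ℝ × ℝ) × ℝ => ‖z.1‖ ^ (k + l)) = fun z => ‖z.1‖ ^ k • ‖z.1‖ ^ l := by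
      funext z; simp only [smul_eq_mul, pow_add]
    rw [h4]
    refine (h1.add h2).congr' ?_ EventuallyEq.rfl
    filter_upwards [h.diff, h'.diff] with z h1 h2
    rw [fderiv_fun_mul h1 h2, ContinuousLinearMap.add_comp, smul_add, ContinuousLinearMap.smul_comp,
      ContinuousLinearMap.smul_comp, smul_comm (E z), smul_comm (E' z)]

lemma mono (h : HasOrder M (k + 1) E) : HasOrder M k E where
  diff := h.diff
  value := h.value.trans (isBigO_pow_succ M k)
  deriv := h.deriv.trans (isBigO_pow_succ M k)

lemma of_smoothGermAt (h : SmoothGermAt E 0) : HasOrder M 0 E where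
  diff := h.eventually_differentiableAt.filter_mono (parabolic_le M)
  value := by
    simp only [pow_zero]
    exact (h.contDiffAt.continuousAt.isBigO_one ℝ).mono (parabolic_le M)
  deriv := by
    have h1 := (h.contDiffAt.fderiv_infty.continuousAt.clm_comp
      (continuousAt_const (y := ContinuousLinearMap.inl ℝ (ℝ × ℝ) ℝ))).isBigO_one ℝ
    have h2 : (fun z : (ℝ × ℝ) × ℝ => ‖z.1‖) =O[parabolic M] fun _ => (1 : ℝ) :=
      (tendsto_norm_fst_parabolic M).isBigO_one ℝ
    simpa using h2.smul (h1.mono (parabolic_le M))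

lemma const (a : ℝ) : HasOrder M 0 fun _ => a :=
  of_smoothGermAt (Eventually.of_forall fun _ => contDiffAt_const)

lemma const_mul (a : ℝ) (h : HasOrder M k E) : HasOrder M k fun z => a * E z := by
  simpa only [zero_add] using (const a).mul h

lemma sub (h : HasOrder M k E) (h' : HasOrder M k E') :
    HasOrder M k fun z => E z - E' z := by
  have := h.add (h'.const_mul (-1))
  refine (funext fun z => ?_ : (fun z => E z + -1 * E' z) = fun z => E z - E' z) ▸ this
  ring

lemma of_apply_zero (h : SmoothGermAt E 0) (h0 : E 0 = 0) : HasOrder M 1 E where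
  diff := h.eventually_differentiableAt.filter_mono (parabolic_le M)
  value := by
    have h1 := (h.contDiffAt.differentiableAt (by simp)).isBigO_sub
    simp only [h0, sub_zero] at h1
    simpa only [pow_one] using (h1.mono (parabolic_le M)).trans (isBigO_id M)
  deriv := by
    have h1 := (h.contDiffAt.fderiv_infty.continuousAt.clm_comp
      (continuousAt_const (y := ContinuousLinearMap.inl ℝ (ℝ × ℝ) ℝ))).isBigO_one ℝ
    have h2 := (isBigO_refl (fun z : (ℝ × ℝ) × ℝ => ‖z.1‖) (parabolic M)).smul
      (h1.mono (parabolic_le M))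
    simpa using h2

/-- The derivative in `t` need not vanish, but `t` itself is of second order. The mean value theorem
in the plane gives `|E(p, t) - E(0, t)| ≤ C ‖z‖ ‖p‖`, and `|E(0, t)| ≤ C' |t|`. -/
lemma of_partialDeriv_zero (h : SmoothGermAt E 0) (h0 : E 0 = 0)
    (h1 : ∀ v, partialDeriv v E 0 = 0) : HasOrder M 2 E := by
  have hd0 : fderiv ℝ E 0 ∘L ContinuousLinearMap.inl ℝ (ℝ × ℝ) ℝ = 0 := by
    ext
    · simpa [partialDeriv] using h1 (1, 0)
    · simpa [partialDeriv] using h1 (0, 1)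
  have hD : (fun z => fderiv ℝ E z ∘L ContinuousLinearMap.inl ℝ (ℝ × ℝ) ℝ) =O[𝓝 0]
      fun z : (ℝ × ℝ) × ℝ => z := by
    have hdiff : DifferentiableAt ℝ
        (fun z => fderiv ℝ E z ∘L ContinuousLinearMap.inl ℝ (ℝ × ℝ) ℝ) 0 :=
      (h.contDiffAt.fderiv_infty.differentiableAt (by simp)).clm_comp (differentiableAt_const _)
    have := hdiff.isBigO_sub
    simpa only [hd0, sub_zero] using this
  refine ⟨h.eventually_differentiableAt.filter_mono (parabolic_le M), ?_, ?_⟩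
  · obtain ⟨C, hC0, hC⟩ := hD.exists_pos
    have hE := (h.contDiffAt.differentiableAt (by simp)).isBigO_sub
    simp only [h0, sub_zero] at hE
    obtain ⟨C', hC0', hC'⟩ := hE.exists_pos
    obtain ⟨δ, hδ, hball⟩ := Metric.eventually_nhds_iff_ball.1
      ((hC.bound.and hC'.bound).and h.eventually_differentiableAt)
    have key : E =O[parabolic M] fun z => ‖z‖ * ‖z.1‖ + ‖z.2‖ := by
      refine IsBigO.of_bound (C + C') ?_
      filter_upwards [parabolic_le M (Metric.ball_mem_nhds 0 hδ)] with z hz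
      rw [mem_ball_zero_iff] at hz
      have hle : ∀ q ∈ Metric.closedBall (0 : ℝ × ℝ) ‖z.1‖, ‖(q, z.2)‖ ≤ ‖z‖ := by
        intro q hq
        rw [mem_closedBall_zero_iff] at hq
        rw [Prod.norm_def, Prod.norm_def]
        exact max_le_max hq le_rfl
      have hmem : ∀ q ∈ Metric.closedBall (0 : ℝ × ℝ) ‖z.1‖, (q, z.2) ∈ Metric.ball 0 δ :=
        fun q hq => mem_ball_zero_iff.2 ((hle q hq).trans_lt hz)
      have hmv := (convex_closedBall (0 : ℝ × ℝ) ‖z.1‖).norm_image_sub_le_of_norm_hasFDerivWithin_le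
        (f := fun q => E (q, z.2)) (C := C * ‖z‖)
        (f' := fun q => fderiv ℝ E (q, z.2) ∘L ContinuousLinearMap.inl ℝ (ℝ × ℝ) ℝ)
        (fun q hq => (fderiv_slice (z := (q, z.2)) (hball _ (hmem q hq)).2).hasFDerivWithinAt)
        (fun q hq => (hball _ (hmem q hq)).1.1.trans
          (mul_le_mul_of_nonneg_left (hle q hq) hC0.le))
        (Metric.mem_closedBall_self (norm_nonneg _)) (y := z.1) (by simp)
      have h0t := (hball _ (hmem 0 (Metric.mem_closedBall_self (norm_nonneg _)))).1.2
      have hnt : ‖((0 : ℝ × ℝ), z.2)‖ = ‖z.2‖ := by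
        rw [Prod.norm_def]; simp
      rw [hnt] at h0t
      simp only [sub_zero] at hmv
      have htri : ‖E z‖ ≤ ‖E (z.1, z.2) - E (0, z.2)‖ + ‖E (0, z.2)‖ := by
        simpa using norm_add_le (E (z.1, z.2) - E (0, z.2)) (E (0, z.2))
      have n1 : 0 ≤ ‖z‖ * ‖z.1‖ := by positivity
      have n2 : 0 ≤ ‖z.2‖ := norm_nonneg _
      rw [Real.norm_of_nonneg (by positivity : 0 ≤ ‖z‖ * ‖z.1‖ + ‖z.2‖)]
      nlinarith [mul_nonneg hC0.le n2, mul_nonneg hC0'.le n1]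
    refine key.trans (IsBigO.add ?_ (isBigO_snd M).norm_left)
    have := (isBigO_id M).norm_left.mul (isBigO_refl (fun z : (ℝ × ℝ) × ℝ => ‖z.1‖) (parabolic M))
    simpa only [sq] using this
  · have h2 := (isBigO_refl (fun z : (ℝ × ℝ) × ℝ => ‖z.1‖) (parabolic M)).smul
      ((hD.mono (parabolic_le M)).trans (isBigO_id M))
    refine h2.congr_right fun z => ?_
    rw [smul_eq_mul, sq]

end HasOrder

/-! ### Leading parts on the parabolic region, and the principal frame of the Hessian -/

section

variable {M : ℝ} {k l : ℕ} {E E₀ E' E₀' : (ℝ × ℝ) × ℝ → ℝ}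

lemma HasOrder.congr (h : HasOrder M k E) (he : ∀ z, E z = E' z) : HasOrder M k E' :=
  funext he ▸ h

/-- One extra order of vanishing gives an arbitrarily small coefficient, both for the function and
for its planar derivatives. -/
lemma HasOrder.eventually_le (h : HasOrder M (k + 1) E) {η : ℝ} (hη : 0 < η) :
    ∀ᶠ z in parabolic M, |E z| ≤ η * ‖z.1‖ ^ k ∧
      ∀ v, ‖z.1‖ * |partialDeriv v E z| ≤ η * ‖z.1‖ ^ k * ‖v‖ := by
  have hlo : (fun z : (ℝ × ℝ) × ℝ => ‖z.1‖ ^ (k + 1)) =o[parabolic M] fun z => ‖z.1‖ ^ k := by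
    have h1 : (fun z : (ℝ × ℝ) × ℝ => ‖z.1‖) =o[parabolic M] fun _ => (1 : ℝ) :=
      (isLittleO_one_iff ℝ).2 (tendsto_norm_fst_parabolic M)
    simpa only [pow_succ, mul_one] using
      (isBigO_refl (fun z : (ℝ × ℝ) × ℝ => ‖z.1‖ ^ k) (parabolic M)).mul_isLittleO h1
  filter_upwards [(h.value.trans_isLittleO hlo).def hη, (h.deriv.trans_isLittleO hlo).def hη]
    with z h1 h2
  rw [norm_pow, norm_norm] at h1 h2
  refine ⟨h1, fun v => ?_⟩
  rw [norm_smul, norm_norm] at h2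
  have h3 := (fderiv ℝ E z ∘L ContinuousLinearMap.inl ℝ (ℝ × ℝ) ℝ).le_opNorm v
  have h4 : partialDeriv v E z = (fderiv ℝ E z ∘L ContinuousLinearMap.inl ℝ (ℝ × ℝ) ℝ) v := rfl
  rw [h4, ← Real.norm_eq_abs]
  calc _ ≤ ‖z.1‖ * (‖fderiv ℝ E z ∘L ContinuousLinearMap.inl ℝ (ℝ × ℝ) ℝ‖ * ‖v‖) := by gcongr
    _ = ‖z.1‖ * ‖fderiv ℝ E z ∘L ContinuousLinearMap.inl ℝ (ℝ × ℝ) ℝ‖ * ‖v‖ := by ring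
    _ ≤ _ := by gcongr

/-- `E₀` is the leading part, of degree `k`, of the function `E` on the parabolic region. -/
structure HasLead (M : ℝ) (k : ℕ) (E E₀ : (ℝ × ℝ) × ℝ → ℝ) : Prop where
  order : HasOrder M k E
  lead : HasOrder M k E₀
  error : HasOrder M (k + 1) fun z => E z - E₀ z

namespace HasLead

lemma mul (h : HasLead M k E E₀) (h' : HasLead M l E' E₀') :
    HasLead M (k + l) (fun z => E z * E' z) fun z => E₀ z * E₀' z where
  order := h.order.mul h'.order
  lead := h.lead.mul h'.lead
  error := by
    -- `E E' - E₀ E₀' = E (E' - E₀') + (E - E₀) E₀'`.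
    have h1 := h.order.mul h'.error
    have h2 := h.error.mul h'.lead
    rw [show k + 1 + l = k + (l + 1) by omega] at h2
    exact (h1.add h2).congr fun z => by ring

lemma add (h : HasLead M k E E₀) (h' : HasLead M k E' E₀') :
    HasLead M k (fun z => E z + E' z) fun z => E₀ z + E₀' z where
  order := h.order.add h'.order
  lead := h.lead.add h'.lead
  error := (h.error.add h'.error).congr fun z => by ring

lemma sub (h : HasLead M k E E₀) (h' : HasLead M k E' E₀') :
    HasLead M k (fun z => E z - E' z) fun z => E₀ z - E₀' z where
  order := h.order.sub h'.order
  lead := h.lead.sub h'.lead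
  error := (h.error.sub h'.error).congr fun z => by ring

lemma const_mul (h : HasLead M k E E₀) (a : ℝ) :
    HasLead M k (fun z => a * E z) fun z => a * E₀ z where
  order := h.order.const_mul a
  lead := h.lead.const_mul a
  error := (h.error.const_mul a).congr fun z => by ring

lemma of_smoothGermAt (h : SmoothGermAt E 0) : HasLead M 0 E fun _ => E 0 where
  order := .of_smoothGermAt h
  lead := .const _
  error := .of_apply_zero (h.mono fun _ hz => hz.sub contDiffAt_const) (sub_self _)

lemma of_apply_zero (h : SmoothGermAt E 0) (h0 : E 0 = 0) {a b : ℝ}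
    (ha : partialDeriv (1, 0) E 0 = a) (hb : partialDeriv (0, 1) E 0 = b) :
    HasLead M 1 E fun z => a * z.1.1 + b * z.1.2 := by
  have hlin : ContDiff ℝ ∞ fun z : (ℝ × ℝ) × ℝ => a * z.1.1 + b * z.1.2 := by fun_prop
  refine ⟨.of_apply_zero h h0, .of_apply_zero (Eventually.of_forall fun _ => hlin.contDiffAt)
    (by simp), .of_partialDeriv_zero (h.mono fun _ hz => hz.sub hlin.contDiffAt)
    (by simp [h0]) fun v => ?_⟩
  have hE := (h.contDiffAt.differentiableAt (by simp)).hasFDerivAt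
  have hL : HasFDerivAt (fun z : (ℝ × ℝ) × ℝ => a * z.1.1 + b * z.1.2)
      (a • (ContinuousLinearMap.fst ℝ ℝ ℝ ∘L ContinuousLinearMap.fst ℝ (ℝ × ℝ) ℝ) +
        b • (ContinuousLinearMap.snd ℝ ℝ ℝ ∘L ContinuousLinearMap.fst ℝ (ℝ × ℝ) ℝ)) 0 :=
    (a • (ContinuousLinearMap.fst ℝ ℝ ℝ ∘L ContinuousLinearMap.fst ℝ (ℝ × ℝ) ℝ) +
        b • (ContinuousLinearMap.snd ℝ ℝ ℝ ∘L ContinuousLinearMap.fst ℝ (ℝ × ℝ) ℝ)).hasFDerivAt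
  have hv : ((v, 0) : (ℝ × ℝ) × ℝ) = v.1 • ((1, 0), 0) + v.2 • ((0, 1), 0) := by
    ext <;> simp
  simp only [partialDeriv] at ha hb ⊢
  rw [(hE.fun_sub hL).fderiv, sub_apply, hv, map_add, map_smul, map_smul, ha, hb]
  simp
  ring

end HasLead

/-! ### The Hessian in an adapted frame -/

/-- The value of the quadratic form with matrix `(a b; b d)` at `(c, s)`. -/
def quadVal (a b d c s : ℝ) : ℝ := a * c ^ 2 + 2 * b * c * s + d * s ^ 2

section Frame

variable {a b d c s : ℝ}

lemma fst_eq_frame (hcs : c ^ 2 + s ^ 2 = 1) (p : ℝ × ℝ) :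
    p.1 = c * frameU c s p - s * frameW c s p := by
  simp only [frameU, frameW]; linear_combination -p.1 * hcs

lemma snd_eq_frame (hcs : c ^ 2 + s ^ 2 = 1) (p : ℝ × ℝ) :
    p.2 = s * frameU c s p + c * frameW c s p := by
  simp only [frameU, frameW]; linear_combination -p.2 * hcs

lemma bilin_eq_frame (hcs : c ^ 2 + s ^ 2 = 1) (hoff : b * (c ^ 2 - s ^ 2) + (d - a) * c * s = 0)
    (p q : ℝ × ℝ) : (a * p.1 + b * p.2) * q.1 + (b * p.1 + d * p.2) * q.2 =
      quadVal a b d c s * frameU c s p * frameU c s q +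
        quadVal a b d (-s) c * frameW c s p * frameW c s q := by
  rw [fst_eq_frame hcs p, snd_eq_frame hcs p, fst_eq_frame hcs q, snd_eq_frame hcs q]
  generalize frameU c s p = u
  generalize frameW c s p = w
  generalize frameU c s q = u'
  generalize frameW c s q = w'
  simp only [quadVal]
  linear_combination (u * w' + w * u') * hoff

/-- The left side is half the angular derivative of the quadratic form, which is `(B - A) u w` in
the principal frame. Its zeros give the directions of the vertices of the ellipse. -/
lemma jac_eq_frame (hcs : c ^ 2 + s ^ 2 = 1) (hoff : b * (c ^ 2 - s ^ 2) + (d - a) * c * s = 0)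
    (p : ℝ × ℝ) : b * p.1 ^ 2 + (d - a) * p.1 * p.2 - b * p.2 ^ 2 =
      (quadVal a b d (-s) c - quadVal a b d c s) * frameU c s p * frameW c s p := by
  rw [fst_eq_frame hcs p, snd_eq_frame hcs p]
  generalize frameU c s p = u
  generalize frameW c s p = w
  simp only [quadVal]
  linear_combination (u ^ 2 - w ^ 2) * hoff

lemma det_eq_frame (hcs : c ^ 2 + s ^ 2 = 1) (hoff : b * (c ^ 2 - s ^ 2) + (d - a) * c * s = 0) :
    a * d - b ^ 2 = quadVal a b d c s * quadVal a b d (-s) c := by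
  have h1 : (a * d - b ^ 2) * (c ^ 2 + s ^ 2) ^ 2 =
      quadVal a b d c s * quadVal a b d (-s) c -
        (b * (c ^ 2 - s ^ 2) + (d - a) * c * s) ^ 2 := by
    simp only [quadVal]; ring
  rw [hcs, hoff] at h1
  linarith

lemma exists_frame (a b d : ℝ) :
    ∃ c s : ℝ, c ^ 2 + s ^ 2 = 1 ∧ b * (c ^ 2 - s ^ 2) + (d - a) * c * s = 0 := by
  -- Under rotation by `θ` the pair `((a - d) / 2, b)` turns by `2 θ`, so half its argument
  -- diagonalises the form.
  let θ := Complex.arg ⟨(a - d) / 2, b⟩ / 2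
  refine ⟨Real.cos θ, Real.sin θ, Real.cos_sq_add_sin_sq θ, ?_⟩
  have h1 := Complex.norm_mul_cos_arg ⟨(a - d) / 2, b⟩
  have h2 := Complex.norm_mul_sin_arg ⟨(a - d) / 2, b⟩
  have hθ : Complex.arg ⟨(a - d) / 2, b⟩ = 2 * θ := by simp only [θ]; ring
  simp only [hθ, Real.cos_two_mul', Real.sin_two_mul] at h1 h2
  linear_combination -(Real.cos θ ^ 2 - Real.sin θ ^ 2) * h2 +
    (2 * Real.sin θ * Real.cos θ) * h1

lemma quadVal_pos (hcs : c ^ 2 + s ^ 2 = 1) (ha : 0 < a) (hdet : 0 < a * d - b ^ 2) :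
    0 < quadVal a b d c s := by
  have h1 : a * quadVal a b d c s = (a * c + b * s) ^ 2 + (a * d - b ^ 2) * s ^ 2 := by
    simp only [quadVal]; ring
  refine (mul_pos_iff_of_pos_left ha).1 ?_
  rw [h1]
  rcases eq_or_ne s 0 with rfl | hs
  · have : c ≠ 0 := by rintro rfl; norm_num at hcs
    have : a * c ≠ 0 := mul_ne_zero ha.ne' this
    simp only [mul_zero, add_zero]
    positivity
  · have := mul_pos hdet (pow_pos (abs_pos.2 hs) 2)
    rw [sq_abs] at this
    linarith [sq_nonneg (a * c + b * s)]

/-- The quantity `(a - d)² + 4 b²` is invariant under rotation, so in a diagonalising frame it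
equals the squared difference of the eigenvalues. -/
lemma quadVal_ne (hcs : c ^ 2 + s ^ 2 = 1) (hoff : b * (c ^ 2 - s ^ 2) + (d - a) * c * s = 0)
    (hne : ¬ (a = d ∧ b = 0)) : quadVal a b d (-s) c - quadVal a b d c s ≠ 0 := by
  intro h0
  have h1 : (quadVal a b d (-s) c - quadVal a b d c s) ^ 2 +
      4 * (b * (c ^ 2 - s ^ 2) + (d - a) * c * s) ^ 2 =
        ((a - d) ^ 2 + 4 * b ^ 2) * (c ^ 2 + s ^ 2) ^ 2 := by
    simp only [quadVal]; ring
  rw [h0, hoff, hcs] at h1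
  refine hne ⟨?_, ?_⟩
  · exact sub_eq_zero.1 (pow_eq_zero_iff two_ne_zero |>.1
      (by nlinarith [sq_nonneg (a - d), sq_nonneg b]))
  · exact pow_eq_zero_iff two_ne_zero |>.1 (by nlinarith [sq_nonneg (a - d), sq_nonneg b])

end Frame

lemma partialDeriv_quartic (A B K c s : ℝ) (v : ℝ × ℝ) (z : (ℝ × ℝ) × ℝ) :
    partialDeriv v (fun z => K * frameU c s z.1 * frameW c s z.1 *
      (A * frameU c s z.1 ^ 2 + B * frameW c s z.1 ^ 2)) z =
    K * ((frameU c s v * frameW c s z.1 + frameU c s z.1 * frameW c s v) *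
      (A * frameU c s z.1 ^ 2 + B * frameW c s z.1 ^ 2) +
      frameU c s z.1 * frameW c s z.1 *
        (2 * A * frameU c s z.1 * frameU c s v + 2 * B * frameW c s z.1 * frameW c s v)) := by
  let fst' := ContinuousLinearMap.fst ℝ (ℝ × ℝ) ℝ
  let U : (ℝ × ℝ) × ℝ →L[ℝ] ℝ :=
    (c • ContinuousLinearMap.fst ℝ ℝ ℝ + s • ContinuousLinearMap.snd ℝ ℝ ℝ) ∘L fst'
  let W : (ℝ × ℝ) × ℝ →L[ℝ] ℝ :=
    (-s • ContinuousLinearMap.fst ℝ ℝ ℝ + c • ContinuousLinearMap.snd ℝ ℝ ℝ) ∘L fst'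
  have hU : HasFDerivAt (fun z : (ℝ × ℝ) × ℝ => frameU c s z.1) U z := U.hasFDerivAt
  have hW : HasFDerivAt (fun z : (ℝ × ℝ) × ℝ => frameW c s z.1) W z := W.hasFDerivAt
  have hUv : U (v, 0) = frameU c s v := rfl
  have hWv : W (v, 0) = frameW c s v := rfl
  have h := ((hU.const_mul K).mul hW).mul (((hU.pow 2).const_mul A).add ((hW.pow 2).const_mul B))
  have h' := h.fderiv
  simp only [partialDeriv]
  refine (congrArg (fun L => L (v, 0)) h').trans ?_
  simp only [add_apply, smul_apply, hUv, hWv, smul_eq_mul,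
    Pi.mul_apply, Pi.add_apply, nsmul_eq_mul]
  norm_num
  ring

end

/-! ### Leading terms of the inflection and vertex functions -/

/-- The vertex function of a family of functions, in terms of partial derivatives on the total
space. -/
noncomputable def familyVert (F : (ℝ × ℝ) × ℝ → ℝ) (z : (ℝ × ℝ) × ℝ) : ℝ :=
  let gx := partialDeriv (1, 0) F z
  let gy := partialDeriv (0, 1) F z
  let gxx := partialDeriv (1, 0) (partialDeriv (1, 0) F) z
  let gxy := partialDeriv (0, 1) (partialDeriv (1, 0) F) z
  let gyy := partialDeriv (0, 1) (partialDeriv (0, 1) F) z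
  let gxxx := partialDeriv (1, 0) (partialDeriv (1, 0) (partialDeriv (1, 0) F)) z
  let gxxy := partialDeriv (0, 1) (partialDeriv (1, 0) (partialDeriv (1, 0) F)) z
  let gxyy := partialDeriv (0, 1) (partialDeriv (0, 1) (partialDeriv (1, 0) F)) z
  let gyyy := partialDeriv (0, 1) (partialDeriv (0, 1) (partialDeriv (0, 1) F)) z
  (gx ^ 2 + gy ^ 2) *
      (-gx ^ 3 * gyyy + 3 * gx ^ 2 * gy * gxyy - 3 * gx * gy ^ 2 * gxxy + gy ^ 3 * gxxx)
    + 3 * gx * gy * (gyy - gxx) * (gx ^ 2 * gyy + gxx * gy ^ 2)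
    + 6 * gx * gy * gxy ^ 2 * (gy ^ 2 - gx ^ 2)
    + 3 * gxy * (gx ^ 4 * gyy + 3 * gx ^ 2 * gy ^ 2 * (gxx - gyy) - gxx * gy ^ 4)

section Families

variable {F : (ℝ × ℝ) × ℝ → ℝ}

lemma smoothGermAt_familyVert (hF : SmoothGermAt F 0) : SmoothGermAt (familyVert F) 0 := by
  have hX := hF.partialDeriv (1, 0)
  have hY := hF.partialDeriv (0, 1)
  have hXX := hX.partialDeriv (1, 0)
  have hXY := hX.partialDeriv (0, 1)
  have hYY := hY.partialDeriv (0, 1)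
  filter_upwards [hX, hY, hXX, hXY, hYY, hXX.partialDeriv (1, 0), hXX.partialDeriv (0, 1),
    hXY.partialDeriv (0, 1), hYY.partialDeriv (0, 1)] with z h1 h2 h3 h4 h5 h6 h7 h8 h9
  unfold familyVert
  fun_prop

lemma eventually_vertFun_member (hF : SmoothGermAt F 0) :
    ∀ᶠ z in 𝓝 (0 : (ℝ × ℝ) × ℝ), vertFun (member F z.2) z.1 = familyVert F z := by
  have hX := hF.partialDeriv (1, 0)
  have hY := hF.partialDeriv (0, 1)
  have hXX := hX.partialDeriv (1, 0)
  have hXY := hX.partialDeriv (0, 1)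
  have hYY := hY.partialDeriv (0, 1)
  have e0 : ∀ᶠ z in 𝓝 (0 : (ℝ × ℝ) × ℝ), member F z.2 z.1 = F z := Eventually.of_forall fun _ => rfl
  have eX := eventually_dx_slice hF e0
  have eY := eventually_dy_slice hF e0
  have eXX := eventually_dx_slice (A := fun t => dx (member F t)) hX eX
  have eXY := eventually_dy_slice (A := fun t => dx (member F t)) hX eX
  have eYY := eventually_dy_slice (A := fun t => dy (member F t)) hY eY
  have eXXX := eventually_dx_slice (A := fun t => dx (dx (member F t))) hXX eXX
  have eXXY := eventually_dy_slice (A := fun t => dx (dx (member F t))) hXX eXX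
  have eXYY := eventually_dy_slice (A := fun t => dy (dx (member F t))) hXY eXY
  have eYYY := eventually_dy_slice (A := fun t => dy (dy (member F t))) hYY eYY
  filter_upwards [eX, eY, eXX, eXY, eYY, eXXX, eXXY, eXYY, eYYY] with z h1 h2 h3 h4 h5 h6 h7 h8 h9
  simp only [vertFun, familyVert, h1, h2, h3, h4, h5, h6, h7, h8, h9]

lemma eventually_inflFun_member (hF : SmoothGermAt F 0) :
    ∀ᶠ z in 𝓝 (0 : (ℝ × ℝ) × ℝ), inflFun (member F z.2) z.1 =
      partialDeriv (1, 0) (partialDeriv (1, 0) F) z * partialDeriv (0, 1) F z ^ 2 -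
      2 * partialDeriv (0, 1) (partialDeriv (1, 0) F) z * partialDeriv (1, 0) F z *
        partialDeriv (0, 1) F z +
      partialDeriv (0, 1) (partialDeriv (0, 1) F) z * partialDeriv (1, 0) F z ^ 2 := by
  have hX := hF.partialDeriv (1, 0)
  have hY := hF.partialDeriv (0, 1)
  have e0 : ∀ᶠ z in 𝓝 (0 : (ℝ × ℝ) × ℝ), member F z.2 z.1 = F z := Eventually.of_forall fun _ => rfl
  have eX := eventually_dx_slice hF e0
  have eY := eventually_dy_slice hF e0
  have eXX := eventually_dx_slice (A := fun t => dx (member F t)) hX eX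
  have eXY := eventually_dy_slice (A := fun t => dx (member F t)) hX eX
  have eYY := eventually_dy_slice (A := fun t => dy (member F t)) hY eY
  filter_upwards [eX, eY, eXX, eXY, eYY] with z h1 h2 h3 h4 h5
  simp only [inflFun, h1, h2, h3, h4, h5]

/-- The 2-jet of a family in the variables of the plane, at a critical point. -/
structure IsCriticalFamily (F : (ℝ × ℝ) × ℝ → ℝ) (a b d : ℝ) : Prop where
  smooth : SmoothGermAt F 0
  x_eq : partialDeriv (1, 0) F 0 = 0
  y_eq : partialDeriv (0, 1) F 0 = 0
  xx_eq : partialDeriv (1, 0) (partialDeriv (1, 0) F) 0 = a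
  xy_eq : partialDeriv (0, 1) (partialDeriv (1, 0) F) 0 = b
  yy_eq : partialDeriv (0, 1) (partialDeriv (0, 1) F) 0 = d

variable {a b d c s : ℝ}

lemma IsCriticalFamily.hasLead_x (h : IsCriticalFamily F a b d) (M : ℝ) :
    HasLead M 1 (partialDeriv (1, 0) F) fun z => a * z.1.1 + b * z.1.2 :=
  .of_apply_zero (h.smooth.partialDeriv _) h.x_eq h.xx_eq h.xy_eq

lemma IsCriticalFamily.hasLead_y (h : IsCriticalFamily F a b d) (M : ℝ) :
    HasLead M 1 (partialDeriv (0, 1) F) fun z => b * z.1.1 + d * z.1.2 :=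
  .of_apply_zero (h.smooth.partialDeriv _) h.y_eq
    (by rw [partialDeriv_comm h.smooth.contDiffAt]; exact h.xy_eq) h.yy_eq

lemma IsCriticalFamily.hasLead_second (h : IsCriticalFamily F a b d) (M : ℝ) :
    HasLead M 0 (partialDeriv (1, 0) (partialDeriv (1, 0) F)) (fun _ => a) ∧
    HasLead M 0 (partialDeriv (0, 1) (partialDeriv (1, 0) F)) (fun _ => b) ∧
    HasLead M 0 (partialDeriv (0, 1) (partialDeriv (0, 1) F)) (fun _ => d) := by
  have hX := h.smooth.partialDeriv (1, 0)
  have hY := h.smooth.partialDeriv (0, 1)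
  have h1 := HasLead.of_smoothGermAt (M := M) (hX.partialDeriv (1, 0))
  have h2 := HasLead.of_smoothGermAt (M := M) (hX.partialDeriv (0, 1))
  have h3 := HasLead.of_smoothGermAt (M := M) (hY.partialDeriv (0, 1))
  rw [h.xx_eq] at h1
  rw [h.xy_eq] at h2
  rw [h.yy_eq] at h3
  exact ⟨h1, h2, h3⟩

/-- Replacing first derivatives by their linear parts and second derivatives by constants turns the
terms of degree four into `3 (a d - b²)²` times the angular form times the quadratic form. -/
lemma IsCriticalFamily.hasOrder_familyVert (h : IsCriticalFamily F a b d)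
    (hcs : c ^ 2 + s ^ 2 = 1) (hoff : b * (c ^ 2 - s ^ 2) + (d - a) * c * s = 0) (M : ℝ) :
    HasOrder M 5 fun z => familyVert F z -
      3 * (quadVal a b d c s * quadVal a b d (-s) c) ^ 2 *
        (quadVal a b d (-s) c - quadVal a b d c s) * frameU c s z.1 * frameW c s z.1 *
        (quadVal a b d c s * frameU c s z.1 ^ 2 + quadVal a b d (-s) c * frameW c s z.1 ^ 2) := by
  have X := h.hasLead_x M
  have Y := h.hasLead_y M
  obtain ⟨XX, XY, YY⟩ := h.hasLead_second M
  have hX := h.smooth.partialDeriv (1, 0)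
  have hXX := hX.partialDeriv (1, 0)
  have hXY := hX.partialDeriv (0, 1)
  have hYY := (h.smooth.partialDeriv (0, 1)).partialDeriv (0, 1)
  have o1 := HasOrder.of_smoothGermAt (M := M) (hXX.partialDeriv (1, 0))
  have o2 := HasOrder.of_smoothGermAt (M := M) (hXX.partialDeriv (0, 1))
  have o3 := HasOrder.of_smoothGermAt (M := M) (hXY.partialDeriv (0, 1))
  have o4 := HasOrder.of_smoothGermAt (M := M) (hYY.partialDeriv (0, 1))
  have x := X.order
  have y := Y.order
  -- Each third derivative is only bounded, but it comes with three first derivatives here and two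
  -- more from `gx² + gy²`; in total this is order five and belongs to the error.
  have cubic : HasOrder M 3 _ :=
    (((x.mul (x.mul x)).mul o4).const_mul (-1)).add <|
    (((x.mul (x.mul y)).mul o3).const_mul 3).add <|
    (((x.mul (y.mul y)).mul o2).const_mul (-3)).add ((y.mul (y.mul y)).mul o1)
  have third : HasOrder M 5 _ := ((x.mul x).add (y.mul y)).mul cubic
  have X2 := X.mul X
  have Y2 := Y.mul Y
  have XYp := X.mul Y
  have t1 : HasLead M 4 _ _ :=
    ((XYp.mul (YY.sub XX)).mul ((X2.mul YY).add (Y2.mul XX))).const_mul 3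
  have t2 : HasLead M 4 _ _ := ((XYp.mul (XY.mul XY)).mul (Y2.sub X2)).const_mul 6
  have t3 : HasLead M 4 _ _ := (((((X2.mul X2).mul YY).add
    (((X2.mul Y2).mul (XX.sub YY)).const_mul 3)).sub ((Y2.mul Y2).mul XX)).mul XY).const_mul 3
  have err : HasOrder M 5 _ := third.add ((t1.add t2).add t3).error
  refine err.congr fun z => ?_
  have hq := bilin_eq_frame hcs hoff z.1 z.1
  have hj := jac_eq_frame hcs hoff z.1
  have hd := det_eq_frame hcs hoff
  have e : 3 * (quadVal a b d c s * quadVal a b d (-s) c) ^ 2 *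
        (quadVal a b d (-s) c - quadVal a b d c s) * frameU c s z.1 * frameW c s z.1 *
        (quadVal a b d c s * frameU c s z.1 ^ 2 + quadVal a b d (-s) c * frameW c s z.1 ^ 2) =
      3 * (a * d - b ^ 2) ^ 2 * (b * z.1.1 ^ 2 + (d - a) * z.1.1 * z.1.2 - b * z.1.2 ^ 2) *
        ((a * z.1.1 + b * z.1.2) * z.1.1 + (b * z.1.1 + d * z.1.2) * z.1.2) := by
    rw [hq, hj, hd]; ring
  rw [e]
  simp only [familyVert]
  ring

lemma IsCriticalFamily.eventually_fderiv_member (h : IsCriticalFamily F a b d)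
    (hcs : c ^ 2 + s ^ 2 = 1) (hoff : b * (c ^ 2 - s ^ 2) + (d - a) * c * s = 0) (M : ℝ) {η : ℝ}
    (hη : 0 < η) : ∀ᶠ z in parabolic M, ∀ v, |fderiv ℝ (member F z.2) z.1 v -
      (quadVal a b d c s * frameU c s z.1 * frameU c s v +
        quadVal a b d (-s) c * frameW c s z.1 * frameW c s v)| ≤ η * ‖z.1‖ * ‖v‖ := by
  have e0 : ∀ᶠ z in 𝓝 (0 : (ℝ × ℝ) × ℝ), member F z.2 z.1 = F z := Eventually.of_forall fun _ => rfl
  filter_upwards [(h.hasLead_x M).error.eventually_le (half_pos hη),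
    (h.hasLead_y M).error.eventually_le (half_pos hη),
    parabolic_le M (eventually_hasFDerivAt_slice h.smooth e0)] with z h1 h2 h3 v
  have hv : ((v, 0) : (ℝ × ℝ) × ℝ) = v.1 • ((1, 0), 0) + v.2 • ((0, 1), 0) := by
    ext <;> simp
  have e : fderiv ℝ (member F z.2) z.1 v =
      partialDeriv (1, 0) F z * v.1 + partialDeriv (0, 1) F z * v.2 := by
    rw [h3.fderiv, ContinuousLinearMap.comp_apply, ContinuousLinearMap.inl_apply, hv, map_add,
      map_smul, map_smul, smul_eq_mul, smul_eq_mul, mul_comm, mul_comm v.2]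
    rfl
  rw [e, ← bilin_eq_frame hcs hoff]
  have g1 := h1.1
  have g2 := h2.1
  rw [pow_one] at g1 g2
  have n1 : |v.1| ≤ ‖v‖ := norm_fst_le v
  have n2 : |v.2| ≤ ‖v‖ := norm_snd_le v
  calc _ = |(partialDeriv (1, 0) F z - (a * z.1.1 + b * z.1.2)) * v.1 +
        (partialDeriv (0, 1) F z - (b * z.1.1 + d * z.1.2)) * v.2| := by congr 1; ring
    _ ≤ |partialDeriv (1, 0) F z - (a * z.1.1 + b * z.1.2)| * |v.1| +
        |partialDeriv (0, 1) F z - (b * z.1.1 + d * z.1.2)| * |v.2| := by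
      rw [← abs_mul, ← abs_mul]; exact abs_add_le _ _
    _ ≤ η / 2 * ‖z.1‖ * ‖v‖ + η / 2 * ‖z.1‖ * ‖v‖ := by gcongr
    _ = η * ‖z.1‖ * ‖v‖ := by ring

lemma IsCriticalFamily.eventually_vertFun (h : IsCriticalFamily F a b d)
    (hcs : c ^ 2 + s ^ 2 = 1) (hoff : b * (c ^ 2 - s ^ 2) + (d - a) * c * s = 0) (M : ℝ) {K η : ℝ}
    (hK : K = 3 * (quadVal a b d c s * quadVal a b d (-s) c) ^ 2 *
      (quadVal a b d (-s) c - quadVal a b d c s)) (hη : 0 < η) :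
    ∀ᶠ z in parabolic M, |vertFun (member F z.2) z.1 - K * frameU c s z.1 * frameW c s z.1 *
        (quadVal a b d c s * frameU c s z.1 ^ 2 + quadVal a b d (-s) c * frameW c s z.1 ^ 2)| ≤
          η * ‖z.1‖ ^ 4 ∧
      ∀ v, ‖z.1‖ * |fderiv ℝ (vertFun (member F z.2)) z.1 v -
    K * ((frameU c s v * frameW c s z.1 + frameU c s z.1 * frameW c s v) *
      (quadVal a b d c s * frameU c s z.1 ^ 2 + quadVal a b d (-s) c * frameW c s z.1 ^ 2) +
      frameU c s z.1 * frameW c s z.1 *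
        (2 * quadVal a b d c s * frameU c s z.1 * frameU c s v +
          2 * quadVal a b d (-s) c * frameW c s z.1 * frameW c s v))| ≤ η * ‖z.1‖ ^ 4 * ‖v‖ := by
  subst hK
  have hV := smoothGermAt_familyVert h.smooth
  filter_upwards [(h.hasOrder_familyVert hcs hoff M).eventually_le hη,
    parabolic_le M (eventually_vertFun_member h.smooth),
    parabolic_le M hV.eventually_differentiableAt,
    parabolic_le M (eventually_hasFDerivAt_slice (A := fun t => vertFun (member F t)) hV
      (eventually_vertFun_member h.smooth))] with z h1 h2 h3 h4
  refine ⟨by rw [h2]; exact h1.1, fun v => ?_⟩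
  rw [← partialDeriv_quartic]
  convert! h1.2 v using 3
  have hq : DifferentiableAt ℝ (fun z : (ℝ × ℝ) × ℝ =>
      3 * (quadVal a b d c s * quadVal a b d (-s) c) ^ 2 *
        (quadVal a b d (-s) c - quadVal a b d c s) * frameU c s z.1 * frameW c s z.1 *
        (quadVal a b d c s * frameU c s z.1 ^ 2 + quadVal a b d (-s) c * frameW c s z.1 ^ 2)) z := by
    unfold frameU frameW
    fun_prop
  rw [h4.fderiv]
  simp only [partialDeriv]
  rw [fderiv_fun_sub h3 hq]
  rfl

/-- The leading form is `(a d - b²)` times the positive definite quadratic form, and so is bounded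
below by a multiple of `‖p‖²`; the admitted error is half of that multiple. -/
lemma IsCriticalFamily.eventually_inflFun_ne_zero (h : IsCriticalFamily F a b d)
    (ha : 0 < a) (hdet : 0 < a * d - b ^ 2) (M : ℝ) :
    ∀ᶠ z in parabolic M, z.1 ≠ 0 → inflFun (member F z.2) z.1 ≠ 0 := by
  obtain ⟨c, s, hcs, hoff⟩ := exists_frame a b d
  have hA := quadVal_pos hcs ha hdet
  have hB := quadVal_pos (show (-s) ^ 2 + c ^ 2 = 1 by linarith [neg_sq s]) ha hdet
  have X := h.hasLead_x M
  have Y := h.hasLead_y M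
  obtain ⟨XX, XY, YY⟩ := h.hasLead_second M
  have t : HasLead M 2 _ _ := (((Y.mul Y).mul XX).sub (((X.mul Y).mul XY).const_mul 2)).add
    ((X.mul X).mul YY)
  set m := min (quadVal a b d c s) (quadVal a b d (-s) c) with hm
  have hm0 : 0 < m := lt_min hA hB
  have hη : 0 < (a * d - b ^ 2) * m / 2 := by positivity
  filter_upwards [t.error.eventually_le hη, parabolic_le M (eventually_inflFun_member h.smooth)]
    with z h1 h2 hz h0
  have h3 := h1.1
  have hq := bilin_eq_frame hcs hoff z.1 z.1
  rw [h0] at h2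
  have e : (b * z.1.1 + d * z.1.2) * (b * z.1.1 + d * z.1.2) * a -
      2 * ((a * z.1.1 + b * z.1.2) * (b * z.1.1 + d * z.1.2) * b) +
      (a * z.1.1 + b * z.1.2) * (a * z.1.1 + b * z.1.2) * d =
      (a * d - b ^ 2) * ((a * z.1.1 + b * z.1.2) * z.1.1 + (b * z.1.1 + d * z.1.2) * z.1.2) := by
    ring
  rw [e, hq] at h3
  have h4 := (abs_le.1 h3).1
  have hn : 0 < ‖z.1‖ ^ 2 := pow_pos (norm_pos_iff.2 hz) 2
  have h5 : m * ‖z.1‖ ^ 2 ≤ quadVal a b d c s * frameU c s z.1 * frameU c s z.1 +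
      quadVal a b d (-s) c * frameW c s z.1 * frameW c s z.1 := by
    have g0 : m * ‖z.1‖ ^ 2 ≤ m * normSq z.1 :=
      mul_le_mul_of_nonneg_left (norm_sq_le_normSq _) hm0.le
    rw [← frame_sq hcs] at g0
    have g1 : m * (frameU c s z.1 * frameU c s z.1) ≤
        quadVal a b d c s * (frameU c s z.1 * frameU c s z.1) :=
      mul_le_mul_of_nonneg_right (min_le_left _ _) (mul_self_nonneg _)
    have g2 : m * (frameW c s z.1 * frameW c s z.1) ≤
        quadVal a b d (-s) c * (frameW c s z.1 * frameW c s z.1) :=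
      mul_le_mul_of_nonneg_right (min_le_right _ _) (mul_self_nonneg _)
    nlinarith
  have h6 := mul_le_mul_of_nonneg_left h5 hdet.le
  have h7 : 0 < (a * d - b ^ 2) * (m * ‖z.1‖ ^ 2) := by positivity
  nlinarith

end Families

section

/-! ### The bifurcation of an oval from a nondegenerate minimum -/

lemma exists_pos_of_eventually_parabolic {M : ℝ} {p : (ℝ × ℝ) × ℝ → Prop}
    (h : ∀ᶠ z in parabolic M, p z) :
    ∃ δ > 0, ∀ z : (ℝ × ℝ) × ℝ, ‖z.1‖ < δ → |z.2| < δ → |z.2| ≤ M * ‖z.1‖ ^ 2 → p z := by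
  obtain ⟨δ, hδ, hb⟩ := Metric.eventually_nhds_iff_ball.1 (eventually_inf_principal.1 h)
  refine ⟨δ, hδ, fun z h1 h2 h3 => hb z ?_ h3⟩
  rw [mem_ball_zero_iff, Prod.norm_def]
  exact max_lt h1 h2

lemma exists_pos_of_eventually {p : (ℝ × ℝ) × ℝ → Prop}
    (h : ∀ᶠ z in 𝓝 0, p z) :
    ∃ δ > 0, ∀ z : (ℝ × ℝ) × ℝ, ‖z.1‖ < δ → |z.2| < δ → p z := by
  obtain ⟨δ, hδ, hb⟩ := Metric.eventually_nhds_iff_ball.1 h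
  refine ⟨δ, hδ, fun z h1 h2 => hb z ?_⟩
  rw [mem_ball_zero_iff, Prod.norm_def]
  exact max_lt h1 h2

lemma norm_lt_of_mem_disc {ε : ℝ} (hε : 0 < ε) {p : ℝ × ℝ} (hp : p ∈ disc ε) : ‖p‖ < ε :=
  lt_of_pow_lt_pow_left₀ 2 hε.le ((norm_sq_le_normSq p).trans_lt (mem_disc.1 hp))

variable {F : (ℝ × ℝ) × ℝ → ℝ} {a b d : ℝ}

/-- Bounds for the variation of a family with its parameter. -/
lemma exists_time_bounds (hF : SmoothGermAt F 0) (ht : fderiv ℝ F 0 (0, 1) < 0) :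
    ∃ c₁ > 0, ∃ c₂ > 0, ∃ δ > 0, ∀ p : ℝ × ℝ, ∀ t : ℝ, ‖p‖ < δ → 0 ≤ t → t < δ →
      F (p, t) ≤ F (p, 0) - c₁ * t ∧ F (p, 0) - c₂ * t ≤ F (p, t) ∧
        F (p, 0) + c₁ * t ≤ F (p, -t) := by
  set κ := -fderiv ℝ F 0 (0, 1) with hκ
  have hκ0 : 0 < κ := by linarith
  have hc : ContinuousAt (fun z => fderiv ℝ F z (0, 1)) 0 :=
    hF.contDiffAt.fderiv_infty.continuousAt.clm_apply continuousAt_const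
  have e1 : ∀ᶠ z in 𝓝 0, fderiv ℝ F z (0, 1) < -(κ / 2) :=
    hc.eventually_lt_const (by linarith)
  have e2 : ∀ᶠ z in 𝓝 0, -(2 * κ) < fderiv ℝ F z (0, 1) :=
    hc.eventually_const_lt (by linarith)
  obtain ⟨δ, hδ, hb⟩ := exists_pos_of_eventually ((e1.and e2).and hF.eventually_differentiableAt)
  refine ⟨κ / 2, half_pos hκ0, 2 * κ, by positivity, δ, hδ, fun p t hp ht0 ht => ?_⟩
  have key : ∀ t, |t| < δ → ∃ D, -(2 * κ) < D ∧ D < -(κ / 2) ∧ F (p, t) - F (p, 0) = t * D := by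
    intro t ht
    have hd : ∀ x ∈ Ioo (-δ) δ, HasFDerivWithinAt (fun x => F (p, x))
        (fderiv ℝ F (p, x) ∘L ContinuousLinearMap.inr ℝ (ℝ × ℝ) ℝ) (Ioo (-δ) δ) x := by
      intro x hx
      have h1 : HasFDerivAt (fun x : ℝ => (p, x)) (ContinuousLinearMap.inr ℝ (ℝ × ℝ) ℝ) x := by
        exact (hasFDerivAt_const p x).prodMk (hasFDerivAt_id x)
      have h2 := (hb (p, x) hp (abs_lt.2 hx)).2.hasFDerivAt
      exact (HasFDerivAt.comp x (g := F) h2 h1).hasFDerivWithinAt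
    obtain ⟨ξ, hξ, he⟩ := domain_mvt hd (convex_Ioo _ _) (x := 0) (y := t) ⟨by linarith, hδ⟩
      (abs_lt.1 ht)
    have hξ' := (convex_Ioo (-δ) δ).segment_subset ⟨by linarith, hδ⟩ (abs_lt.1 ht) hξ
    have h3 := (hb (p, ξ) hp (abs_lt.2 hξ')).1
    refine ⟨_, h3.2, h3.1, he.trans ?_⟩
    have : ((0, t - 0) : (ℝ × ℝ) × ℝ) = t • (0, 1) := by ext <;> simp
    rw [ContinuousLinearMap.comp_apply, ContinuousLinearMap.inr_apply, this, map_smul, smul_eq_mul]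
  obtain ⟨D, hD1, hD2, hD⟩ := key t (by rwa [abs_of_nonneg ht0])
  obtain ⟨D', hD1', hD2', hD'⟩ := key (-t) (by rwa [abs_neg, abs_of_nonneg ht0])
  refine ⟨?_, ?_, ?_⟩ <;> nlinarith

/-- The upper bound is second-order vanishing at the critical point. For positivity, the mean value
theorem on the segment from the origin to `p` reduces to the radial derivative, which is close to a
positive definite form. -/
lemma exists_static_bounds (h : IsCriticalFamily F a b d) (h0 : F 0 = 0) (ha : 0 < a)
    (hdet : 0 < a * d - b ^ 2) :
    ∃ C > 0, ∃ δ > 0, ∀ p : ℝ × ℝ, ‖p‖ < δ → F (p, 0) ≤ C * ‖p‖ ^ 2 ∧ (p ≠ 0 → 0 < F (p, 0)) := by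
  obtain ⟨c, s, hcs, hoff⟩ := exists_frame a b d
  have hA := quadVal_pos hcs ha hdet
  have hB := quadVal_pos (show (-s) ^ 2 + c ^ 2 = 1 by linarith [neg_sq s]) ha hdet
  set m := min (quadVal a b d c s) (quadVal a b d (-s) c) with hm
  have hm0 : 0 < m := lt_min hA hB
  -- With `M = 0` the parabolic region is the slice `t = 0`, so the estimates for families
  -- specialise to the undeformed function.
  have hord : HasOrder 0 2 F := .of_partialDeriv_zero h.smooth h0 fun v => by
    have hv : ((v, 0) : (ℝ × ℝ) × ℝ) = v.1 • ((1, 0), 0) + v.2 • ((0, 1), 0) := by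
      ext <;> simp
    have hx := h.x_eq
    have hy := h.y_eq
    simp only [partialDeriv] at hx hy ⊢
    rw [hv, map_add, map_smul, map_smul, hx, hy]; simp
  obtain ⟨C, hC, hbound⟩ := hord.value.exists_pos
  obtain ⟨δ, hδ, hb⟩ := exists_pos_of_eventually_parabolic ((hbound.bound.and
    (h.eventually_fderiv_member hcs hoff 0 (half_pos hm0))).and
    (parabolic_le 0 h.smooth.eventually_differentiableAt))
  have hb' : ∀ p : ℝ × ℝ, ‖p‖ < δ → _ := fun p hp => hb (p, 0) hp (by simpa using hδ) (by simp)
  refine ⟨C, hC, δ, hδ, fun p hp => ⟨?_, fun hp0 => ?_⟩⟩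
  · have := (hb' p hp).1.1
    simp only [norm_pow, norm_norm] at this
    exact (le_abs_self _).trans this
  · have hmem : ∀ x ∈ Icc (0 : ℝ) 1, ‖x • p‖ < δ := by
      intro x hx
      rw [norm_smul, Real.norm_of_nonneg hx.1]
      exact (mul_le_of_le_one_left (norm_nonneg p) hx.2).trans_lt hp
    have hd : ∀ x ∈ Icc (0 : ℝ) 1, HasDerivAt (fun s : ℝ => member F 0 (s • p))
        (fderiv ℝ (member F 0) (x • p) p) x := by
      intro x hx
      refine hasDerivAt_comp_smul ?_
      exact (fderiv_slice (z := (x • p, 0)) (hb' _ (hmem x hx)).2).differentiableAt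
    obtain ⟨x, hx, he⟩ := exists_hasDerivAt_eq_slope _ _ zero_lt_one
      (fun x hx => (hd x hx).continuousAt.continuousWithinAt)
      (fun x hx => hd x (Ioo_subset_Icc_self hx))
    have h1 := (hb' _ (hmem x (Ioo_subset_Icc_self hx))).1.2 (x • p)
    have h2 := (abs_le.1 h1).1
    have hxp : x • p ≠ 0 := smul_ne_zero hx.1.ne' hp0
    have g0 : m * ‖x • p‖ ^ 2 ≤ m * normSq (x • p) :=
      mul_le_mul_of_nonneg_left (norm_sq_le_normSq _) hm0.le
    rw [← frame_sq hcs] at g0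
    have g1 : m * (frameU c s (x • p) * frameU c s (x • p)) ≤
        quadVal a b d c s * (frameU c s (x • p) * frameU c s (x • p)) :=
      mul_le_mul_of_nonneg_right (min_le_left _ _) (mul_self_nonneg _)
    have g2 : m * (frameW c s (x • p) * frameW c s (x • p)) ≤
        quadVal a b d (-s) c * (frameW c s (x • p) * frameW c s (x • p)) :=
      mul_le_mul_of_nonneg_right (min_le_right _ _) (mul_self_nonneg _)
    have hn : 0 < m * ‖x • p‖ ^ 2 := mul_pos hm0 (pow_pos (norm_pos_iff.2 hxp) 2)
    have h3 : 0 < fderiv ℝ (member F 0) (x • p) (x • p) := by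
      dsimp only at h2
      nlinarith
    rw [map_smul, smul_eq_mul] at h3
    have h4 := (mul_pos_iff_of_pos_left hx.1).1 h3
    rw [he, one_smul, zero_smul, sub_zero, div_one] at h4
    have h5 : member F 0 (0 : ℝ × ℝ) = 0 := h0
    rw [h5, sub_zero] at h4
    exact h4

/-- Near a nondegenerate minimum with distinct principal curvatures, the positive levels are ovals
with four vertices and the negative levels are empty. -/
theorem exists_isOval (h : IsCriticalFamily F a b d) (h0 : F 0 = 0) (ha : 0 < a)
    (hdet : 0 < a * d - b ^ 2) (hne : ¬ (a = d ∧ b = 0)) (ht : fderiv ℝ F 0 (0, 1) < 0) :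
    ∃ ε₀ > 0, ∀ ε, 0 < ε → ε < ε₀ → ∃ δ > 0, ∀ t, 0 < t → t < δ →
      IsOval (member F t) ε ∧ curve (member F (-t)) ε = ∅ := by
  obtain ⟨c, s, hcs, hoff⟩ := exists_frame a b d
  have hA := quadVal_pos hcs ha hdet
  have hB := quadVal_pos (show (-s) ^ 2 + c ^ 2 = 1 by linarith [neg_sq s]) ha hdet
  have hK0 : 3 * (quadVal a b d c s * quadVal a b d (-s) c) ^ 2 *
      (quadVal a b d (-s) c - quadVal a b d c s) ≠ 0 :=
    mul_ne_zero (by positivity) (quadVal_ne hcs hoff hne)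
  obtain ⟨K, hK⟩ : ∃ K, K = 3 * (quadVal a b d c s * quadVal a b d (-s) c) ^ 2 *
      (quadVal a b d (-s) c - quadVal a b d c s) := ⟨_, rfl⟩
  rw [← hK] at hK0
  obtain ⟨m, C', τ, η, hk⟩ := GoodConstants.exists_const hA hB hK0
  obtain ⟨c₁, hc₁, c₂, hc₂, δ₁, hδ₁, htime⟩ := exists_time_bounds h.smooth ht
  obtain ⟨C, hC, δ₂, hδ₂, hstatic⟩ := exists_static_bounds h h0 ha hdet
  -- With `r² = c₁ t / (2 C)` below, `‖p‖ ≥ r / 4` gives `t = 2 C r² / c₁ ≤ (32 C / c₁) ‖p‖²`.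
  obtain ⟨δ₃, hδ₃, hest⟩ := exists_pos_of_eventually_parabolic (M := 32 * C / c₁)
    (((h.eventually_fderiv_member hcs hoff _ hk.η_pos).and
      (h.eventually_vertFun hcs hoff _ hK hk.η_pos)).and
      (h.eventually_inflFun_ne_zero ha hdet _))
  obtain ⟨δ₄, hδ₄, hsm⟩ := exists_pos_of_eventually (h.smooth.and
    (eventually_hasFDerivAt_slice (A := fun t => vertFun (member F t))
      (smoothGermAt_familyVert h.smooth) (eventually_vertFun_member h.smooth)))
  refine ⟨min (min δ₁ δ₂) (min δ₃ δ₄), by positivity, fun ε hε hεlt => ?_⟩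
  have hε₁ : ε < δ₁ := hεlt.trans_le ((min_le_left _ _).trans (min_le_left _ _))
  have hε₂ : ε < δ₂ := hεlt.trans_le ((min_le_left _ _).trans (min_le_right _ _))
  have hε₃ : ε < δ₃ := hεlt.trans_le ((min_le_right _ _).trans (min_le_left _ _))
  have hε₄ : ε < δ₄ := hεlt.trans_le ((min_le_right _ _).trans (min_le_right _ _))
  have hnd : ∀ p ∈ disc ε, ‖p‖ < ε := fun p hp => norm_lt_of_mem_disc hε hp
  -- The minimum of the undeformed function on the boundary of the square; `t` is later taken so
  -- small that the deformation cannot lower it to zero.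
  obtain ⟨μ, hμ, hμle⟩ : ∃ μ > 0, ∀ p : ℝ × ℝ, ‖p‖ = ε / 2 → μ ≤ F (p, 0) := by
    have hcont : ContinuousOn (fun p : ℝ × ℝ => F (p, 0)) (Metric.sphere 0 (ε / 2)) := by
      intro p hp
      have hp' : ‖p‖ = ε / 2 := by simpa using hp
      have h1 := (hsm (p, 0) (by dsimp only; linarith) (by simpa using hδ₄)).1
      have h2 : DifferentiableAt ℝ F (p, 0) := h1.differentiableAt (by simp)
      exact (fderiv_slice (z := (p, 0)) h2).continuousAt.continuousWithinAt
    obtain ⟨q, hq, hmin⟩ := (isCompact_sphere (0 : ℝ × ℝ) (ε / 2)).exists_isMinOn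
      ⟨(ε / 2, 0), by simpa [Prod.norm_def, abs_of_pos hε] using (half_pos hε).le⟩ hcont
    have hq' : ‖q‖ = ε / 2 := by simpa using hq
    have hq0 : q ≠ 0 := by
      rintro rfl
      rw [norm_zero] at hq'
      linarith
    exact ⟨F (q, 0), (hstatic q (by linarith)).2 hq0, fun p hp => hmin (by simpa using hp)⟩
  refine ⟨min (min (min δ₁ δ₃) δ₄) (μ / c₂), by positivity, fun t ht0 htlt => ?_⟩
  have ht₁ : t < δ₁ :=
    htlt.trans_le ((min_le_left _ _).trans ((min_le_left _ _).trans (min_le_left _ _)))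
  have ht₃ : t < δ₃ :=
    htlt.trans_le ((min_le_left _ _).trans ((min_le_left _ _).trans (min_le_right _ _)))
  have ht₄ : t < δ₄ := htlt.trans_le ((min_le_left _ _).trans (min_le_right _ _))
  have htμ : c₂ * t < μ := by
    have := (lt_div_iff₀ hc₂).1 (htlt.trans_le (min_le_right _ _))
    linarith
  have habs : |t| = t := abs_of_pos ht0
  constructor
  -- This radius makes `C r² = c₁ t / 2`, so that `F_t ≤ C r² - c₁ t < 0` for `‖p‖ ≤ r`.
  · have hr2 : 0 < c₁ * t / (2 * C) := by positivity
    have hrsq := Real.sq_sqrt hr2.le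
    have hr := Real.sqrt_pos.2 hr2
    set r := Real.sqrt (c₁ * t / (2 * C)) with hrdef
    have hCr : C * r ^ 2 = c₁ * t / 2 := by rw [hrsq]; field_simp
    have hest' : ∀ p ∈ disc ε, r / 4 ≤ ‖p‖ → _ := fun p hp hrp =>
      hest (p, t) ((hnd p hp).trans hε₃) (by rw [habs]; exact ht₃) (by
        have h1 : (r / 4) ^ 2 ≤ ‖p‖ ^ 2 := pow_le_pow_left₀ (by positivity) hrp 2
        rw [habs, div_mul_eq_mul_div, le_div_iff₀ hc₁]
        have := mul_le_mul_of_nonneg_left h1 hC.le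
        dsimp only
        nlinarith)
    have hsm' : ∀ p ∈ disc ε, _ := fun p hp =>
      hsm (p, t) ((hnd p hp).trans hε₄) (by rw [habs]; exact ht₄)
    have hsmooth : ∀ p ∈ disc ε, ContDiffAt ℝ ∞ (member F t) p := fun p hp => by
      have h2 : ContDiffAt ℝ ∞ (fun q : ℝ × ℝ => (q, t)) p := by fun_prop
      exact ContDiffAt.comp p (hsm' p hp).1 h2
    refine isOval_of_modelBounds hk hcs hε hr hsmooth ?_ ?_ ?_ ⟨?_, ?_, ?_, ?_, ?_⟩
    · intro p hp hpr
      have h1 := (htime p t ((hnd p hp).trans hε₁) ht0.le ht₁).1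
      have h2 := (hstatic p ((hnd p hp).trans hε₂)).1
      have h3 : C * ‖p‖ ^ 2 ≤ C * r ^ 2 := by gcongr
      show F (p, t) < 0
      have : 0 < c₁ * t := by positivity
      linarith
    · intro p hp
      have h1 := (htime p t (by linarith) ht0.le ht₁).2.1
      show 0 < F (p, t)
      linarith [hμle p hp]
    · intro p hp hrp
      exact (hest' p hp hrp).2 (norm_pos_iff.1 (by linarith))
    · exact fun p hp => (hsmooth p hp).differentiableAt (by simp)
    · exact fun p hp => (hsm' p hp).2.differentiableAt
    · exact fun p hp hrp => (hest' p hp hrp).1.1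
    · exact fun p hp hrp => (hest' p hp hrp).1.2.1
    · intro p hp hrp z
      have h1 := (hest' p hp hrp).1.2.2 z
      have hn : 0 < ‖p‖ := by linarith
      refine le_of_mul_le_mul_left (h1.trans (le_of_eq ?_)) hn
      ring
  · refine eq_empty_iff_forall_notMem.2 ?_
    rintro p ⟨hp, hp0⟩
    have h1 := (htime p t ((hnd p hp).trans hε₁) ht0.le ht₁).2.2
    have h2 : 0 ≤ F (p, 0) := by
      rcases eq_or_ne p 0 with rfl | hpne
      · exact h0.ge
      · exact ((hstatic p ((hnd p hp).trans hε₂)).2 hpne).le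
    have h3 : F (p, -t) = 0 := hp0
    have : 0 < c₁ * t := by positivity
    linarith

end

/-! ### Reduction to a minimum -/

lemma dx_const_mul (κ : ℝ) (g : ℝ × ℝ → ℝ) : dx (fun p => κ * g p) = fun p => κ * dx g p := by
  funext p
  have : (fun p => κ * g p) = κ • g := rfl
  rw [dx, this, fderiv_const_smul_field]
  rfl

lemma dy_const_mul (κ : ℝ) (g : ℝ × ℝ → ℝ) : dy (fun p => κ * g p) = fun p => κ * dy g p := by
  funext p
  have : (fun p => κ * g p) = κ • g := rfl
  rw [dy, this, fderiv_const_smul_field]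
  rfl

lemma inflFun_const_mul (κ : ℝ) (g : ℝ × ℝ → ℝ) (p : ℝ × ℝ) :
    inflFun (fun p => κ * g p) p = κ ^ 3 * inflFun g p := by
  simp only [inflFun, dx_const_mul, dy_const_mul]; ring

lemma vertFun_const_mul (κ : ℝ) (g : ℝ × ℝ → ℝ) (p : ℝ × ℝ) :
    vertFun (fun p => κ * g p) p = κ ^ 6 * vertFun g p := by
  simp only [vertFun, dx_const_mul, dy_const_mul]; ring

lemma curve_const_mul {κ : ℝ} (hκ : κ ≠ 0) (g : ℝ × ℝ → ℝ) (ε : ℝ) :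
    curve (fun p => κ * g p) ε = curve g ε := by
  ext p; simp [curve, hκ]

lemma IsOval.of_const_mul {κ : ℝ} (hκ : κ ≠ 0) {g : ℝ × ℝ → ℝ} {ε : ℝ}
    (h : IsOval (fun p => κ * g p) ε) : IsOval g ε := by
  have hc := curve_const_mul hκ g ε
  have hi : inflections (fun p => κ * g p) ε = inflections g ε := by
    ext p; simp [inflections, hc, inflFun_const_mul, hκ]
  have hv : vertices (fun p => κ * g p) ε = vertices g ε := by
    ext p; simp [vertices, hc, vertFun_const_mul, hκ]
  exact ⟨hi ▸ h.inflections_eq, hc ▸ h.diffeo, hc ▸ h.diffeo_symm, by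
    have := h.homeo
    rwa [hc, hv] at this⟩

lemma dx_eventuallyEq {g₁ g₂ : ℝ × ℝ → ℝ} {p : ℝ × ℝ} (h : g₁ =ᶠ[𝓝 p] g₂) :
    dx g₁ =ᶠ[𝓝 p] dx g₂ := by
  filter_upwards [h.eventuallyEq_nhds] with q hq
  simp only [dx, hq.fderiv_eq]

lemma dy_eventuallyEq {g₁ g₂ : ℝ × ℝ → ℝ} {p : ℝ × ℝ} (h : g₁ =ᶠ[𝓝 p] g₂) :
    dy g₁ =ᶠ[𝓝 p] dy g₂ := by
  filter_upwards [h.eventuallyEq_nhds] with q hq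
  simp only [dy, hq.fderiv_eq]

lemma IsDeformation.isCriticalFamily {f : ℝ × ℝ → ℝ} {F : (ℝ × ℝ) × ℝ → ℝ}
    (h : IsDeformation f F) (hx : dx f 0 = 0) (hy : dy f 0 = 0) :
    IsCriticalFamily F (dx (dx f) 0) (dy (dx f) 0) (dy (dy f) 0) := by
  have hF := h.1
  have e : member F 0 =ᶠ[𝓝 0] f := h.2
  have hX := hF.partialDeriv (1, 0)
  have hY := hF.partialDeriv (0, 1)
  have e0 : ∀ᶠ z in 𝓝 (0 : (ℝ × ℝ) × ℝ), member F z.2 z.1 = F z := Eventually.of_forall fun _ => rfl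
  have eX := eventually_dx_slice hF e0
  have eY := eventually_dy_slice hF e0
  have eXX := eventually_dx_slice (A := fun t => dx (member F t)) hX eX
  have eXY := eventually_dy_slice (A := fun t => dx (member F t)) hX eX
  have eYY := eventually_dy_slice (A := fun t => dy (member F t)) hY eY
  have dX := dx_eventuallyEq e
  have dY := dy_eventuallyEq e
  exact
    { smooth := hF
      x_eq := eX.self_of_nhds.symm.trans (dX.self_of_nhds.trans hx)
      y_eq := eY.self_of_nhds.symm.trans (dY.self_of_nhds.trans hy)
      xx_eq := eXX.self_of_nhds.symm.trans (dx_eventuallyEq dX).self_of_nhds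
      xy_eq := eXY.self_of_nhds.symm.trans (dy_eventuallyEq dX).self_of_nhds
      yy_eq := eYY.self_of_nhds.symm.trans (dy_eventuallyEq dY).self_of_nhds }

/-- Rescaling of the values and of the parameter of a deformation. -/
lemma IsDeformation.rescale {f : ℝ × ℝ → ℝ} {F : (ℝ × ℝ) × ℝ → ℝ} (h : IsDeformation f F)
    (κ σ : ℝ) : IsDeformation (fun p => κ * f p) fun z => κ * F (z.1, σ * z.2) := by
  have hs : ContDiff ℝ ∞ fun z : (ℝ × ℝ) × ℝ => (z.1, σ * z.2) := by fun_prop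
  have ht : Tendsto (fun z : (ℝ × ℝ) × ℝ => (z.1, σ * z.2)) (𝓝 0) (𝓝 0) :=
    hs.continuous.tendsto' 0 0 (by simp)
  constructor
  · filter_upwards [ht.eventually h.1] with z hz
    exact contDiffAt_const.mul (ContDiffAt.comp z hz hs.contDiffAt)
  · filter_upwards [h.2] with p hp
    rw [mul_zero, hp]

lemma fderiv_rescale {F : (ℝ × ℝ) × ℝ → ℝ} (hF : DifferentiableAt ℝ F 0) (κ σ : ℝ) :
    fderiv ℝ (fun z : (ℝ × ℝ) × ℝ => κ * F (z.1, σ * z.2)) 0 (0, 1) =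
      κ * σ * fderiv ℝ F 0 (0, 1) := by
  let L : (ℝ × ℝ) × ℝ →L[ℝ] (ℝ × ℝ) × ℝ :=
    (ContinuousLinearMap.fst ℝ (ℝ × ℝ) ℝ).prod (σ • ContinuousLinearMap.snd ℝ (ℝ × ℝ) ℝ)
  have hL0 : L 0 = 0 := map_zero L
  have h1 : HasFDerivAt (F ∘ L) (fderiv ℝ F 0 ∘L L) 0 :=
    HasFDerivAt.comp 0 (by rw [hL0]; exact hF.hasFDerivAt) L.hasFDerivAt
  have h2 := (h1.const_mul κ).fderiv
  refine (congrArg (fun T => T (0, 1)) h2).trans ?_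
  have h3 : L (0, 1) = σ • (0, 1) := by ext <;> simp [L]
  rw [smul_apply, ContinuousLinearMap.comp_apply, h3, map_smul, smul_eq_mul, smul_eq_mul]
  ring

lemma HasA1Plus.data {f : ℝ × ℝ → ℝ} (h : HasA1Plus f) :
    f 0 = 0 ∧ dx f 0 = 0 ∧ dy f 0 = 0 ∧ 0 < dx (dx f) 0 * dy (dy f) 0 - dy (dx f) 0 ^ 2 := by
  obtain ⟨c20, c21, c22, hc, hdisc⟩ := h
  simp only [jet2, Prod.mk.injEq] at hc
  obtain ⟨h0, h1, h2, h3, h4, h5⟩ := hc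
  refine ⟨h0, h1, h2, ?_⟩
  rw [← h3, ← h4, ← h5] at hdisc
  linarith

lemma not_isUmbilic_data {f : ℝ × ℝ → ℝ} (h : HasA1Plus f) (hu : ¬ IsUmbilicAtOrigin f) :
    ¬ (dx (dx f) 0 = dy (dy f) 0 ∧ dy (dx f) 0 = 0) := by
  rintro ⟨h1, h2⟩
  obtain ⟨-, hx, hy, -⟩ := h.data
  refine hu ⟨f 0, dx f 0, dy f 0, dx (dx f) 0 / 2, dy (dx f) 0, dy (dy f) 0 / 2, dx (dx f) 0, rfl,
    ?_, ?_, ?_⟩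
  · rw [hx]; ring
  · rw [hx, h2]; ring
  · rw [hy, ← h1]; ring

/-- The sign `κ` turns a maximum into a minimum, and `σ` then makes the values decrease with the
parameter. Multiplication by `κ` changes the inflection and vertex functions only by powers of `κ`.
-/
theorem exists_sign_isOval {f : ℝ × ℝ → ℝ} (hA : HasA1Plus f) (hu : ¬ IsUmbilicAtOrigin f)
    {F : (ℝ × ℝ) × ℝ → ℝ} (hF : IsDeformation f F) (ht : fderiv ℝ F 0 (0, 1) ≠ 0) :
    ∃ σ : ℝ, (σ = 1 ∨ σ = -1) ∧ ∃ ε₀ > 0, ∀ ε, 0 < ε → ε < ε₀ → ∃ δ > 0, ∀ t, 0 < t → t < δ →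
      IsOval (member F (σ * t)) ε ∧ curve (member F (-(σ * t))) ε = ∅ := by
  obtain ⟨h0, hx, hy, hdet⟩ := hA.data
  have hne := not_isUmbilic_data hA hu
  have ha : dx (dx f) 0 ≠ 0 := by
    intro h; rw [h, zero_mul] at hdet; linarith [sq_nonneg (dy (dx f) 0)]
  obtain ⟨κ, hκ, hκa⟩ : ∃ κ : ℝ, κ ^ 2 = 1 ∧ 0 < κ * dx (dx f) 0 := by
    rcases lt_or_gt_of_ne ha with h | h
    · exact ⟨-1, by norm_num, by linarith⟩
    · exact ⟨1, by norm_num, by linarith⟩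
  have hκ0 : κ ≠ 0 := by rintro rfl; norm_num at hκ
  obtain ⟨σ, hσ, hσt⟩ : ∃ σ : ℝ, (σ = 1 ∨ σ = -1) ∧ κ * σ * fderiv ℝ F 0 (0, 1) < 0 := by
    rcases lt_or_gt_of_ne (mul_ne_zero hκ0 ht) with h | h
    · exact ⟨1, Or.inl rfl, by linarith⟩
    · exact ⟨-1, Or.inr rfl, by linarith⟩
  have hF' := hF.rescale κ σ
  have hcrit := hF'.isCriticalFamily (by simp only [dx_const_mul, hx, mul_zero])
    (by simp only [dy_const_mul, hy, mul_zero])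
  simp only [dx_const_mul, dy_const_mul] at hcrit
  have hF0 : F 0 = 0 := hF.2.self_of_nhds.trans h0
  obtain ⟨ε₀, hε₀, H⟩ := exists_isOval hcrit
    (by simp only [Prod.fst_zero, Prod.snd_zero, mul_zero]; rw [Prod.mk_zero_zero, hF0, mul_zero])
    hκa
    (by
      have : κ * dx (dx f) 0 * (κ * dy (dy f) 0) - (κ * dy (dx f) 0) ^ 2 =
        κ ^ 2 * (dx (dx f) 0 * dy (dy f) 0 - dy (dx f) 0 ^ 2) := by ring
      rwa [this, hκ, one_mul])
    (by
      rintro ⟨h1, h2⟩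
      exact hne ⟨mul_left_cancel₀ hκ0 h1, (mul_eq_zero.1 h2).resolve_left hκ0⟩)
    (by rwa [fderiv_rescale (hF.1.contDiffAt.differentiableAt (by simp))])
  refine ⟨σ, hσ, ε₀, hε₀, fun ε hε hε' => ?_⟩
  obtain ⟨δ, hδ, H'⟩ := H ε hε hε'
  refine ⟨δ, hδ, fun t ht0 htδ => ?_⟩
  obtain ⟨h1, h2⟩ := H' t ht0 htδ
  refine ⟨IsOval.of_const_mul hκ0 h1, ?_⟩
  rw [← curve_const_mul hκ0, ← mul_neg]
  exact h2

/-! ### Versal deformations -/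

lemma isDeformation_addParam {f : ℝ × ℝ → ℝ} (hf : SmoothGermAt f 0) :
    IsDeformation f (addParam f) := by
  constructor
  · have ht : Tendsto (fun z : (ℝ × ℝ) × ℝ => z.1) (𝓝 0) (𝓝 0) := continuous_fst.tendsto' _ _ rfl
    filter_upwards [ht.eventually hf] with z hz
    exact (ContDiffAt.comp z hz contDiffAt_fst).add contDiffAt_snd
  · exact Eventually.of_forall fun p => add_zero _

lemma fderiv_addParam {f : ℝ × ℝ → ℝ} (hf : SmoothGermAt f 0) :
    fderiv ℝ (addParam f) 0 (0, 1) = 1 := by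
  have h1 : HasFDerivAt (fun z : (ℝ × ℝ) × ℝ => f z.1)
      (fderiv ℝ f 0 ∘L ContinuousLinearMap.fst ℝ (ℝ × ℝ) ℝ) 0 :=
    HasFDerivAt.comp (0 : (ℝ × ℝ) × ℝ) (g := f)
      (hf.contDiffAt.differentiableAt (by simp)).hasFDerivAt hasFDerivAt_fst
  have h2 : HasFDerivAt (addParam f) _ 0 := h1.add hasFDerivAt_snd
  rw [h2.fderiv]
  simp

/-- If `∂F/∂t` vanished, the whole differential of `F` at the origin would vanish. Differentiating
`f + v = Ψ (F (Φ, h), v)` in `v` then leaves only the contribution of the second argument of `Ψ`,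
which is zero because `Ψ (0, v) = 0`; but the left side has derivative `1`. -/
lemma IsAVersal.fderiv_ne_zero {f : ℝ × ℝ → ℝ} (hf : SmoothGermAt f 0) (hA : HasA1Plus f)
    {F : (ℝ × ℝ) × ℝ → ℝ} (hF : IsAVersal f F) : fderiv ℝ F 0 (0, 1) ≠ 0 := by
  intro ht
  obtain ⟨hdef, hv⟩ := hF
  obtain ⟨h0, hx, hy, -⟩ := hA.data
  let e : EuclideanSpace ℝ (Fin 1) →L[ℝ] ℝ := EuclideanSpace.proj 0
  have hGdef : IsDeformation f
      (fun z : (ℝ × ℝ) × EuclideanSpace ℝ (Fin 1) => f z.1 + e z.2) := by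
    constructor
    · have ht : Tendsto (fun z : (ℝ × ℝ) × EuclideanSpace ℝ (Fin 1) => z.1) (𝓝 0) (𝓝 0) :=
        continuous_fst.tendsto' _ _ rfl
      filter_upwards [ht.eventually hf] with z hz
      exact (ContDiffAt.comp z hz contDiffAt_fst).add (e.contDiff.contDiffAt.comp z contDiffAt_snd)
    · exact Eventually.of_forall fun p => by simp
  obtain ⟨Φ, Ψ, h, hΦ, hΨ, hh, Φ0, -, Ψ0, hh0, heq⟩ := hv 1 _ hGdef
  have hcrit := hdef.isCriticalFamily hx hy
  have hF0 : F 0 = 0 := hdef.2.self_of_nhds.trans h0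
  have hdF : fderiv ℝ F 0 = 0 := by
    have hx' := hcrit.x_eq
    have hy' := hcrit.y_eq
    simp only [partialDeriv] at hx' hy'
    ext
    · simpa using hx'
    · simpa using hy'
    · simpa using ht
  have hΦ0 : Φ 0 = 0 := Φ0.self_of_nhds
  -- differentiate the identity along the parameter at the origin
  let v : EuclideanSpace ℝ (Fin 1) := EuclideanSpace.single 0 1
  have hev : e v = 1 := by simp [e, v]
  let inr := ContinuousLinearMap.inr ℝ (ℝ × ℝ) (EuclideanSpace ℝ (Fin 1))
  have hΦd : HasFDerivAt Φ (fderiv ℝ Φ 0) 0 :=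
    (hΦ.contDiffAt.differentiableAt (by simp)).hasFDerivAt
  have hhd : HasFDerivAt h (fderiv ℝ h 0) 0 :=
    (hh.contDiffAt.differentiableAt (by simp)).hasFDerivAt
  have hFd : HasFDerivAt F (0 : (ℝ × ℝ) × ℝ →L[ℝ] ℝ) 0 := by
    rw [← hdF]; exact (hdef.1.contDiffAt.differentiableAt (by simp)).hasFDerivAt
  have hΨd : HasFDerivAt Ψ (fderiv ℝ Ψ 0) 0 :=
    (hΨ.contDiffAt.differentiableAt (by simp)).hasFDerivAt
  have d1 : HasFDerivAt (fun z : (ℝ × ℝ) × EuclideanSpace ℝ (Fin 1) => h z.2)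
      (fderiv ℝ h 0 ∘L ContinuousLinearMap.snd ℝ (ℝ × ℝ) (EuclideanSpace ℝ (Fin 1))) 0 :=
    HasFDerivAt.comp (0 : (ℝ × ℝ) × EuclideanSpace ℝ (Fin 1)) (g := h) hhd hasFDerivAt_snd
  have d2 := hΦd.prodMk d1
  have d3 : HasFDerivAt (fun z => F (Φ z, h z.2))
      (0 : (ℝ × ℝ) × EuclideanSpace ℝ (Fin 1) →L[ℝ] ℝ) 0 := by
    have := HasFDerivAt.comp (0 : (ℝ × ℝ) × EuclideanSpace ℝ (Fin 1)) (g := F)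
      (f := fun z => (Φ z, h z.2)) (g' := 0)
      (by simp only [hΦ0, Prod.snd_zero, hh0]; exact hFd) d2
    rwa [ContinuousLinearMap.zero_comp] at this
  have d4 := d3.prodMk (hasFDerivAt_snd (𝕜 := ℝ) (p := (0 : (ℝ × ℝ) × EuclideanSpace ℝ (Fin 1))))
  have d5 : HasFDerivAt (fun z : (ℝ × ℝ) × EuclideanSpace ℝ (Fin 1) => Ψ (F (Φ z, h z.2), z.2)) _ 0 :=
    HasFDerivAt.comp (0 : (ℝ × ℝ) × EuclideanSpace ℝ (Fin 1)) (g := Ψ)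
      (f := fun z => (F (Φ z, h z.2), z.2)) (g' := fderiv ℝ Ψ 0)
      (by
        simp only [hΦ0, Prod.snd_zero, hh0]
        rw [Prod.mk_zero_zero, hF0, Prod.mk_zero_zero]
        exact hΨd) d4
  have d6 : HasFDerivAt (fun z : (ℝ × ℝ) × EuclideanSpace ℝ (Fin 1) => f z.1 + e z.2)
      (fderiv ℝ f 0 ∘L ContinuousLinearMap.fst ℝ (ℝ × ℝ) (EuclideanSpace ℝ (Fin 1)) +
        e ∘L ContinuousLinearMap.snd ℝ (ℝ × ℝ) (EuclideanSpace ℝ (Fin 1))) 0 :=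
    (HasFDerivAt.comp (0 : (ℝ × ℝ) × EuclideanSpace ℝ (Fin 1)) (g := f)
      (hf.contDiffAt.differentiableAt (by simp)).hasFDerivAt hasFDerivAt_fst).add
      (e.hasFDerivAt.comp (0 : (ℝ × ℝ) × EuclideanSpace ℝ (Fin 1)) hasFDerivAt_snd)
  have huniq := (d5.congr_of_eventuallyEq heq).unique d6
  have happ := congrArg (fun T => T (0, v)) huniq
  simp only [ContinuousLinearMap.comp_apply, ContinuousLinearMap.prod_apply, add_apply,
    ContinuousLinearMap.coe_fst', ContinuousLinearMap.coe_snd', map_zero, zero_add, hev,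
    zero_apply] at happ
  -- the target changes of coordinates fix the origin
  have d7 : HasFDerivAt (fun w : EuclideanSpace ℝ (Fin 1) => Ψ (0, w))
      (fderiv ℝ Ψ 0 ∘L ContinuousLinearMap.inr ℝ ℝ (EuclideanSpace ℝ (Fin 1))) 0 :=
    HasFDerivAt.comp (0 : EuclideanSpace ℝ (Fin 1)) (g := Ψ) hΨd
      ((hasFDerivAt_const (0 : ℝ) (0 : EuclideanSpace ℝ (Fin 1))).prodMk (hasFDerivAt_id 0))
  have d8 : HasFDerivAt (fun w : EuclideanSpace ℝ (Fin 1) => Ψ (0, w))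
      (0 : EuclideanSpace ℝ (Fin 1) →L[ℝ] ℝ) 0 :=
    (hasFDerivAt_const (0 : ℝ) (0 : EuclideanSpace ℝ (Fin 1))).congr_of_eventuallyEq Ψ0
  have happ' := congrArg (fun T => T v) (d7.unique d8)
  simp only [ContinuousLinearMap.comp_apply, ContinuousLinearMap.inr_apply, zero_apply] at happ'
  rw [happ'] at happ
  exact zero_ne_one happ

/-! ### Stratifications of the line and FRS-equivalence -/

/-- The stratification of the line by the sign. -/
def signStrata : Set (Set ℝ) := {Iio 0, {0}, Ioi 0}

lemma isSmoothSubmanifold_of_isOpen {A : Set ℝ} (hA : IsOpen A) : IsSmoothSubmanifold A :=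
  fun x hx => ⟨(OpenPartialHomeomorph.refl ℝ).restrOpen A hA, ⊤, by simpa using hx,
    contDiff_id.contDiffOn, contDiff_id.contDiffOn, fun y hy => by
      have : y ∈ A := by simpa using hy
      simp [this]⟩

lemma isSmoothSubmanifold_singleton (x : ℝ) : IsSmoothSubmanifold ({x} : Set ℝ) := by
  rintro y rfl
  refine ⟨(Homeomorph.subRight y).toOpenPartialHomeomorph, ⊥, mem_univ _, ?_, ?_, ?_⟩
  · exact (contDiff_id.sub contDiff_const).contDiffOn
  · exact (contDiff_id.add contDiff_const).contDiffOn
  · intro z _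
    simp [sub_eq_zero]

lemma isStratification_signStrata : IsStratification univ signStrata where
  finite := by simp [signStrata]
  cover := by
    refine eq_univ_of_forall fun x => ?_
    rcases lt_trichotomy x 0 with h | h | h
    · exact ⟨Iio 0, by simp [signStrata], h⟩
    · exact ⟨{0}, by simp [signStrata], h⟩
    · exact ⟨Ioi 0, by simp [signStrata], h⟩
  disjoint := by
    intro A hA B hB hne
    simp only [signStrata, mem_insert_iff, mem_singleton_iff] at hA hB
    refine Set.disjoint_left.2 fun x hxA hxB => hne ?_
    rcases hA with rfl | rfl | rfl <;> rcases hB with rfl | rfl | rfl <;>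
      simp only [id, mem_Iio, mem_Ioi, mem_singleton_iff] at hxA hxB <;>
      first | rfl | (exfalso; linarith)
  connected := by
    intro A hA
    simp only [signStrata, mem_insert_iff, mem_singleton_iff] at hA
    rcases hA with rfl | rfl | rfl
    · exact isConnected_Iio
    · exact isConnected_singleton
    · exact isConnected_Ioi
  submanifold := by
    intro A hA
    simp only [signStrata, mem_insert_iff, mem_singleton_iff] at hA
    rcases hA with rfl | rfl | rfl
    · exact isSmoothSubmanifold_of_isOpen isOpen_Iio
    · exact isSmoothSubmanifold_singleton 0
    · exact isSmoothSubmanifold_of_isOpen isOpen_Ioi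
  frontier := by
    intro A hA B hB hne
    simp only [signStrata, mem_insert_iff, mem_singleton_iff] at hA hB
    obtain ⟨x, hx, hx'⟩ := hne
    rcases hA with rfl | rfl | rfl <;> rcases hB with rfl | rfl | rfl <;>
      simp only [closure_Iio, closure_Ioi, closure_singleton, mem_Iio, mem_Ioi, mem_Iic, mem_Ici,
        mem_singleton_iff, singleton_subset_iff, Iio_subset_Iic_self, Ioi_subset_Ici_self,
        le_refl] at hx hx' ⊢ <;> exfalso <;> linarith

/-- The members of the family are ovals on one side of the origin of the parameter line, and empty
on the other side. -/
def IsOvalFamily (F : (ℝ × ℝ) × ℝ → ℝ) (σ ε δ : ℝ) : Prop :=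
  ∀ t, 0 < t → t < δ → IsOval (member F (σ * t)) ε ∧ curve (member F (-(σ * t))) ε = ∅

lemma IsOvalFamily.sameGeometry {F G : (ℝ × ℝ) × ℝ → ℝ} {σ σ' ε δ δ' : ℝ} (hσ : σ = 1 ∨ σ = -1)
    (hσ' : σ' = 1 ∨ σ' = -1) (hF : IsOvalFamily F σ ε δ) (hG : IsOvalFamily G σ' ε δ') {s s' : ℝ}
    (hs : |s| < δ) (hs' : |s'| < δ') (h : 0 < (σ * s) * (σ' * s')) :
    SameGeometry (member F s) (member G s') ε := by
  have aux : ∀ {F : (ℝ × ℝ) × ℝ → ℝ} {σ δ s : ℝ}, (σ = 1 ∨ σ = -1) → IsOvalFamily F σ ε δ →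
      |s| < δ → (0 < σ * s → IsOval (member F s) ε) ∧ (σ * s < 0 → curve (member F s) ε = ∅) := by
    intro F σ δ s hσ hF hs
    have hσ2 : σ * σ = 1 := by rcases hσ with rfl | rfl <;> norm_num
    have habs : |σ * s| < δ := by
      rw [abs_mul]; rcases hσ with rfl | rfl <;> simpa using hs
    constructor
    · intro h
      rw [abs_of_pos h] at habs
      have := (hF _ h habs).1
      rwa [← mul_assoc, hσ2, one_mul] at this
    · intro h
      rw [abs_of_neg h] at habs
      have := (hF _ (neg_pos.2 h) habs).2
      rwa [mul_neg, neg_neg, ← mul_assoc, hσ2, one_mul] at this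
  have h1 := aux hσ hF hs
  have h2 := aux hσ' hG hs'
  rcases pos_and_pos_or_neg_and_neg_of_mul_pos h with ⟨g1, g2⟩ | ⟨g1, g2⟩
  · exact (h1.1 g1).sameGeometry (h2.1 g2)
  · exact sameGeometry_of_empty (h1.2 g1) (h2.2 g2)

lemma IsOvalFamily.isAdapted {F : (ℝ × ℝ) × ℝ → ℝ} {σ ε δ : ℝ} (hσ : σ = 1 ∨ σ = -1) (hδ : 0 < δ)
    (hF : IsOvalFamily F σ ε δ) : IsAdapted signStrata F ε := by
  refine ⟨Metric.ball 0 δ, Metric.ball_mem_nhds 0 hδ, ?_⟩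
  rintro A hA s ⟨hs, hsN⟩ s' ⟨hs', hsN'⟩
  rw [mem_ball_zero_iff, Real.norm_eq_abs] at hsN hsN'
  have hσ2 : σ * σ = 1 := by rcases hσ with rfl | rfl <;> norm_num
  have e : σ * s * (σ * s') = s * s' := by linear_combination s * s' * hσ2
  simp only [signStrata, mem_insert_iff, mem_singleton_iff] at hA
  rcases hA with rfl | rfl | rfl
  · exact hF.sameGeometry hσ hσ hF hsN hsN' (by rw [e]; exact mul_pos_of_neg_of_neg hs hs')
  · rw [mem_singleton_iff] at hs hs'
    rw [hs, hs']
    exact sameGeometry_of_eqOn fun _ _ => rfl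
  · exact hF.sameGeometry hσ hσ hF hsN hsN' (by rw [e]; exact mul_pos hs hs')

/-- Multiplication by `σ σ'` matches the oval side of one family with the oval side of the other,
and either fixes or exchanges the two half-lines. -/
theorem frsEquiv_of_isOvalFamily {f : ℝ × ℝ → ℝ} {F G : (ℝ × ℝ) × ℝ → ℝ} {σ σ' ε₁ ε₂ : ℝ}
    (hσ : σ = 1 ∨ σ = -1) (hσ' : σ' = 1 ∨ σ' = -1) (hF0 : IsDeformation f F)
    (hG0 : IsDeformation f G) (hε₁ : 0 < ε₁) (hε₂ : 0 < ε₂)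
    (hF : ∀ ε, 0 < ε → ε < ε₁ → ∃ δ > 0, IsOvalFamily F σ ε δ)
    (hG : ∀ ε, 0 < ε → ε < ε₂ → ∃ δ > 0, IsOvalFamily G σ' ε δ) : FRSEquiv F G := by
  have hne : σ * σ' ≠ 0 := by
    rcases hσ with rfl | rfl <;> rcases hσ' with rfl | rfl <;> norm_num
  have hsq : σ * σ' = 1 ∨ σ * σ' = -1 := by
    rcases hσ with rfl | rfl <;> rcases hσ' with rfl | rfl <;> norm_num
  obtain ⟨ε₃, hε₃, h0⟩ := Metric.eventually_nhds_iff_ball.1 (hF0.2.and hG0.2)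
  refine ⟨(Homeomorph.mulLeft₀ (σ * σ') hne).toOpenPartialHomeomorph, signStrata, signStrata,
    mem_univ _, by simp, isStratification_signStrata, isStratification_signStrata, ?_,
    min (min ε₁ ε₂) ε₃, by positivity, ?_⟩
  · intro A hA
    simp only [signStrata, mem_insert_iff, mem_singleton_iff, Homeomorph.toOpenPartialHomeomorph_apply,
      Homeomorph.coe_mulLeft₀] at hA ⊢
    rcases hsq with h | h <;> rw [h] <;> rcases hA with rfl | rfl | rfl <;> simp
  · intro ε hε hεlt
    have h1 : ε < ε₁ := hεlt.trans_le ((min_le_left _ _).trans (min_le_left _ _))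
    have h2 : ε < ε₂ := hεlt.trans_le ((min_le_left _ _).trans (min_le_right _ _))
    have h3 : ε < ε₃ := hεlt.trans_le (min_le_right _ _)
    obtain ⟨δ, hδ, hFo⟩ := hF ε hε h1
    obtain ⟨δ', hδ', hGo⟩ := hG ε hε h2
    refine ⟨hFo.isAdapted hσ hδ, hGo.isAdapted hσ' hδ', ?_⟩
    filter_upwards [Metric.ball_mem_nhds 0 (lt_min hδ hδ')] with s hs
    rw [mem_ball_zero_iff, Real.norm_eq_abs] at hs
    show SameGeometry (member F s) (member G (σ * σ' * s)) ε
    rcases eq_or_ne s 0 with rfl | hs0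
    · rw [mul_zero]
      -- At the parameter `0` both members equal `f` on the disc, so nothing about the singular
      -- curve has to be computed.
      refine sameGeometry_of_eqOn fun p hp => ?_
      have := h0 p (mem_ball_zero_iff.2 ((norm_lt_of_mem_disc hε hp).trans h3))
      exact this.1.trans this.2.symm
    · refine hFo.sameGeometry hσ hσ' hGo (hs.trans_le (min_le_left _ _)) ?_ ?_
      · rw [abs_mul]
        rcases hsq with h | h <;> rw [h] <;> simpa using hs.trans_le (min_le_right _ _)
      · have e : σ * s * (σ' * (σ * σ' * s)) = (σ * σ') ^ 2 * s ^ 2 := by ring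
        rw [e]
        positivity

/-! ### Umbilic jets -/

/-- The first proportionality determines `lam = 2 c20 / (1 + c10²)`; eliminating it leaves
polynomial equations, from which closedness is immediate. -/
lemma mem_umbilicJets_iff (c : Jet2) : c ∈ UmbilicJets ↔
    c.2.2.2.2.1 * (1 + c.2.1 ^ 2) = 2 * c.2.2.2.1 * (c.2.1 * c.2.2.1) ∧
      c.2.2.2.2.2 * (1 + c.2.1 ^ 2) = c.2.2.2.1 * (1 + c.2.2.1 ^ 2) := by
  obtain ⟨c00, c10, c11, c20, c21, c22⟩ := c
  have hpos : 1 + c10 ^ 2 ≠ 0 := by positivity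
  constructor
  · rintro ⟨_, _, _, _, _, _, lam, h, h1, h2, h3⟩
    simp only [Prod.mk.injEq] at h
    obtain ⟨rfl, rfl, rfl, rfl, rfl, rfl⟩ := h
    refine ⟨?_, ?_⟩
    · linear_combination (1 + c10 ^ 2) * h2 - c10 * c11 * h1
    · linear_combination (1 + c10 ^ 2) / 2 * h3 - (1 + c11 ^ 2) / 2 * h1
  · rintro ⟨h1, h2⟩
    dsimp only at h1 h2
    refine ⟨c00, c10, c11, c20, c21, c22, 2 * c20 / (1 + c10 ^ 2), rfl, ?_, ?_, ?_⟩
    · field_simp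
    · field_simp; linarith
    · field_simp; linarith

lemma isOpen_compl_umbilicJets : IsOpen UmbilicJetsᶜ := by
  rw [isOpen_compl_iff]
  have : UmbilicJets = {c : Jet2 |
      c.2.2.2.2.1 * (1 + c.2.1 ^ 2) = 2 * c.2.2.2.1 * (c.2.1 * c.2.2.1)} ∩
      {c : Jet2 | c.2.2.2.2.2 * (1 + c.2.1 ^ 2) = c.2.2.2.1 * (1 + c.2.2.1 ^ 2)} := by
    ext c; exact mem_umbilicJets_iff c
  rw [this]
  exact (isClosed_eq (by fun_prop) (by fun_prop)).inter (isClosed_eq (by fun_prop) (by fun_prop))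

lemma a1PlusJets_subset_closure : A1PlusJets ⊆ closure (A1PlusJets \ UmbilicJets) := by
  rintro c ⟨c20, c21, c22, rfl, hc⟩
  by_cases hu : ((0, 0, 0, c20, c21, c22) : Jet2) ∈ UmbilicJets
  · rw [mem_umbilicJets_iff] at hu
    have h1 : c21 = 0 := by simpa using hu.1
    have h2 : c22 = c20 := by simpa using hu.2
    subst h1 h2
    have hc0 : c22 ≠ 0 := by rintro rfl; norm_num at hc
    -- Stretching one coefficient of the umbilic form by `1 + x` with `x > 0` keeps it definite and
    -- makes its eigenvalues distinct.
    have hcont : Continuous fun x : ℝ => ((0, 0, 0, c22 * (1 + x), 0, c22) : Jet2) := by fun_prop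
    have hlim : Tendsto (fun x : ℝ => ((0, 0, 0, c22 * (1 + x), 0, c22) : Jet2)) (𝓝[>] 0)
        (𝓝 (0, 0, 0, c22, 0, c22)) :=
      (hcont.tendsto' 0 _ (by simp)).mono_left nhdsWithin_le_nhds
    refine mem_closure_of_tendsto hlim ?_
    filter_upwards [self_mem_nhdsWithin] with x hx
    have hx0 : 0 < x := hx
    refine ⟨⟨_, _, _, rfl, ?_⟩, ?_⟩
    · have : 0 < c22 ^ 2 := by positivity
      nlinarith [mul_pos this hx0]
    · rw [mem_umbilicJets_iff]
      rintro ⟨-, h⟩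
      have h' : c22 * x = 0 := by
        norm_num at h
        linarith
      exact mul_ne_zero hc0 hx0.ne' h'
  · exact subset_closure ⟨⟨_, _, _, rfl, hc⟩, hu⟩

end PlaneCurve

/-! ### The theorem -/

theorem mainTheorem5 :
    -- being non-umbilic is an open and dense condition on A₁⁺-singularities
    (IsOpen PlaneCurve.UmbilicJetsᶜ ∧
      PlaneCurve.A1PlusJets ⊆ closure (PlaneCurve.A1PlusJets \ PlaneCurve.UmbilicJets)) ∧
    ∀ f : ℝ × ℝ → ℝ, PlaneCurve.SmoothGermAt f 0 → PlaneCurve.HasA1Plus f →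
      ¬ PlaneCurve.IsUmbilicAtOrigin f →
      -- every 1-parameter versal deformation is FRS-equivalent to `f + t`
      (∀ F : (ℝ × ℝ) × ℝ → ℝ, PlaneCurve.IsAVersal f F →
        PlaneCurve.FRSEquiv F (PlaneCurve.addParam f)) ∧
      -- the geometric configuration of `f + t = 0`, where `σ` is one of the two signs
      ∃ σ : ℝ, (σ = 1 ∨ σ = -1) ∧
        ∃ ε₀ > 0, ∀ ε : ℝ, 0 < ε → ε < ε₀ → ∃ δ > 0, ∀ t : ℝ, 0 < t → t < δ →
          ((PlaneCurve.vertices (PlaneCurve.member (PlaneCurve.addParam f) (σ * t)) ε).encard = 4 ∧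
            PlaneCurve.inflections (PlaneCurve.member (PlaneCurve.addParam f) (σ * t)) ε = ∅) ∧
          PlaneCurve.curve (PlaneCurve.member (PlaneCurve.addParam f) (-(σ * t))) ε = ∅ := by
  refine ⟨⟨PlaneCurve.isOpen_compl_umbilicJets, PlaneCurve.a1PlusJets_subset_closure⟩,
    fun f hf hA hu => ?_⟩
  have hG := PlaneCurve.isDeformation_addParam hf
  obtain ⟨σ, hσ, ε₀, hε₀, H⟩ := PlaneCurve.exists_sign_isOval hA hu hG
    (by rw [PlaneCurve.fderiv_addParam hf]; exact one_ne_zero)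
  refine ⟨fun F hF => ?_, σ, hσ, ε₀, hε₀, fun ε hε hε' => ?_⟩
  · obtain ⟨σ', hσ', ε₁, hε₁, H'⟩ := PlaneCurve.exists_sign_isOval hA hu hF.1
      (hF.fderiv_ne_zero hf hA)
    exact PlaneCurve.frsEquiv_of_isOvalFamily hσ' hσ hF.1 hG hε₁ hε₀ H' H
  · obtain ⟨δ, hδ, H'⟩ := H ε hε hε'
    refine ⟨δ, hδ, fun t ht htδ => ?_⟩
    obtain ⟨h1, h2⟩ := H' t ht htδ
    exact ⟨⟨h1.encard_vertices, h1.inflections_eq⟩, h2⟩
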